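/- **Setting.** A noiseless protocol $\Pi$ of even length $N$ has finite-dimensional registers $A$ (Alice), $B$ (Bob), a one-qubit communication register $C$ passed back and forth (first held by Alice), and a finite-dimensional reference register $E$. It is a sequence of unitaries $U_1,\dots,U_{N+1}$, with $U_i$ acting on $AC$ for odd $i$ and on $BC$ for even $i$. It induces the channel $\Pi(\rho)=\mathrm{Tr}_E\big(U_{N+1}\cdots U_1\,\rho\,U_1^\dagger\cdots U_{N+1}^\dagger\big)$ from $ABCE$ to $ABC$. In the *shared entanglement model*, a universal simulator $S$ of length $N'$ (even) with alphabet size $q\ge 2$ uses $k$ EPR pairs shared by Alice and Bob and $N'$ transmissions of a classical symbol in $\{0,\dots,q-1\}$, alternately from Alice to Bob and from Bob to Alice, after each of which the receiver acts. In her turns Alice performs, on her classical memory and the classical symbol, a qubit register $C_A$ (initially holding $C$), scratch registers and her halves of the EPR pairs, any finite sequence of quantum instruments, interleaved with classically controlled black-box uses of $U_j$ or $U_j^{-1}$ ($j$ odd) on $AC_A$ and swaps of $A$ with an isomorphic dummy register $\tilde A$. Bob acts likewise with $C_B$, $B$, $\tilde B$ and $j$ even. $S$ may depend on $N$, but not on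 $\Pi$, on the input or on the dimensions of $A$, $B$, $E$. The output consists of $\tilde A$, $\tilde B$ and a qubit $\tilde C$ of Alice, everything else being traced out. Each transmitted symbol passes through an adversary, who holds $E$, a finite quantum scratch register and a finite classical register, and who applies to these and to the symbol an arbitrary quantum instrument, so that she may read and change symbols adaptively and at random. Write $S^\Pi(\mathcal A)$ for the resulting channel from $ABCE$ to $ABC$. The class $\mathcal A_\delta^S$ consists of the adversaries such that, whatever symbols are sent, in every branch of her operations that can occur at most $\delta N'$ of the $N'$ delivered symbols differ from the symbols sent. The simulator *succeeds with error $\epsilon$* at simulating all protocols of length $N$ against $\mathcal A^S_\delta$ if $\|\Pi-S^\Pi(\mathcal A)\|_\diamond\le\epsilon$ for all $\Pi$ of length $N$ (all $A$, $B$, $E$) and all $\mathcal A\in\mathcal A_\delta^S$. Its communication rate is $\frac{N}{N'\log_2 q}$, and its entanglement consumption rate is $\frac{k}{N'\log_2 q}$. **Theorem.** Let $\delta=\frac1{80}$. There exist a communication rate $R_C>0$, an alphabet size $q\in\mathbb N$, $q\ge 2$, and an entanglement consumption rate $R_E>0$ such that for every even $N\ge 2$ there exists a universal simulator $S$ in the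 shared entanglement model with alphabet size $q$, communication rate at least $R_C$ and entanglement consumption rate $R_E$ (hence with $O(N)$ transmissions and $O(N)$ EPR pairs) which succeeds with zero error at simulating all noiseless protocols of length $N$ against all adversaries in $\mathcal A_\delta^S$. -/

import Mathlib

open scoped Kronecker ENNReal ComplexOrder

noncomputable section

namespace QInteractive

/-! ## Linear maps on matrices, trace norm and diamond norm

A register is represented by the finite type that indexes its computational basis; a qubit is
`Bool`, with `false` for the basis vector 0. A state is a matrix over the basis. -/

/-- The linear map `ρ ↦ K ρ Kᴴ`. -/
def conjMap {m n : Type} [Fintype n] (K : Matrix m n ℂ) :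
    Matrix n n ℂ →ₗ[ℂ] Matrix m m ℂ where
  toFun ρ := K * ρ * K.conjTranspose
  map_add' ρ σ := by simp [Matrix.mul_add, Matrix.add_mul]
  map_smul' c ρ := by simp

/-- Partial trace. The basis of the whole system is reached by `f i t`, where `i` is an index of
the part that is kept and `t` an index of the part that is traced out. -/
def partialTrace {o t m : Type} [Fintype t] (f : o → t → m) :
    Matrix m m ℂ →ₗ[ℂ] Matrix o o ℂ where
  toFun ρ := Matrix.of fun i j => ∑ s, ρ (f i s) (f j s)
  map_add' ρ σ := by ext i j; simp [Finset.sum_add_distrib]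
  map_smul' c ρ := by ext i j; simp [Finset.mul_sum]

/-- Density operators. -/
def IsDensity {n : Type} [Fintype n] (σ : Matrix n n ℂ) : Prop :=
  σ.PosSemidef ∧ σ.trace = 1

/-- The trace norm `Tr √(Oᴴ O)`, i.e. the sum of the square roots of the eigenvalues of `Oᴴ O`. -/
def traceNorm {n : Type} [Fintype n] [DecidableEq n] (O : Matrix n n ℂ) : ℝ :=
  ∑ i, Real.sqrt ((Matrix.isHermitian_conjTranspose_mul_self O).eigenvalues i)

/-- The map `Φ ⊗ id` with a reference register `r`. -/
def withReference {n m : Type} (r : Type) (Φ : Matrix n n ℂ →ₗ[ℂ] Matrix m m ℂ)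
    (σ : Matrix (n × r) (n × r) ℂ) : Matrix (m × r) (m × r) ℂ :=
  Matrix.of fun p p' => Φ (Matrix.of fun i j => σ (i, p.2) (j, p'.2)) p.1 p'.1

/-- The diamond norm: the supremum of the trace norm of `(Φ ⊗ id) σ` over the density operators
`σ` on the input register and a reference register of the same dimension. -/
def diamondNorm {n m : Type} [Fintype n] [Fintype m] [DecidableEq n] [DecidableEq m]
    (Φ : Matrix n n ℂ →ₗ[ℂ] Matrix m m ℂ) : ℝ≥0∞ :=
  ⨆ σ : {σ : Matrix (n × n) (n × n) ℂ // IsDensity σ},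
    ENNReal.ofReal (traceNorm (withReference n Φ σ.1))

/-! ## Noiseless protocols -/

/-- A noiseless protocol of (even) length `N` with local registers `a` (Alice), `b` (Bob) and a
one-qubit communication register: unitaries `U₁, …, U_{N+1}`. `alice k` is `U_{2k+1}`, acting on
Alice's register and the communication register; `bob k` is `U_{2k+2}`, acting on Bob's register
and the communication register. -/
structure NoiselessProtocol (N : ℕ) (a b : Type)
    [Fintype a] [DecidableEq a] [Fintype b] [DecidableEq b] where
  alice : Fin (N / 2 + 1) → Matrix.unitaryGroup (a × Bool) ℂ
  bob : Fin (N / 2) → Matrix.unitaryGroup (b × Bool) ℂ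

/-- An operator on registers `A C`, acting on `A B C E`. -/
def onAC {a : Type} (b e : Type) [DecidableEq b] [DecidableEq e]
    (U : Matrix (a × Bool) (a × Bool) ℂ) : Matrix (a × b × Bool × e) (a × b × Bool × e) ℂ :=
  Matrix.of fun (i, j, c, x) (i', j', c', x') =>
    if j = j' ∧ x = x' then U (i, c) (i', c') else 0

/-- An operator on registers `B C`, acting on `A B C E`. -/
def onBC {b : Type} (a e : Type) [DecidableEq a] [DecidableEq e]
    (U : Matrix (b × Bool) (b × Bool) ℂ) : Matrix (a × b × Bool × e) (a × b × Bool × e) ℂ :=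
  Matrix.of fun (i, j, c, x) (i', j', c', x') =>
    if i = i' ∧ x = x' then U (j, c) (j', c') else 0

namespace NoiselessProtocol

variable {N : ℕ} {a b : Type} [Fintype a] [DecidableEq a] [Fintype b] [DecidableEq b]

/-- The product `U_{N+1} U_N ⋯ U₂ U₁` on the registers `A B C E`. -/
def evolution (P : NoiselessProtocol N a b) (e : Type) [Fintype e] [DecidableEq e] :
    Matrix (a × b × Bool × e) (a × b × Bool × e) ℂ :=
  onAC b e (P.alice (Fin.last _)).1 *
    (List.ofFn fun k : Fin (N / 2) =>
      onBC a e (P.bob k).1 * onAC b e (P.alice k.castSucc).1).reverse.prod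

/-- The channel from `A B C E` to `A B C` that the noiseless protocol implements: apply all the
unitaries, then trace out `E`. -/
def channel (P : NoiselessProtocol N a b) (e : Type) [Fintype e] [DecidableEq e] :
    Matrix (a × b × Bool × e) (a × b × Bool × e) ℂ →ₗ[ℂ]
      Matrix (a × b × Bool) (a × b × Bool) ℂ :=
  partialTrace (fun (i, j, c) (x : e) => (i, j, c, x)) ∘ₗ conjMap (P.evolution e)

end NoiselessProtocol

/-! ## Classical-quantum states and instruments

A classical-quantum state with classical register `M` and quantum register `P` is a function
`M → Matrix P P ℂ` (value `m` of the classical register, with the unnormalized state of the quantum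
register conditioned on it). -/

/-- A family of Kraus operators: `op m m' k` are the Kraus operators of the completely positive
map that takes the classical value `m` to `m'`. -/
structure KrausFamily (M P : Type) where
  rank : ℕ
  op : M → M → Fin rank → Matrix P P ℂ

/-- The linear map on classical-quantum states given by a family of Kraus operators. -/
def KrausFamily.act {M P : Type} [Fintype M] [Fintype P] (F : KrausFamily M P) :
    (M → Matrix P P ℂ) →ₗ[ℂ] (M → Matrix P P ℂ) :=
  LinearMap.pi fun m' => ∑ m, ∑ k, conjMap (F.op m m' k) ∘ₗ LinearMap.proj m

/-- A quantum instrument: the family is trace preserving. -/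
structure Instrument (M P : Type) [Fintype M] [Fintype P] [DecidableEq P]
    extends KrausFamily M P where
  complete : ∀ m, ∑ m', ∑ k, (op m m' k).conjTranspose * op m m' k = 1

/-! ## Local operations with black-box access -/

/-- An elementary local operation of a party that has black-box access to unitaries indexed by `J`.
`M` is the classical memory of the party (with the classical channel register), `V` is the quantum
register that it holds besides its four registers below, which are `Bool` for the qubit on which
the black box acts (`C_A` or `C_B`), `r` for its input register (`A` or `B`) and another copy of `r`
for the dummy register (`Ã` or `B̃`). The type `r` is unknown to the operations.
* `instr`: any instrument on the communication qubit and `V`;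
* `query`: depending on the classical memory, apply to the input register and the communication
  qubit the black box `U_j`, (`some (j, false)`), or its inverse (`some (j, true)`), or nothing;
* `swap`: depending on the classical memory, exchange the input register and its dummy copy. -/
inductive LocalOp (J M V : Type) [Fintype M] [Fintype V] [DecidableEq V] where
  | instr (I : Instrument M (Bool × V))
  | query (f : M → Option (J × Bool))
  | swap (f : M → Bool)

/-- An operator on the input register and the communication qubit, acting on
(input register, dummy register, communication qubit, rest). -/
def liftQuery {r : Type} (V : Type) [DecidableEq r] [DecidableEq V]
    (U : Matrix (r × Bool) (r × Bool) ℂ) : Matrix (r × r × Bool × V) (r × r × Bool × V) ℂ :=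
  Matrix.of fun (i, d, c, v) (i', d', c', v') =>
    if d = d' ∧ v = v' then U (i, c) (i', c') else 0

/-- The exchange of the input register and the dummy register. -/
def swapMatrix (r V : Type) [DecidableEq r] [DecidableEq V] :
    Matrix (r × r × Bool × V) (r × r × Bool × V) ℂ :=
  Matrix.of fun (i, d, w) (i', d', w') => if i = d' ∧ d = i' ∧ w = w' then 1 else 0

/-- The Kraus operators of an elementary local operation, for given black-box unitaries. -/
def LocalOp.kraus {J M V r : Type} [Fintype M] [DecidableEq M] [Fintype V] [DecidableEq V]
    [Fintype r] [DecidableEq r] (U : J → Matrix.unitaryGroup (r × Bool) ℂ) :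
    LocalOp J M V → KrausFamily M (r × r × Bool × V)
  | .instr I => ⟨I.rank, fun m m' k => (1 : Matrix r r ℂ) ⊗ₖ ((1 : Matrix r r ℂ) ⊗ₖ I.op m m' k)⟩
  | .query f => ⟨1, fun m m' _ => if m = m' then
      match f m with
      | none => 1
      | some (j, false) => liftQuery V (U j).1
      | some (j, true) => liftQuery V (U j).1.conjTranspose
      else 0⟩
  | .swap f => ⟨1, fun m m' _ => if m = m' then (if f m then swapMatrix r V else 1) else 0⟩

/-! ## Simulators in the shared entanglement model -/

/-- A universal simulator, in the shared entanglement model, for noiseless protocols of length `N`,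
with a classical channel register of alphabet size `q`. It consists of `2 * rounds` transmissions,
alternating between Alice and Bob and beginning with Alice, and it uses `pairs` EPR pairs. -/
structure Simulator (N q : ℕ) where
  two_le : 2 ≤ q
  /-- Half the number of transmissions. -/
  rounds : ℕ
  /-- The number of shared EPR pairs. -/
  pairs : ℕ
  /-- Classical registers of Alice and Bob, with initial values. -/
  X : Type
  Y : Type
  x₀ : X
  y₀ : Y
  /-- Quantum scratch registers of Alice and Bob, with initial basis vectors. -/
  WA : Type
  WB : Type
  wA₀ : WA
  wB₀ : WB
  [fintypeX : Fintype X]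
  [fintypeY : Fintype Y]
  [fintypeWA : Fintype WA]
  [fintypeWB : Fintype WB]
  [decidableEqX : DecidableEq X]
  [decidableEqY : DecidableEq Y]
  [decidableEqWA : DecidableEq WA]
  [decidableEqWB : DecidableEq WB]
  /-- The operations of Alice in her turns `0, …, rounds`, first operation first. She acts on her
  classical register and the channel register, on `C_A`, and on `C̃`, her scratch register and
  her halves of the EPR pairs. Her black boxes are `U_{2k+1}`. -/
  alice : ℕ → List (LocalOp (Fin (N / 2 + 1)) (X × Fin q) (Bool × WA × (Fin pairs → Bool)))
  /-- The operations of Bob in his turns `0, …, rounds - 1`. He acts on his classical register and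
  the channel register, on `C_B`, and on his scratch register and his halves of the EPR
  pairs. His black boxes are `U_{2k+2}`. -/
  bob : ℕ → List (LocalOp (Fin (N / 2)) (Y × Fin q) (WB × (Fin pairs → Bool)))

attribute [instance] Simulator.fintypeX Simulator.fintypeY Simulator.fintypeWA Simulator.fintypeWB
  Simulator.decidableEqX Simulator.decidableEqY Simulator.decidableEqWA Simulator.decidableEqWB

/-! ## Adversaries -/

/-- An adversary with reference register `e`: a sequence of instruments (the `i`th is applied to the
`i`th transmission), acting on her classical register `Z` and the classical channel register, and
on her quantum register, which consists of `e` and a scratch register `W`. -/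
structure Adversary (q : ℕ) (e : Type) [Fintype e] [DecidableEq e] where
  Z : Type
  z₀ : Z
  W : Type
  w₀ : W
  [fintypeZ : Fintype Z]
  [fintypeW : Fintype W]
  [decidableEqZ : DecidableEq Z]
  [decidableEqW : DecidableEq W]
  step : ℕ → Instrument (Z × Fin q) (e × W)

attribute [instance] Adversary.fintypeZ Adversary.fintypeW
  Adversary.decidableEqZ Adversary.decidableEqW

namespace Adversary

variable {q : ℕ} {e : Type} [Fintype e] [DecidableEq e]

/-- The operator that the first `n` steps of the adversary apply to her quantum register when her
classical register goes through `z 0, z 1, …`, the symbol sent in transmission `i` is `s i`, the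
symbol delivered is `t i`, and the Kraus operator number `k i` is the one that occurs. -/
def trajectoryOp (E : Adversary q e) (z : ℕ → E.Z) (s t : ℕ → Fin q)
    (k : ∀ i, Fin (E.step i).rank) : ℕ → Matrix (e × E.W) (e × E.W) ℂ
  | 0 => 1
  | n + 1 => (E.step n).op (z n, s n) (z (n + 1), t n) (k n) * trajectoryOp E z s t k n

/-- The adversaries that corrupt at most a fraction `δ` of `L` transmissions: whatever is sent, in
every branch that can occur (i.e. does so with positive probability for some state of her quantum
register), at most `δ L` of the symbols delivered differ from those sent. She may read all symbols,
and choose adaptively and at random which to corrupt and how. -/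
def CorruptsAtMost (E : Adversary q e) (δ : ℝ) (L : ℕ) : Prop :=
  ∀ (z : ℕ → E.Z) (s t : ℕ → Fin q) (k : ∀ i, Fin (E.step i).rank),
    z 0 = E.z₀ → E.trajectoryOp z s t k L ≠ 0 →
      (((Finset.range L).filter fun i => s i ≠ t i).card : ℝ) ≤ δ * L

end Adversary

/-! ## Execution of a simulator against an adversary -/

namespace Simulator

variable {N q : ℕ}

/-- The number of transmissions. -/
def length (S : Simulator N q) : ℕ := 2 * S.rounds

/-- The communication rate. -/
def communicationRate (S : Simulator N q) : ℝ :=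
  N / (S.length * Real.logb 2 q)

/-- The entanglement consumption rate; the registers that hold the halves of the EPR pairs have
dimension `2 ^ pairs`. -/
def entanglementRate (S : Simulator N q) : ℝ :=
  S.pairs / (S.length * Real.logb 2 q)

/-- Quantum registers of Alice: `A, Ã, C_A, C̃`, scratch, halves of the EPR pairs. -/
abbrev AliceReg (S : Simulator N q) (a : Type) : Type :=
  a × a × Bool × Bool × S.WA × (Fin S.pairs → Bool)

/-- Quantum registers of Bob: `B, B̃, C_B`, scratch, halves of the EPR pairs. -/
abbrev BobReg (S : Simulator N q) (b : Type) : Type :=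
  b × b × Bool × S.WB × (Fin S.pairs → Bool)

instance (S : Simulator N q) : DecidableEq (S.WA × (Fin S.pairs → Bool)) := inferInstance

instance (S : Simulator N q) : DecidableEq (S.WB × (Fin S.pairs → Bool)) := inferInstance

instance (S : Simulator N q) (a : Type) [DecidableEq a] : DecidableEq (S.AliceReg a) :=
  inferInstance

instance (S : Simulator N q) (b : Type) [DecidableEq b] : DecidableEq (S.BobReg b) :=
  inferInstance

variable {e : Type} [Fintype e] [DecidableEq e]

/-- All classical registers: those of Alice, Bob and Eve, and the channel register. -/
abbrev Classical (S : Simulator N q) (E : Adversary q e) : Type :=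
  S.X × S.Y × E.Z × Fin q

/-- All quantum registers. -/
abbrev Quantum (S : Simulator N q) (a b : Type) (E : Adversary q e) : Type :=
  S.AliceReg a × S.BobReg b × (e × E.W)

/-- Global classical-quantum states. -/
abbrev GlobalState (S : Simulator N q) (a b : Type) (E : Adversary q e) : Type :=
  S.Classical E → Matrix (S.Quantum a b E) (S.Quantum a b E) ℂ

variable {a b : Type} [Fintype a] [DecidableEq a] [Fintype b] [DecidableEq b]

/-- Operations on the registers of Alice and the channel register, as global operations. -/
def onAlice (S : Simulator N q) (b : Type) [DecidableEq b] (E : Adversary q e)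
    (F : KrausFamily (S.X × Fin q) (S.AliceReg a)) :
    KrausFamily (S.Classical E) (S.Quantum a b E) :=
  ⟨F.rank, fun (x, y, z, c) (x', y', z', c') k =>
    if y = y' ∧ z = z' then
      F.op (x, c) (x', c') k ⊗ₖ (1 : Matrix (S.BobReg b × (e × E.W)) (S.BobReg b × (e × E.W)) ℂ)
    else 0⟩

/-- Operations on the registers of Bob and the channel register, as global operations. -/
def onBob (S : Simulator N q) (a : Type) [DecidableEq a] (E : Adversary q e)
    (F : KrausFamily (S.Y × Fin q) (S.BobReg b)) :
    KrausFamily (S.Classical E) (S.Quantum a b E) :=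
  ⟨F.rank, fun (x, y, z, c) (x', y', z', c') k =>
    if x = x' ∧ z = z' then
      (1 : Matrix (S.AliceReg a) (S.AliceReg a) ℂ) ⊗ₖ
        (F.op (y, c) (y', c') k ⊗ₖ (1 : Matrix (e × E.W) (e × E.W) ℂ))
    else 0⟩

/-- Operations on the registers of Eve and the channel register, as global operations. -/
def onEve (S : Simulator N q) (a b : Type) [DecidableEq a] [DecidableEq b] (E : Adversary q e)
    (F : KrausFamily (E.Z × Fin q) (e × E.W)) :
    KrausFamily (S.Classical E) (S.Quantum a b E) :=
  ⟨F.rank, fun (x, y, z, c) (x', y', z', c') k =>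
    if x = x' ∧ y = y' then
      (1 : Matrix (S.AliceReg a) (S.AliceReg a) ℂ) ⊗ₖ
        ((1 : Matrix (S.BobReg b) (S.BobReg b) ℂ) ⊗ₖ F.op (z, c) (z', c') k)
    else 0⟩

/-- The turn number `i` of Alice, with black-box access to the protocol `P`. -/
def aliceTurn (S : Simulator N q) (P : NoiselessProtocol N a b) (E : Adversary q e) (i : ℕ) :
    S.GlobalState a b E →ₗ[ℂ] S.GlobalState a b E :=
  (S.alice i).foldl (fun T o => (S.onAlice b E (o.kraus P.alice)).act ∘ₗ T) LinearMap.id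

/-- The turn number `i` of Bob, with black-box access to the protocol `P`. -/
def bobTurn (S : Simulator N q) (P : NoiselessProtocol N a b) (E : Adversary q e) (i : ℕ) :
    S.GlobalState a b E →ₗ[ℂ] S.GlobalState a b E :=
  (S.bob i).foldl (fun T o => (S.onBob a E (o.kraus P.bob)).act ∘ₗ T) LinearMap.id

/-- The action of Eve on transmission number `i`. -/
def eveTurn (S : Simulator N q) (a b : Type) [Fintype a] [DecidableEq a] [Fintype b]
    [DecidableEq b] (E : Adversary q e) (i : ℕ) :
    S.GlobalState a b E →ₗ[ℂ] S.GlobalState a b E :=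
  (S.onEve a b E (E.step i).toKrausFamily).act

/-- The first `n` rounds. In each of them Alice acts, her symbol passes through Eve to Bob, Bob
acts, and his symbol passes through Eve to Alice. -/
def runRounds (S : Simulator N q) (P : NoiselessProtocol N a b) (E : Adversary q e) :
    ℕ → (S.GlobalState a b E →ₗ[ℂ] S.GlobalState a b E)
  | 0 => LinearMap.id
  | n + 1 => S.eveTurn a b E (2 * n + 1) ∘ₗ S.bobTurn P E n ∘ₗ
      S.eveTurn a b E (2 * n) ∘ₗ S.aliceTurn P E n ∘ₗ runRounds S P E n

/-- The coefficients, in the computational basis, of `p` EPR pairs `(|00⟩ + |11⟩) / √2`. -/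
def eprPairs (p : ℕ) (s t : Fin p → Bool) : ℂ :=
  ∏ i, if s i = t i then ((Real.sqrt 2 : ℝ) : ℂ)⁻¹ else 0

/-- The isometry that takes the input on `A B C E` to the initial state of all quantum registers:
`C` is put into `C_A`, the registers of the EPR pairs hold EPR pairs, and all other registers are in
their initial basis vector. -/
def prepare (S : Simulator N q) (a b : Type) [DecidableEq a] [DecidableEq b]
    [Inhabited a] [Inhabited b] (E : Adversary q e) :
    Matrix (S.Quantum a b E) (a × b × Bool × e) ℂ :=
  Matrix.of fun ((i, i', cA, c', wA, tA), (j, j', cB, wB, tB), (x, w)) (i₀, j₀, c₀, x₀) =>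
    if (i = i₀ ∧ j = j₀ ∧ cA = c₀ ∧ x = x₀) ∧
        (i' = default ∧ j' = default ∧ c' = false ∧ cB = false) ∧
        (wA = S.wA₀ ∧ wB = S.wB₀ ∧ w = E.w₀) then
      eprPairs S.pairs tA tB
    else 0

/-- The initial values of the classical registers. -/
def initialClassical (S : Simulator N q) (E : Adversary q e) : S.Classical E :=
  (S.x₀, S.y₀, E.z₀, ⟨0, lt_of_lt_of_le Nat.zero_lt_two S.two_le⟩)

/-- The channel from `A B C E` to `A B C` that the simulator implements, for the protocol `P` and
against the adversary `E`: prepare the registers, run all rounds, let Alice act a last time, and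
output `Ã B̃ C̃`, all other registers being discarded. -/
def channel [Inhabited a] [Inhabited b] (S : Simulator N q) (P : NoiselessProtocol N a b)
    (E : Adversary q e) :
    Matrix (a × b × Bool × e) (a × b × Bool × e) ℂ →ₗ[ℂ]
      Matrix (a × b × Bool) (a × b × Bool) ℂ :=
  partialTrace
      (fun (i', j', c') ((i, cA, wA, tA), (j, cB, wB, tB), (y : e × E.W)) =>
        (((i, i', cA, c', wA, tA), (j, j', cB, wB, tB), y) : S.Quantum a b E)) ∘ₗ
    (∑ m : S.Classical E, LinearMap.proj m) ∘ₗ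
    S.aliceTurn P E S.rounds ∘ₗ S.runRounds P E S.rounds ∘ₗ
    LinearMap.single ℂ (fun _ : S.Classical E => Matrix (S.Quantum a b E) (S.Quantum a b E) ℂ)
      (S.initialClassical E) ∘ₗ
    conjMap (S.prepare a b E)

/-- The simulator succeeds with error `ε` at simulating all noiseless protocols of length `N`
against all adversaries that corrupt at most a fraction `δ` of the transmissions. -/
def SucceedsWithError (S : Simulator N q) (δ ε : ℝ) : Prop :=
  ∀ (a b e : Type) [Fintype a] [DecidableEq a] [Inhabited a] [Fintype b] [DecidableEq b]
    [Inhabited b] [Fintype e] [DecidableEq e]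
    (P : NoiselessProtocol N a b) (E : Adversary q e),
    E.CorruptsAtMost δ S.length →
      diamondNorm (P.channel e - S.channel P E) ≤ ENNReal.ofReal ε

end Simulator

end QInteractive

end

set_option linter.unusedSectionVars false

noncomputable section

namespace QInteractive

/-! ## Tree codes -/

section TreeCode

variable {Γ : Type} {p : ℕ}

/-! The communication qubit is teleported at every transmission through a fresh EPR pair, so the
adversary only touches classical symbols. A message consists of the Pauli operator applied, the
direction of the move and the Bell outcome. The true messages of both parties determine, up to a
scalar and up to the adversary's own operation, the word (`Todo`) of operations that separates the
current state from the result of the protocol. A party that acts on a false belief applies an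
invertible operation, which merely puts its inverse in front of the word (`Leads.turn`); nothing is
ever lost.

Each stream of messages is protected by a tree code over an alphabet of constant size, a random
convolutional code (`exists_isTreeCode`). With minimum distance decoding, the turns taken on a
wrongly decoded transcript number at most four times the corrupted symbols (`badCount_le`). A party
that decodes correctly knows the word: it undoes the leading Pauli operator and, if the first letter
is its own, removes it. A round without error thus shortens a nonempty word, and each bad turn costs
at most two letters (`progress_alice`, `progress_bob`).

The protocol is padded. The initial word has two letters on each of `K = 4N` edges of the integer
line: the black boxes come first, the exchange of the communication qubit with `C̃` sits on edge `N
/ 2 + 1`, and all later edges carry the identity. After `2K = 8N` rounds with `k` corruptions at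
most `8k` letters remain. Those of each party form a walk that ends at `K`, hence all lie on edges
from `K - 8k` on (`AliceReady.le_edge`). Since `k ≤ 16N / 80 = N / 5`, one has `K - 8k ≥ 12N / 5 ≥ N
/ 2 + 2`, so the remaining letters act trivially: the result is in `A`, `B`, `C̃`, and only an
operator on the discarded communication qubit is undetermined (`Leads.eq_of_idle`).

In every branch the simulation is therefore the unitary `U` of the protocol followed by an operator
from `E` to discarded registers (`FactorsThrough`). The output has the form `∑ Q y y' ⟨y| U ρ U*
|y'⟩` with `y`, `y'` in the basis of `E` and `Q` independent of `ρ`. As the simulation preserves the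
trace, `Q` is the identity (`eq_of_trace_eq`), and the two channels agree exactly. -/

/-- The difference, `k` steps before the end, of the codewords of two words of length `l`
(indexed backwards in time). -/
def syndrome (ι : Γ → ZMod p) (g : ℕ → ZMod p) (l : ℕ) (u v : ℕ → Γ) (k : ℕ) : ZMod p :=
  ∑ j ∈ Finset.Ico k l, g (j - k) * (ι (u j) - ι (v j))

/-- The generators (vanishing from `n` on) that annihilate the syndromes at `S`. -/
theorem card_generators_mul_le [Fact p.Prime] {ι : Γ → ZMod p} (hι : Function.Injective ι) {n l : ℕ}
    (hl : l + 1 ≤ n) (u v : ℕ → Γ) (huv : u l ≠ v l) (S : Finset (Fin (l + 1))) :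
    Nat.card {g : Fin n → ZMod p // ∀ k ∈ S,
      syndrome ι (fun j => if h : j < n then g ⟨j, h⟩ else 0) (l + 1) u v k = 0} * p ^ S.card
      ≤ p ^ n := by
  classical
  set B := {g : Fin n → ZMod p // ∀ k ∈ S,
      syndrome ι (fun j => if h : j < n then g ⟨j, h⟩ else 0) (l + 1) u v k = 0}
  -- Overwriting the coordinates `l - k`, `k ∈ S`, of `g` by free values loses nothing: the equation
  -- at `k` has top term `g (l - k) * (ι (u l) - ι (v l))` with nonzero second factor, so it
  -- recovers `g (l - k)` from the earlier coordinates.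
  let Φ : B × (S → ZMod p) → (Fin n → ZMod p) := fun x i =>
    if h : ∃ k : S, (i : ℕ) + (k : Fin (l + 1)) = l then x.2 h.choose else x.1.1 i
  have hΦ : Function.Injective Φ := by
    rintro ⟨⟨g, hg⟩, h⟩ ⟨⟨g', hg'⟩, h'⟩ he
    have hh : h = h' := by
      funext k
      have hk := k.1.2
      have := congrFun he ⟨l - k.1, by omega⟩
      have hex : ∃ k' : S, (l - (k.1 : ℕ)) + (k' : Fin (l + 1)) = l := ⟨k, by omega⟩
      simp only [Φ, dif_pos hex] at this
      have hc : hex.choose = k := by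
        have := hex.choose_spec
        apply Subtype.ext; apply Fin.ext; omega
      rwa [hc] at this
    have hgg : ∀ m (hm : m < n), g ⟨m, hm⟩ = g' ⟨m, hm⟩ := by
      intro m
      induction m using Nat.strong_induction_on with
      | _ m ih =>
        intro hm
        by_cases hex : ∃ k : S, m + (k : Fin (l + 1)) = l
        · obtain ⟨⟨k, hkS⟩, hk⟩ := hex
          have h1 := hg k hkS
          have h2 := hg' k hkS
          have hkl := k.2
          dsimp only at hk
          unfold syndrome at h1 h2
          rw [Finset.sum_Ico_succ_top (by omega)] at h1 h2
          have e : ∑ j ∈ Finset.Ico (k : ℕ) l, (if h : j - k < n then g ⟨j - k, h⟩ else 0) *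
                (ι (u j) - ι (v j)) = ∑ j ∈ Finset.Ico (k : ℕ) l,
                (if h : j - k < n then g' ⟨j - k, h⟩ else 0) * (ι (u j) - ι (v j)) := by
            refine Finset.sum_congr rfl fun j hj => ?_
            rw [Finset.mem_Ico] at hj
            rw [dif_pos (by omega), dif_pos (by omega), ih _ (by omega)]
          rw [e] at h1
          have h3 := add_left_cancel (h1.trans h2.symm)
          have hne : ι (u l) - ι (v l) ≠ 0 := sub_ne_zero.2 fun h => huv (hι h)
          have h4 := mul_right_cancel₀ hne h3
          have hm' : l - (k : ℕ) = m := by omega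
          simpa [hm', hm] using h4
        · have := congrFun he ⟨m, hm⟩
          simpa only [Φ, dif_neg hex] using this
    refine Prod.ext (Subtype.ext (funext fun i => hgg i.1 i.2)) hh
  have := Nat.card_le_card_of_injective Φ hΦ
  rw [Nat.card_prod] at this
  simpa [Nat.card_eq_fintype_card, Fintype.card_fun, ZMod.card] using this

/-- Union bound over `(u, v, S)` with `S` a set of more than half of the positions. With `d` letters
there are at most `(2 d²) ^ (l + 1)` such triples of length `l + 1`, and each excludes a fraction `p
^ (-|S|) ≤ (4 d²) ^ (-(l + 1))` of the generators. The sum of `2 ^ (-(l + 1))` over `l < n` is below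
1. -/
theorem exists_generator [Fintype Γ] [Nonempty Γ] [Fact p.Prime] {ι : Γ → ZMod p}
    (hι : Function.Injective ι) (hp : (4 * Fintype.card Γ ^ 2) ^ 2 ≤ p) (n : ℕ) :
    ∃ g : ℕ → ZMod p, ∀ l < n, ∀ u v : ℕ → Γ, u l ≠ v l →
      2 * ((Finset.range (l + 1)).filter fun k => syndrome ι g (l + 1) u v k = 0).card ≤ l + 1 := by
  classical
  by_contra! hcon
  obtain ⟨x₀⟩ := ‹Nonempty Γ›
  set d := Fintype.card Γ with hd
  have hd1 : 1 ≤ d := Fintype.card_pos_iff.2 ⟨x₀⟩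
  let ext : ∀ {l : ℕ}, (Fin (l + 1) → Γ) → ℕ → Γ := fun {l} u j =>
    if h : j < l + 1 then u ⟨j, h⟩ else x₀
  let I (l : ℕ) := (Fin (l + 1) → Γ) × (Fin (l + 1) → Γ) × Finset (Fin (l + 1))
  let toN : (Fin n → ZMod p) → ℕ → ZMod p := fun g j => if h : j < n then g ⟨j, h⟩ else 0
  let J (l : ℕ) : Finset (I l) := Finset.univ.filter fun x =>
    ext x.1 l ≠ ext x.2.1 l ∧ l + 1 < 2 * x.2.2.card
  let B (l : ℕ) (x : I l) : Finset (Fin n → ZMod p) := Finset.univ.filter fun g =>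
    ∀ k ∈ x.2.2, syndrome ι (toN g) (l + 1) (ext x.1) (ext x.2.1) k = 0
  have hcover : (Finset.univ : Finset (Fin n → ZMod p)) ⊆
      (Finset.range n).biUnion fun l => (J l).biUnion (B l) := by
    intro g _
    obtain ⟨l, hl, u, v, huv, hS⟩ := hcon (toN g)
    have hext : ∀ (w : ℕ → Γ) j, j < l + 1 → ext (fun k : Fin (l + 1) => w k) j = w j :=
      fun w j hj => by simp only [ext, dif_pos hj]
    refine Finset.mem_biUnion.2 ⟨l, Finset.mem_range.2 hl, Finset.mem_biUnion.2
      ⟨(fun k => u k, fun k => v k, Finset.univ.filter fun k : Fin (l + 1) =>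
        syndrome ι (toN g) (l + 1) u v k = 0), ?_, ?_⟩⟩
    · simp only [J, Finset.mem_filter, Finset.mem_univ, true_and]
      refine ⟨by rwa [hext u l (by omega), hext v l (by omega)], ?_⟩
      refine hS.trans_le (Nat.mul_le_mul_left 2 ?_)
      rw [← Finset.card_map Fin.valEmbedding]
      refine Finset.card_le_card fun k hk => ?_
      rw [Finset.mem_filter, Finset.mem_range] at hk
      simp only [Finset.mem_map, Finset.mem_filter, Finset.mem_univ, true_and]
      exact ⟨⟨k, hk.1⟩, hk.2, rfl⟩
    · simp only [B, Finset.mem_filter, Finset.mem_univ, true_and]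
      intro k hk
      rw [← hk]
      refine Finset.sum_congr rfl fun j hj => ?_
      rw [Finset.mem_Ico] at hj
      rw [hext u j hj.2, hext v j hj.2]
  have hp0 : (0 : ℝ) < (p : ℝ) ^ n := pow_pos (Nat.cast_pos.2 (Fact.out : p.Prime).pos) n
  have hB : ∀ l < n, ∀ x ∈ J l, ((B l x).card : ℝ) ≤ (p : ℝ) ^ n / (4 * d ^ 2) ^ (l + 1) := by
    intro l hl x hx
    simp only [J, Finset.mem_filter, Finset.mem_univ, true_and] at hx
    have h1 := card_generators_mul_le hι (n := n) (l := l) hl (ext x.1) (ext x.2.1) hx.1 x.2.2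
    have h2 : Nat.card {g : Fin n → ZMod p // ∀ k ∈ x.2.2,
        syndrome ι (fun j => if h : j < n then g ⟨j, h⟩ else 0) (l + 1) (ext x.1) (ext x.2.1) k = 0}
        = (B l x).card := by
      rw [Nat.card_eq_fintype_card, Fintype.card_subtype]
    rw [h2] at h1
    -- The square in the bound on `p` compensates for `S` having only about half of the positions.
    have h3 : (4 * d ^ 2) ^ (l + 1) ≤ p ^ x.2.2.card :=
      calc (4 * d ^ 2) ^ (l + 1) ≤ (4 * d ^ 2) ^ (2 * x.2.2.card) :=
            Nat.pow_le_pow_right (by positivity) hx.2.le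
        _ = ((4 * d ^ 2) ^ 2) ^ x.2.2.card := by rw [pow_mul]
        _ ≤ _ := Nat.pow_le_pow_left hp _
    rw [le_div_iff₀ (by positivity)]
    exact_mod_cast (Nat.mul_le_mul_left _ h3).trans h1
  have hJ : ∀ l, ((J l).card : ℝ) ≤ (2 * d ^ 2) ^ (l + 1) := by
    intro l
    have h : (J l).card ≤ (2 * d ^ 2) ^ (l + 1) := by
      refine (Finset.card_le_univ _).trans (le_of_eq ?_)
      simp only [I, Fintype.card_prod, Fintype.card_fun, Fintype.card_fin, Fintype.card_finset, ← hd]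
      ring
    exact_mod_cast h
  have h1 : ((Finset.univ : Finset (Fin n → ZMod p)).card : ℝ) ≤
      ∑ l ∈ Finset.range n, ∑ x ∈ J l, ((B l x).card : ℝ) := by
    refine le_trans (Nat.cast_le.2 ((Finset.card_le_card hcover).trans Finset.card_biUnion_le)) ?_
    push_cast
    exact Finset.sum_le_sum fun l _ => by exact_mod_cast Finset.card_biUnion_le
  have h2 : ∑ l ∈ Finset.range n, ∑ x ∈ J l, ((B l x).card : ℝ) ≤
      ∑ l ∈ Finset.range n, (p : ℝ) ^ n * (1 / 2) ^ (l + 1) := by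
    refine Finset.sum_le_sum fun l hl => ?_
    refine (Finset.sum_le_card_nsmul _ _ _ (hB l (Finset.mem_range.1 hl))).trans ?_
    rw [nsmul_eq_mul]
    refine (mul_le_mul_of_nonneg_right (hJ l) (by positivity)).trans (le_of_eq ?_)
    have hd0 : (d : ℝ) ≠ 0 := by positivity
    rw [mul_div_left_comm, ← div_pow]
    congr 2
    field_simp
    norm_num
  have h3 : ∀ m : ℕ, ∑ l ∈ Finset.range m, (1 / 2 : ℝ) ^ (l + 1) = 1 - (1 / 2) ^ m := by
    intro m
    induction m with
    | zero => simp
    | succ m ih => rw [Finset.sum_range_succ, ih]; ring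
  rw [← Finset.mul_sum, h3] at h2
  have h4 : ((Finset.univ : Finset (Fin n → ZMod p)).card : ℝ) = (p : ℝ) ^ n := by
    rw [Finset.card_univ, Fintype.card_fun, ZMod.card, Fintype.card_fin]; push_cast; rfl
  have h5 : (0 : ℝ) < (1 / 2) ^ n := by positivity
  nlinarith

/-! ### Hamming distance and tree codes -/

/-- The number of positions in which two lists differ. -/
def ham {α : Type} [DecidableEq α] : List α → List α → ℕ
  | a :: l, b :: m => (if a = b then 0 else 1) + ham l m
  | _, _ => 0

/-- The codeword of `l` (newest letter first) for the tree code with labelling `enc`. -/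
def codeword {Γ α : Type} (enc : List Γ → α) : List Γ → List α
  | [] => []
  | a :: l => enc (a :: l) :: codeword enc l

variable {α : Type} [DecidableEq α]

theorem ham_append {l m l' m' : List α} (h : l.length = m.length) :
    ham (l ++ l') (m ++ m') = ham l m + ham l' m' := by
  induction l generalizing m with
  | nil => cases m <;> simp_all [ham]
  | cons a l ih =>
    cases m with
    | nil => simp at h
    | cons b m => simp only [List.cons_append, ham, ih (by simpa using h)]; ring

theorem ham_triangle (l m r : List α) (h : l.length = m.length) (h' : m.length = r.length) :
    ham l m ≤ ham l r + ham m r := by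
  induction l generalizing m r with
  | nil => simp [ham]
  | cons a l ih =>
    cases m with
    | nil => simp [ham]
    | cons b m =>
      cases r with
      | nil => simp at h'
      | cons c r =>
        have := ih m r (by simpa using h) (by simpa using h')
        have key : (if a = b then 0 else 1) ≤ (if a = c then 0 else 1) + if b = c then 0 else 1 := by
          split_ifs <;> simp_all
        simp only [ham]
        omega

theorem ham_eq_card (l m : List α) (h : l.length = m.length) :
    ham l m = ((Finset.range l.length).filter fun k => l[k]? ≠ m[k]?).card := by
  induction l generalizing m with
  | nil => simp [ham]
  | cons a l ih =>
    cases m with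
    | nil => simp at h
    | cons b m =>
      rw [List.length_cons, Finset.card_filter, Finset.sum_range_succ', ham,
        ih m (by simpa using h), Finset.card_filter]
      simp [add_comm]

@[simp] theorem length_codeword {Γ α : Type} (enc : List Γ → α) (l : List Γ) :
    (codeword enc l).length = l.length := by
  induction l with
  | nil => rfl
  | cons a l ih => simp [codeword, ih]

theorem drop_codeword {Γ α : Type} (enc : List Γ → α) (l : List Γ) (k : ℕ) :
    (codeword enc l).drop k = codeword enc (l.drop k) := by
  induction k generalizing l with
  | zero => rfl
  | succ k ih => cases l <;> simp [codeword, ih]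

theorem getElem?_codeword {Γ α : Type} (enc : List Γ → α) (l : List Γ) (k : ℕ) (hk : k < l.length) :
    (codeword enc l)[k]? = some (enc (l.drop k)) := by
  induction l generalizing k with
  | nil => simp at hk
  | cons a l ih =>
    cases k with
    | zero => simp [codeword]
    | succ k => simpa [codeword] using ih k (by simpa using hk)

/-- A labelling of the words of length at most `n` by which words that part `l` steps ago have
codewords that differ in at least half of the last `l` positions. -/
def IsTreeCode (n : ℕ) (enc : List Γ → α) : Prop :=
  ∀ (u v w : List Γ) (a b : Γ), u.length = v.length → a ≠ b → u.length < n →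
    u.length + 1 ≤ 2 * ham ((codeword enc (u ++ a :: w)).take (u.length + 1))
      ((codeword enc (v ++ b :: w)).take (u.length + 1))

/-- The label of a word for the convolutional code with generator `g`. -/
def convLabel (ι : Γ → ZMod p) (g : ℕ → ZMod p) : ℕ → List Γ → ZMod p
  | _, [] => 0
  | i, a :: l => g i * ι a + convLabel ι g (i + 1) l

theorem convLabel_append (ι : Γ → ZMod p) (g : ℕ → ZMod p) (i : ℕ) (l m : List Γ) :
    convLabel ι g i (l ++ m) = convLabel ι g i l + convLabel ι g (i + l.length) m := by
  induction l generalizing i with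
  | nil => simp [convLabel]
  | cons a l ih =>
    simp only [List.cons_append, convLabel, ih, List.length_cons]
    rw [show i + 1 + l.length = i + (l.length + 1) by ring]; ring

theorem convLabel_drop [Inhabited Γ] (ι : Γ → ZMod p) (g : ℕ → ZMod p) (i k : ℕ) (l : List Γ) :
    convLabel ι g i (l.drop k) =
      ∑ j ∈ Finset.Ico k l.length, g (i + (j - k)) * ι (l.getD j default) := by
  induction l generalizing i k with
  | nil => simp [convLabel]
  | cons a l ih =>
    cases k with
    | zero =>
      have := ih (i + 1) 0
      rw [List.drop_zero] at this
      rw [List.drop_zero, convLabel, this, List.length_cons,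
        Finset.sum_eq_sum_Ico_succ_bot (a := 0) (b := l.length + 1) (by omega),
        ← Finset.sum_Ico_add' _ 0 l.length 1]
      simp [add_comm, add_left_comm]
    | succ k =>
      rw [List.drop_succ_cons, ih, List.length_cons, ← Finset.sum_Ico_add' _ k l.length 1]
      simp

/-- The convolutional code is linear after `ι`, so the common past `w` cancels and two labels agree
at a position exactly when the syndrome vanishes there. The prime `q` depends only on the number of
letters, not on the depth `n`. -/
theorem exists_isTreeCode (Γ : Type) [Fintype Γ] [Inhabited Γ] :
    ∃ q : ℕ, 2 ≤ q ∧ ∀ n, ∃ enc : List Γ → Fin q, IsTreeCode n enc := by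
  classical
  obtain ⟨p, hp, hprime⟩ := Nat.exists_infinite_primes ((4 * Fintype.card Γ ^ 2) ^ 2)
  have := Fact.mk hprime
  refine ⟨p, hprime.two_le, fun n => ?_⟩
  have hc : Fintype.card Γ ≤ Fintype.card (ZMod p) := by
    rw [ZMod.card]
    refine le_trans ?_ hp
    nlinarith [Nat.zero_le (Fintype.card Γ), Nat.le_self_pow (n := 4) (by norm_num) (Fintype.card Γ)]
  obtain ⟨ι⟩ := Function.Embedding.nonempty_of_card_le hc
  obtain ⟨g, hg⟩ := exists_generator ι.injective hp n
  have : NeZero p := ⟨hprime.ne_zero⟩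
  have e : ZMod p ≃ Fin p := Fintype.equivOfCardEq (by simp [ZMod.card])
  refine ⟨fun l => e (convLabel ι g 0 l), ?_⟩
  intro u v w a b huv hab hn
  set l := u.length
  have hu1 : (u ++ [a]).length = l + 1 := by simp [l]
  have hv1 : (v ++ [b]).length = l + 1 := by simp [l, huv]
  have h1 := hg l hn (fun j => (u ++ [a]).getD j default) (fun j => (v ++ [b]).getD j default)
    (by
      have : v.length = l := huv.symm
      simpa [List.getD_append_right, this, l] using hab)
  rw [ham_eq_card _ _ (by
    simp only [List.length_take, length_codeword, List.length_append, List.length_cons]; omega)]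
  have hlen : ((codeword (fun l => e (convLabel ι g 0 l)) (u ++ a :: w)).take (l + 1)).length
      = l + 1 := by
    simp only [List.length_take, length_codeword, List.length_append, List.length_cons]
    omega
  rw [hlen]
  have h2 := Finset.card_filter_add_card_filter_not (s := Finset.range (l + 1))
    (fun k => syndrome ι g (l + 1) (fun j => (u ++ [a]).getD j default)
      (fun j => (v ++ [b]).getD j default) k = 0)
  rw [Finset.card_range] at h2
  have h3 : ((Finset.range (l + 1)).filter fun k => ¬ syndrome ι g (l + 1)
      (fun j => (u ++ [a]).getD j default) (fun j => (v ++ [b]).getD j default) k = 0).card ≤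
      ((Finset.range (l + 1)).filter fun k =>
        ((codeword (fun l => e (convLabel ι g 0 l)) (u ++ a :: w)).take (l + 1))[k]? ≠
        ((codeword (fun l => e (convLabel ι g 0 l)) (v ++ b :: w)).take (l + 1))[k]?).card := by
    refine Finset.card_le_card fun k hk => ?_
    rw [Finset.mem_filter, Finset.mem_range] at hk ⊢
    refine ⟨hk.1, fun heq => hk.2 ?_⟩
    rw [List.getElem?_take_of_lt hk.1, List.getElem?_take_of_lt hk.1,
      getElem?_codeword _ _ _ (by simp only [List.length_append, List.length_cons]; omega),
      getElem?_codeword _ _ _ (by simp only [List.length_append, List.length_cons]; omega)] at heq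
    have h4 := e.injective (Option.some.inj heq)
    rw [List.append_cons u, List.append_cons v,
      List.drop_append_of_le_length (l₁ := u ++ [a]) (by omega),
      List.drop_append_of_le_length (l₁ := v ++ [b]) (by omega), convLabel_append _ _ _ _ w,
      convLabel_append _ _ _ _ w,
      List.length_drop, List.length_drop, hu1, hv1, convLabel_drop, convLabel_drop, hu1, hv1] at h4
    have h5 := add_right_cancel h4
    simp only [zero_add] at h5
    simp only [syndrome, mul_sub, Finset.sum_sub_distrib, h5, sub_self]
  omega

/-! ### Decoding -/

theorem exists_nearest [Inhabited Γ] (enc : List Γ → α) (r : List α) :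
    ∃ l : List Γ, l.length = r.length ∧
      ∀ l' : List Γ, l'.length = r.length → ham (codeword enc l) r ≤ ham (codeword enc l') r := by
  obtain ⟨l, hl, hmin⟩ := WellFounded.has_min
    (InvImage.wf (fun l : List Γ => ham (codeword enc l) r) Nat.lt_wfRel.wf)
    {l : List Γ | l.length = r.length} ⟨List.replicate r.length default, by simp⟩
  exact ⟨l, hl, fun l' hl' => not_lt.1 (hmin l' hl')⟩

/-- Minimum distance decoding. -/
def decode [Inhabited Γ] (enc : List Γ → α) (r : List α) : List Γ :=
  (exists_nearest enc r).choose

theorem length_decode [Inhabited Γ] (enc : List Γ → α) (r : List α) :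
    (decode enc r).length = r.length :=
  (exists_nearest enc r).choose_spec.1

theorem exists_divergence {l m : List Γ} (h : l.length = m.length) (hne : l ≠ m) :
    ∃ (u v w : List Γ) (a b : Γ), l = u ++ a :: w ∧ m = v ++ b :: w ∧ u.length = v.length ∧
      a ≠ b := by
  induction l generalizing m with
  | nil => cases m <;> simp_all
  | cons x l ih =>
    cases m with
    | nil => simp at h
    | cons y m =>
      by_cases hlm : l = m
      · subst hlm
        exact ⟨[], [], l, x, y, rfl, rfl, rfl, fun hxy => hne (by rw [hxy])⟩
      · obtain ⟨u, v, w, a, b, rfl, rfl, h1, h2⟩ := ih (by simpa using h) hlm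
        exact ⟨x :: u, y :: v, w, a, b, rfl, rfl, by simp [h1], h2⟩

/-- If the decoded word parts from the true one `k` steps ago, their codewords agree before that, so
on the last `k` positions the received word is at least as close to the wrong codeword. By the
triangle inequality the distance of the codewords, at least `k / 2`, is at most twice the number of
errors there. -/
theorem le_ham_of_decode_ne [Inhabited Γ] {n : ℕ} {enc : List Γ → α} (henc : IsTreeCode n enc)
    {l : List Γ} {r : List α} (hlr : l.length = r.length) (hn : l.length ≤ n)
    (hne : decode enc r ≠ l) :
    ∃ k, 1 ≤ k ∧ k ≤ l.length ∧ k ≤ 4 * ham ((codeword enc l).take k) (r.take k) := by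
  have hmin := (exists_nearest enc r).choose_spec.2 l hlr
  change ham (codeword enc (decode enc r)) r ≤ _ at hmin
  obtain ⟨u, v, w, a, b, hu, hv, huv, hab⟩ :=
    exists_divergence ((length_decode enc r).trans hlr.symm) hne
  have hlen : l.length = u.length + 1 + w.length := by rw [hv]; simp [huv]; omega
  refine ⟨u.length + 1, by omega, by omega, ?_⟩
  have h1 := henc u v w a b huv hab (by omega)
  rw [← hu, ← hv] at h1
  set c := codeword enc l with hc
  set c' := codeword enc (decode enc r) with hc'
  have lc : c.length = r.length := by simp [hc, hlr]
  have lc' : c'.length = r.length := by simp [hc', length_decode]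
  set k := u.length + 1
  have e1 : ham c r = ham (c.take k) (r.take k) + ham (c.drop k) (r.drop k) := by
    rw [← ham_append (by simp [lc]), List.take_append_drop, List.take_append_drop]
  have e2 : ham c' r = ham (c'.take k) (r.take k) + ham (c'.drop k) (r.drop k) := by
    rw [← ham_append (by simp [lc']), List.take_append_drop, List.take_append_drop]
  -- Lists run backwards in time, so `drop k` is the common past.
  have e3 : c.drop k = c'.drop k := by
    rw [hc, hc', drop_codeword, drop_codeword, hu, hv, List.append_cons u, List.append_cons v,
      List.drop_left' (by simp [k, huv]), List.drop_left'
        (by simp only [List.length_append, List.length_cons, List.length_nil]; omega)]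
  have h2 := ham_triangle (c'.take k) (c.take k) (r.take k) (by simp [lc, lc']) (by simp [lc])
  rw [e1, e2, e3] at hmin
  omega

/-- The number of times at which the word sent so far is not decoded correctly. -/
def badCount [Inhabited Γ] [DecidableEq Γ] (enc : List Γ → α) : List Γ → List α → ℕ
  | a :: l, c :: r => (if decode enc (c :: r) = a :: l then 0 else 1) + badCount enc l r
  | _, _ => 0

/-- A wrong decoding sits at the end of a block of some length `k` with at least `k / 4` errors. The
block is cut off, which removes at most `k` bad times, and the induction continues with what is
older; a correct decoding is cut off alone. -/
theorem badCount_le [Inhabited Γ] [DecidableEq Γ] {n : ℕ} {enc : List Γ → α}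
    (henc : IsTreeCode n enc) {l : List Γ} {r : List α} (hlr : l.length = r.length)
    (hn : l.length ≤ n) : badCount enc l r ≤ 4 * ham (codeword enc l) r := by
  have hdrop : ∀ (k : ℕ) (l : List Γ) (r : List α), l.length = r.length →
      badCount enc l r ≤ k + badCount enc (l.drop k) (r.drop k) := by
    intro k
    induction k with
    | zero => simp
    | succ k ih =>
      intro l r h
      cases l with
      | nil => simp [badCount]
      | cons a l =>
        cases r with
        | nil => simp at h
        | cons c r =>
          have := ih l r (by simpa using h)
          simp only [badCount, List.drop_succ_cons]
          split_ifs <;> omega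
  induction hN : l.length using Nat.strong_induction_on generalizing l r with
  | _ N ih =>
    cases l with
    | nil => simp [badCount]
    | cons a l =>
      cases r with
      | nil => simp at hlr
      | cons c r =>
        by_cases hd : decode enc (c :: r) = a :: l
        · have := ih l.length (by simp at hN; omega) (l := l) (r := r) (by simpa using hlr)
            (by simp at hn; omega) rfl
          simp only [badCount, codeword, ham, hd, if_true]
          omega
        · obtain ⟨k, hk1, hk2, hk3⟩ := le_ham_of_decode_ne henc hlr hn hd
          have h1 := hdrop k (a :: l) (c :: r) hlr
          have h2 := ih ((a :: l).drop k).length (by rw [List.length_drop]; omega)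
            (l := (a :: l).drop k) (r := (c :: r).drop k) (by simp [List.length_drop, hlr])
            (by rw [List.length_drop]; omega) rfl
          rw [← drop_codeword] at h2
          have h3 := ham_append (l := (codeword enc (a :: l)).take k) (m := (c :: r).take k)
            (l' := (codeword enc (a :: l)).drop k) (m' := (c :: r).drop k)
            (by simp only [List.length_take, length_codeword, hlr])
          rw [List.take_append_drop, List.take_append_drop] at h3
          omega

end TreeCode

/-! ## Words of operations that remain to be applied -/

/-- The Pauli operator `X ^ p.1 Z ^ p.2`, up to a phase. -/
abbrev Pauli : Type := Bool × Bool

/-- The product of Pauli operators, up to a phase. -/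
def Pauli.mul (p p' : Pauli) : Pauli := (xor p.1 p'.1, xor p.2 p'.2)

/-- The trivial Pauli operator. -/
def Pauli.one : Pauli := (false, false)

/-- An operation of a party (`false` for Alice, `true` for Bob): a step forwards or backwards across
an edge of the integer line. -/
abbrev Letter : Type := Bool × ℤ × Bool

/-- The inverse operation. -/
def Letter.inv (x : Letter) : Letter := (x.1, x.2.1, !x.2.2)

/-- What remains to be applied: a Pauli operator, then operations with Pauli operators after
them. -/
abbrev Todo : Type := Pauli × List (Letter × Pauli)

/-- The message of a party: the Pauli operator that it applied, the direction in which it then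
moved, and the outcome of the teleportation. -/
abbrev Msg : Type := (Pauli × Option Bool) × Pauli

/-- The operation of a party at position `r` that moves in the given direction. -/
def moveLetter (b : Bool) (r : ℤ) : Bool → Letter
  | true => (b, r, true)
  | false => (b, r - 1, false)

/-- The displacement. -/
def displacement : Option Bool → ℤ
  | none => 0
  | some true => 1
  | some false => -1

/-- The position of a party after its messages. -/
def position : List Msg → ℤ
  | [] => 0
  | m :: l => position l + displacement m.1.2

namespace Todo

/-- What remains after a Pauli operator has been applied. -/
def mulPauli (p : Pauli) (τ : Todo) : Todo := (p.mul τ.1, τ.2)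

/-- What remains after an operation has been applied. -/
def applyLetter (x : Letter) : Todo → Todo
  | (p, []) => (Pauli.one, [(x.inv, p)])
  | (p, (y, p') :: l) => if p = Pauli.one ∧ y = x then (p', l)
      else (Pauli.one, (x.inv, p) :: (y, p') :: l)

/-- What remains after a party at position `r` has made a move. -/
def move (b : Bool) (r : ℤ) : Option Bool → Todo → Todo
  | none, τ => τ
  | some d, τ => applyLetter (moveLetter b r d) τ

/-- What remains after the turn of a party at position `r`. -/
def turn (b : Bool) (r : ℤ) (m : Msg) (τ : Todo) : Todo :=
  mulPauli m.2 (move b r m.1.2 (mulPauli m.1.1 τ))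

/-- The action that a party at position `r` should take. -/
def policy (b : Bool) (r : ℤ) (τ : Todo) : Pauli × Option Bool :=
  (τ.1, match τ.2 with
    | [] => none
    | (x, _) :: _ => if x = moveLetter b r true then some true
        else if x = moveLetter b r false then some false else none)

/-- The operations of a party, as steps on the integer line, lead from `r` to `K`. -/
def IsWalk (b : Bool) (K : ℤ) : ℤ → List (Letter × Pauli) → Prop
  | r, [] => r = K
  | r, (x, _) :: l => if x.1 = b then
      ∃ d, x = moveLetter b r d ∧ IsWalk b K (r + displacement (some d)) l else IsWalk b K r l

/-- The first operation is one of the given party. -/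
def HeadIs (b : Bool) (l : List (Letter × Pauli)) : Prop :=
  ∃ x p l', l = (x, p) :: l' ∧ x.1 = b

/-! ### Effect of a turn on the remaining word -/

theorem moveLetter_injective (b : Bool) (r : ℤ) : Function.Injective (moveLetter b r) := by
  intro d d' h
  cases d <;> cases d' <;> simp_all [moveLetter]

theorem moveLetter_inv (b : Bool) (r : ℤ) (d : Bool) :
    (moveLetter b r d).inv = moveLetter b (r + displacement (some d)) (!d) := by
  cases d <;> simp [moveLetter, Letter.inv, displacement, sub_eq_add_neg]

theorem displacement_not (d : Bool) : displacement (some (!d)) = -displacement (some d) := by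
  cases d <;> rfl

@[simp] theorem moveLetter_fst (b : Bool) (r : ℤ) (d : Bool) : (moveLetter b r d).1 = b := by
  cases d <;> rfl

/-- Cancelling the first letter takes the first step of the walk; otherwise the inverse letter that
is added leads back to the old position, where the old walk starts. -/
theorem isWalk_turn_self {b : Bool} {K r : ℤ} {τ : Todo} (m : Msg) (h : IsWalk b K r τ.2) :
    IsWalk b K (r + displacement m.1.2) (turn b r m τ).2 := by
  obtain ⟨p, l⟩ := τ
  obtain ⟨⟨p', d⟩, t⟩ := m
  have push : ∀ d, ∀ q, IsWalk b K r l → IsWalk b K (r + displacement (some d))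
      (((moveLetter b r d).inv, q) :: l) := by
    intro d q h
    rw [IsWalk, moveLetter_inv, if_pos (by simp)]
    exact ⟨!d, rfl, by rwa [displacement_not, add_neg_cancel_right]⟩
  cases d with
  | none => simpa [turn, mulPauli, move, displacement] using h
  | some d =>
    simp only [turn, mulPauli, move]
    cases l with
    | nil => exact push d _ h
    | cons y l =>
      obtain ⟨y, q⟩ := y
      simp only [applyLetter]
      split_ifs with hc
      · obtain ⟨-, rfl⟩ := hc
        simp only [IsWalk] at h
        rw [if_pos (by simp)] at h
        obtain ⟨d', h1, h2⟩ := h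
        rw [moveLetter_injective b r h1]
        exact h2
      · exact push d _ h

/-- Only a letter of `b` is added or removed, and `IsWalk b'` skips those. -/
theorem isWalk_turn_other {b b' : Bool} (hb : b' ≠ b) {K r r' : ℤ} {τ : Todo} (m : Msg)
    (h : IsWalk b' K r' τ.2) : IsWalk b' K r' (turn b r m τ).2 := by
  obtain ⟨p, l⟩ := τ
  obtain ⟨⟨p', d⟩, t⟩ := m
  have push : ∀ d, ∀ q, IsWalk b' K r' l → IsWalk b' K r' (((moveLetter b r d).inv, q) :: l) := by
    intro d q h
    rw [IsWalk, moveLetter_inv, if_neg (by simpa using hb.symm)]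
    exact h
  cases d with
  | none => simpa [turn, mulPauli, move] using h
  | some d =>
    simp only [turn, mulPauli, move]
    cases l with
    | nil => exact push d _ h
    | cons y l =>
      obtain ⟨y, q⟩ := y
      simp only [applyLetter]
      split_ifs with hc
      · obtain ⟨-, rfl⟩ := hc
        simp only [IsWalk] at h
        rwa [if_neg (by simpa using hb.symm)] at h
      · exact push d _ h

theorem length_turn_le (b : Bool) (r : ℤ) (m : Msg) (τ : Todo) :
    (turn b r m τ).2.length ≤ τ.2.length + 1 := by
  obtain ⟨p, l⟩ := τ
  obtain ⟨⟨p', d⟩, t⟩ := m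
  cases d with
  | none => simp [turn, mulPauli, move]
  | some d =>
    cases l with
    | nil => simp [turn, mulPauli, move, applyLetter]
    | cons y l =>
      simp only [turn, mulPauli, move, applyLetter]
      split_ifs <;> simp; omega

theorem pauli_mul_self (p : Pauli) : p.mul p = Pauli.one := by
  simp [Pauli.mul, Pauli.one]

/-- The walk condition places the first letter at the actual position of the party, so the policy
recognises it; once the leading Pauli operator is trivial, `applyLetter` cancels. -/
theorem turn_policy_of_head {b : Bool} {K r : ℤ} {τ : Todo} {m : Msg} (h : IsWalk b K r τ.2)
    (hm : m.1 = policy b r τ) (hb : HeadIs b τ.2) :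
    (turn b r m τ).2.length + 1 = τ.2.length := by
  obtain ⟨p, l⟩ := τ
  obtain ⟨⟨p', d⟩, t⟩ := m
  obtain ⟨x, q, l', rfl, hx⟩ := hb
  simp only [IsWalk, if_pos hx] at h
  obtain ⟨d', rfl, -⟩ := h
  have hd : d = some d' := by
    simp only [policy, Prod.mk.injEq] at hm
    rw [hm.2]
    cases d' <;> simp [moveLetter]
  have hp : p' = p := by simp only [policy, Prod.mk.injEq] at hm; exact hm.1
  subst hd hp
  simp [turn, mulPauli, move, applyLetter, pauli_mul_self]

theorem turn_policy_of_not_head {b : Bool} {r : ℤ} {τ : Todo} {m : Msg}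
    (hm : m.1 = policy b r τ) (hb : ¬ HeadIs b τ.2) : (turn b r m τ).2 = τ.2 := by
  obtain ⟨p, l⟩ := τ
  obtain ⟨⟨p', d⟩, t⟩ := m
  have hd : d = none := by
    simp only [policy, Prod.mk.injEq] at hm
    rw [hm.2]
    cases l with
    | nil => rfl
    | cons y l =>
      have hy : y.1.1 ≠ b := fun h => hb ⟨y.1, y.2, l, rfl, h⟩
      have h : ∀ d, y.1 ≠ moveLetter b r d := fun d h => hy (by rw [h, moveLetter_fst])
      simp [h]
  subst hd
  rfl

theorem length_turn_policy_le {b : Bool} {K r : ℤ} {τ : Todo} {m : Msg} (h : IsWalk b K r τ.2)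
    (hm : m.1 = policy b r τ) : (turn b r m τ).2.length ≤ τ.2.length := by
  by_cases hb : HeadIs b τ.2
  · have := turn_policy_of_head h hm hb; omega
  · rw [turn_policy_of_not_head hm hb]

/-- Alice's half of the progress made in a round. -/
theorem progress_alice {K : ℤ} {r : ℤ} {τ : Todo} {m : Msg} {L i B B' : ℕ}
    (h : IsWalk false K r τ.2) (hlen : τ.2.length ≤ (L - i) + 2 * B)
    (hm : (B' = B ∧ m.1 = policy false r τ) ∨ B' = B + 1) :
    (turn false r m τ).2.length ≤ (L - (i + 1)) + 2 * B' ∨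
      ((turn false r m τ).2.length ≤ (L - i) + 2 * B' ∧ HeadIs true (turn false r m τ).2) := by
  rcases hm with ⟨rfl, hm⟩ | rfl
  · by_cases hb : HeadIs false τ.2
    · have := turn_policy_of_head h hm hb
      left; omega
    · rw [turn_policy_of_not_head hm hb]
      -- Alice has nothing to remove: either the word is empty, or the first letter is Bob's and the
      -- progress of this round is left to him.
      rcases hl : τ.2 with _ | ⟨⟨x, q⟩, l'⟩
      · left; simp
      · right
        rw [hl] at hlen hb
        refine ⟨hlen, x, q, l', rfl, ?_⟩
        by_contra hx
        exact hb ⟨x, q, l', rfl, by simpa using hx⟩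
  -- The allowance of 2 pays for the letter that may be added and for the progress that is missed.
  · have := length_turn_le false r m τ
    left; omega

/-- Bob's half of the progress made in a round. -/
theorem progress_bob {K : ℤ} {r : ℤ} {τ : Todo} {m : Msg} {L i B B' : ℕ}
    (h : IsWalk true K r τ.2)
    (hlen : τ.2.length ≤ (L - (i + 1)) + 2 * B ∨ (τ.2.length ≤ (L - i) + 2 * B ∧ HeadIs true τ.2))
    (hm : (B' = B ∧ m.1 = policy true r τ) ∨ B' = B + 1) :
    (turn true r m τ).2.length ≤ (L - (i + 1)) + 2 * B' := by
  rcases hm with ⟨rfl, hm⟩ | rfl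
  · rcases hlen with hlen | ⟨hlen, hb⟩
    · exact (length_turn_policy_le h hm).trans hlen
    · have := turn_policy_of_head h hm hb
      omega
  · have := length_turn_le true r m τ
    omega

/-- A walk to `K` with at most `l.length` unit steps never goes below `K - l.length`; letters of the
other party only lengthen the list. A backward step from `r` uses edge `r - 1`, which is its end
point. -/
theorem le_edge_of_isWalk {b : Bool} {K r : ℤ} {l : List (Letter × Pauli)} (h : IsWalk b K r l) :
    K - l.length ≤ r ∧ ∀ x ∈ l, x.1.1 = b → K - l.length ≤ x.1.2.1 := by
  induction l generalizing r with
  | nil => simp only [IsWalk] at h; simp [h]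
  | cons x l ih =>
    obtain ⟨x, q⟩ := x
    simp only [IsWalk] at h
    split_ifs at h with hx
    · obtain ⟨d, rfl, h2⟩ := h
      obtain ⟨h3, h4⟩ := ih h2
      have hd : K - (l.length + 1) ≤ r ∧ K - (l.length + 1) ≤ (moveLetter b r d).2.1 := by
        cases d <;> simp only [displacement, moveLetter] at h3 ⊢ <;> omega
      refine ⟨by simpa using hd.1, ?_⟩
      intro y hy hyb
      rcases List.mem_cons.1 hy with rfl | hy
      · simpa using hd.2
      · have := h4 y hy hyb
        push_cast [List.length_cons]
        omega
    · obtain ⟨h3, h4⟩ := ih h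
      refine ⟨by push_cast [List.length_cons]; omega, ?_⟩
      intro y hy hyb
      rcases List.mem_cons.1 hy with rfl | hy
      · exact absurd hyb hx
      · have := h4 y hy hyb
        push_cast [List.length_cons]
        omega

/-- The operations of Alice and Bob across the edges from `k` to `k + n`, alternating. -/
def initialList : ℕ → ℕ → List (Letter × Pauli)
  | _, 0 => []
  | k, n + 1 => ((false, (k : ℤ), true), Pauli.one) :: ((true, (k : ℤ), true), Pauli.one) ::
      initialList (k + 1) n

theorem length_initialList (k n : ℕ) : (initialList k n).length = 2 * n := by
  induction n generalizing k with
  | zero => rfl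
  | succ n ih => simp only [initialList, List.length_cons, ih]; ring

theorem isWalk_initialList (b : Bool) (k n : ℕ) : IsWalk b (k + n : ℕ) k (initialList k n) := by
  induction n generalizing k with
  | zero => simp [initialList, IsWalk]
  | succ n ih =>
    have := ih (k + 1)
    rw [show k + 1 + n = k + (n + 1) by ring] at this
    cases b <;> simp only [initialList, IsWalk] <;>
      simpa [moveLetter, displacement] using this

/-- What remains after the given messages of Alice and Bob (newest first, as many of each). -/
def afterRounds (K : ℕ) : List Msg → List Msg → Todo
  | a :: μ, b :: ν => turn true (position ν) b (turn false (position μ) a (afterRounds K μ ν))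
  | _, _ => (Pauli.one, initialList 0 K)

/-- What remains when Alice has sent one message more than Bob. -/
def midRound (K : ℕ) : List Msg → List Msg → Todo
  | a :: μ, ν => turn false (position μ) a (afterRounds K μ ν)
  | [], _ => (Pauli.one, initialList 0 K)

end Todo

/-! ## The operators of words

The registers are `A`, `B`, the communication qubit, the qubit `C̃` of Alice, and those of Eve. -/

section Words

/-- The registers that the words act on. -/
abbrev CoreReg (a b Y : Type) : Type := a × b × Bool × (Bool × Y)

/-- The operators on these registers. -/
abbrev CoreOp (a b Y : Type) : Type := Matrix (CoreReg a b Y) (CoreReg a b Y) ℂ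

/-- The matrix of a Pauli operator. -/
def pauliMatrix (p : Pauli) : Matrix Bool Bool ℂ :=
  Matrix.of fun c d => if c = xor d p.1 then (if p.2 && d then -1 else 1) else 0

variable {a b Y : Type} [DecidableEq a] [DecidableEq b] [DecidableEq Y]

/-- An operator on the communication qubit. -/
def onC (M : Matrix Bool Bool ℂ) : CoreOp a b Y :=
  Matrix.of fun (i, j, c, w) (i', j', c', w') => if i = i' ∧ j = j' ∧ w = w' then M c c' else 0

/-- An operator on the registers of Eve. -/
def onEnv (O : Matrix Y Y ℂ) : CoreOp a b Y :=
  Matrix.of fun (i, j, c, (d, y)) (i', j', c', (d', y')) =>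
    if i = i' ∧ j = j' ∧ c = c' ∧ d = d' then O y y' else 0

/-- The exchange of the communication qubit and `C̃`. -/
def swapCC : CoreOp a b Y :=
  Matrix.of fun (i, j, c, (d, y)) (i', j', c', (d', y')) =>
    if i = i' ∧ j = j' ∧ c = d' ∧ d = c' ∧ y = y' then 1 else 0

variable [Fintype a] [Fintype b] [Fintype Y]

theorem onC_mul_apply {γ : Type} (M : Matrix Bool Bool ℂ) (Ψ : Matrix (CoreReg a b Y) γ ℂ)
    (i : a) (j : b) (c : Bool) (w : Bool × Y) (k : γ) :
    ((onC M : CoreOp a b Y) * Ψ) (i, j, c, w) k = ∑ c', M c c' * Ψ (i, j, c', w) k := by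
  obtain ⟨d, y⟩ := w
  simp only [Matrix.mul_apply, onC, Matrix.of_apply, Fintype.sum_prod_type, ite_and, ite_mul,
    zero_mul, Finset.sum_ite_irrel, Finset.sum_const_zero, Finset.sum_ite_eq, Finset.mem_univ,
    if_true]

theorem onEnv_mul_apply {γ : Type} (O : Matrix Y Y ℂ) (Ψ : Matrix (CoreReg a b Y) γ ℂ)
    (i : a) (j : b) (c d : Bool) (y : Y) (k : γ) :
    ((onEnv O : CoreOp a b Y) * Ψ) (i, j, c, (d, y)) k = ∑ y', O y y' * Ψ (i, j, c, (d, y')) k := by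
  simp only [Matrix.mul_apply, onEnv, Matrix.of_apply, Fintype.sum_prod_type, ite_and, ite_mul,
    zero_mul, Finset.sum_ite_irrel, Finset.sum_const_zero, Finset.sum_ite_eq, Finset.mem_univ,
    if_true]

theorem swapCC_mul_apply {γ : Type} (Ψ : Matrix (CoreReg a b Y) γ ℂ)
    (i : a) (j : b) (c d : Bool) (y : Y) (k : γ) :
    ((swapCC : CoreOp a b Y) * Ψ) (i, j, c, (d, y)) k = Ψ (i, j, d, (c, y)) k := by
  simp only [Matrix.mul_apply, swapCC, Matrix.of_apply, Fintype.sum_prod_type, ite_and, ite_mul,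
    zero_mul, one_mul, Finset.sum_ite_irrel, Finset.sum_const_zero, Finset.sum_ite_eq,
    Finset.mem_univ, if_true]

theorem onAC_mul_apply {e γ : Type} [Fintype e] [DecidableEq e]
    (U : Matrix (a × Bool) (a × Bool) ℂ) (Ψ : Matrix (a × b × Bool × e) γ ℂ)
    (i : a) (j : b) (c : Bool) (w : e) (k : γ) :
    (onAC b e U * Ψ) (i, j, c, w) k = ∑ i', ∑ c', U (i, c) (i', c') * Ψ (i', j, c', w) k := by
  simp only [Matrix.mul_apply, onAC, Matrix.of_apply, Fintype.sum_prod_type, ite_and, ite_mul,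
    zero_mul, Finset.sum_ite_irrel, Finset.sum_const_zero, Finset.sum_ite_eq, Finset.mem_univ,
    if_true]

theorem onBC_mul_apply {e γ : Type} [Fintype e] [DecidableEq e]
    (U : Matrix (b × Bool) (b × Bool) ℂ) (Ψ : Matrix (a × b × Bool × e) γ ℂ)
    (i : a) (j : b) (c : Bool) (w : e) (k : γ) :
    (onBC a e U * Ψ) (i, j, c, w) k = ∑ j', ∑ c', U (j, c) (j', c') * Ψ (i, j', c', w) k := by
  simp only [Matrix.mul_apply, onBC, Matrix.of_apply, Fintype.sum_prod_type, ite_and, ite_mul,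
    zero_mul, Finset.sum_ite_irrel, Finset.sum_const_zero, Finset.sum_ite_eq, Finset.mem_univ,
    if_true]

theorem onC_one : (onC 1 : CoreOp a b Y) = 1 := by
  ext ⟨i, j, c, w⟩ ⟨i', j', c', w'⟩
  simp only [onC, Matrix.of_apply, Matrix.one_apply, Prod.mk.injEq, ← ite_and]
  congr 1
  exact propext (by tauto)

theorem onEnv_one : (onEnv 1 : CoreOp a b Y) = 1 := by
  ext ⟨i, j, c, d, w⟩ ⟨i', j', c', d', w'⟩
  simp only [onEnv, Matrix.of_apply, Matrix.one_apply, Prod.mk.injEq, ← ite_and]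
  congr 1
  exact propext (by tauto)

theorem onAC_one (e : Type) [DecidableEq e] : onAC b e (1 : Matrix (a × Bool) (a × Bool) ℂ) = 1 := by
  ext ⟨i, j, c, w⟩ ⟨i', j', c', w'⟩
  simp only [onAC, Matrix.of_apply, Matrix.one_apply, Prod.mk.injEq, ← ite_and]
  congr 1
  exact propext (by tauto)

theorem onBC_one (e : Type) [DecidableEq e] : onBC a e (1 : Matrix (b × Bool) (b × Bool) ℂ) = 1 := by
  ext ⟨i, j, c, w⟩ ⟨i', j', c', w'⟩
  simp only [onBC, Matrix.of_apply, Matrix.one_apply, Prod.mk.injEq, ← ite_and]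
  congr 1
  exact propext (by tauto)

theorem onC_mul (M M' : Matrix Bool Bool ℂ) :
    (onC (M * M') : CoreOp a b Y) = onC M * onC M' := by
  ext ⟨i, j, c, w⟩ ⟨i', j', c', w'⟩
  rw [onC_mul_apply]
  simp only [onC, Matrix.of_apply, Matrix.mul_apply, mul_ite, mul_zero, Finset.sum_ite_irrel,
    Finset.sum_const_zero]

theorem onC_smul (s : ℂ) (M : Matrix Bool Bool ℂ) :
    (onC (s • M) : CoreOp a b Y) = s • onC M := by
  ext ⟨i, j, c, w⟩ ⟨i', j', c', w'⟩
  simp [onC]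

theorem onEnv_mul (O O' : Matrix Y Y ℂ) :
    (onEnv (O * O') : CoreOp a b Y) = onEnv O * onEnv O' := by
  ext ⟨i, j, c, d, w⟩ ⟨i', j', c', d', w'⟩
  rw [onEnv_mul_apply]
  simp only [onEnv, Matrix.of_apply, Matrix.mul_apply, mul_ite, mul_zero, Finset.sum_ite_irrel,
    Finset.sum_const_zero]

theorem onAC_mul (e : Type) [Fintype e] [DecidableEq e] (U U' : Matrix (a × Bool) (a × Bool) ℂ) :
    onAC b e (U * U') = onAC b e U * onAC b e U' := by
  ext ⟨i, j, c, w⟩ ⟨i', j', c', w'⟩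
  rw [onAC_mul_apply]
  simp only [onAC, Matrix.of_apply, Matrix.mul_apply, mul_ite, mul_zero, Finset.sum_ite_irrel,
    Finset.sum_const_zero, Fintype.sum_prod_type]

theorem onBC_mul (e : Type) [Fintype e] [DecidableEq e] (U U' : Matrix (b × Bool) (b × Bool) ℂ) :
    onBC a e (U * U') = onBC a e U * onBC a e U' := by
  ext ⟨i, j, c, w⟩ ⟨i', j', c', w'⟩
  rw [onBC_mul_apply]
  simp only [onBC, Matrix.of_apply, Matrix.mul_apply, mul_ite, mul_zero, Finset.sum_ite_irrel,
    Finset.sum_const_zero, Fintype.sum_prod_type]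

theorem swapCC_mul_self : (swapCC * swapCC : CoreOp a b Y) = 1 := by
  ext ⟨i, j, c, d, w⟩ ⟨i', j', c', d', w'⟩
  rw [swapCC_mul_apply]
  simp only [swapCC, Matrix.of_apply, Matrix.one_apply, Prod.mk.injEq]
  congr 1
  exact propext (by tauto)

theorem onEnv_mul_swapCC (O : Matrix Y Y ℂ) :
    (onEnv O * swapCC : CoreOp a b Y) = swapCC * onEnv O := by
  ext ⟨i, j, c, d, w⟩ ⟨i', j', c', d', w'⟩
  rw [swapCC_mul_apply, onEnv_mul_apply]
  simp only [swapCC, onEnv, Matrix.of_apply, mul_ite, mul_one, mul_zero, ite_and,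
    Finset.sum_ite_irrel, Finset.sum_const_zero, Finset.sum_ite_eq', Finset.mem_univ, if_true]
  split_ifs <;> rfl

theorem onEnv_mul_onC (O : Matrix Y Y ℂ) (M : Matrix Bool Bool ℂ) :
    (onEnv O * onC M : CoreOp a b Y) = onC M * onEnv O := by
  ext ⟨i, j, c, d, w⟩ ⟨i', j', c', d', w'⟩
  rw [onC_mul_apply, onEnv_mul_apply]
  simp only [onC, onEnv, Matrix.of_apply, mul_ite, mul_zero, ite_and, Prod.mk.injEq,
    Finset.sum_ite_irrel, Finset.sum_const_zero, Finset.sum_ite_eq', Finset.mem_univ, if_true]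
  simp only [mul_comm]

theorem onEnv_mul_onAC (O : Matrix Y Y ℂ) (U : Matrix (a × Bool) (a × Bool) ℂ) :
    (onEnv O * onAC b (Bool × Y) U : CoreOp a b Y) =
      onAC b (Bool × Y) U * onEnv O := by
  ext ⟨i, j, c, d, w⟩ ⟨i', j', c', d', w'⟩
  rw [onAC_mul_apply, onEnv_mul_apply]
  simp only [onAC, onEnv, Matrix.of_apply, mul_ite, mul_zero, ite_and, Prod.mk.injEq,
    Finset.sum_ite_irrel, Finset.sum_const_zero, Finset.sum_ite_eq', Finset.mem_univ, if_true]
  simp only [mul_comm]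

theorem onEnv_mul_onBC (O : Matrix Y Y ℂ) (U : Matrix (b × Bool) (b × Bool) ℂ) :
    (onEnv O * onBC a (Bool × Y) U : CoreOp a b Y) =
      onBC a (Bool × Y) U * onEnv O := by
  ext ⟨i, j, c, d, w⟩ ⟨i', j', c', d', w'⟩
  rw [onBC_mul_apply, onEnv_mul_apply]
  simp only [onBC, onEnv, Matrix.of_apply, mul_ite, mul_zero, ite_and, Prod.mk.injEq,
    Finset.sum_ite_irrel, Finset.sum_const_zero, Finset.sum_ite_eq', Finset.mem_univ, if_true]
  simp only [mul_comm]

theorem pauliMatrix_one : pauliMatrix Pauli.one = 1 := by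
  ext c d
  cases c <;> cases d <;> simp [pauliMatrix, Pauli.one]

theorem conjTranspose_pauliMatrix_mul (p : Pauli) :
    (pauliMatrix p).conjTranspose * pauliMatrix p = 1 := by
  obtain ⟨x, z⟩ := p
  ext c d
  cases x <;> cases z <;> cases c <;> cases d <;>
    simp [pauliMatrix, Matrix.mul_apply]

theorem exists_pauliMatrix_mul (p p' : Pauli) :
    ∃ s : ℂ, pauliMatrix (p.mul p') * pauliMatrix p = s • pauliMatrix p' := by
  obtain ⟨x, z⟩ := p
  obtain ⟨x', z'⟩ := p'
  refine ⟨if x && xor z z' then -1 else 1, ?_⟩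
  ext c d
  cases x <;> cases z <;> cases x' <;> cases z' <;> cases c <;> cases d <;>
    simp [pauliMatrix, Matrix.mul_apply, Pauli.mul]

/-! ### Operators of letters and words -/

/-- The black box that an operation uses, if any. -/
def Letter.query (n : ℕ) (x : Letter) : Option (Fin n × Bool) :=
  -- `true` means forwards in a letter but inverse in a query, hence the negation. Edges outside `0,
  -- …, n - 1` have no black box; they arise when a misled party leaves the range of the protocol.
  if h : 0 ≤ x.2.1 ∧ x.2.1.toNat < n then some (⟨x.2.1.toNat, h.2⟩, !x.2.2) else none

/-- The operator of a black-box use. -/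
def queryOp {J r : Type} [Fintype r] [DecidableEq r] (U : J → Matrix.unitaryGroup (r × Bool) ℂ) :
    Option (J × Bool) → Matrix (r × Bool) (r × Bool) ℂ
  | none => 1
  | some (j, false) => (U j).1
  | some (j, true) => (U j).1.conjTranspose

theorem queryOp_inv_mul {J r : Type} [Fintype r] [DecidableEq r]
    (U : J → Matrix.unitaryGroup (r × Bool) ℂ) (o : Option (J × Bool)) :
    queryOp U (o.map fun x => (x.1, !x.2)) * queryOp U o = 1 := by
  rcases o with _ | ⟨j, _ | _⟩
  · simp [queryOp]
  · exact (Matrix.mem_unitaryGroup_iff').1 (U j).2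
  · exact (Matrix.mem_unitaryGroup_iff).1 (U j).2

theorem Letter.query_inv (n : ℕ) (x : Letter) :
    x.inv.query n = (x.query n).map fun x => (x.1, !x.2) := by
  by_cases h : 0 ≤ x.2.1 ∧ x.2.1.toNat < n
  · have h' : 0 ≤ x.inv.2.1 ∧ x.inv.2.1.toNat < n := h
    rw [Letter.query, Letter.query, dif_pos h, dif_pos h']
    rfl
  · have h' : ¬ (0 ≤ x.inv.2.1 ∧ x.inv.2.1.toNat < n) := h
    rw [Letter.query, Letter.query, dif_neg h, dif_neg h']
    rfl

variable {N : ℕ}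

/-- Whether an operation exchanges the communication qubit and `C̃`. -/
def Letter.IsSwap (N : ℕ) (x : Letter) : Prop := x.1 = false ∧ x.2.1 = (N / 2 + 1 : ℕ)

instance (N : ℕ) (x : Letter) : Decidable (x.IsSwap N) := inferInstanceAs (Decidable (_ ∧ _))

/-- The operator of an operation. -/
def letterOp (P : NoiselessProtocol N a b) (x : Letter) :
    CoreOp a b Y :=
  if x.1 then onBC a (Bool × Y) (queryOp P.bob (x.query (N / 2)))
  else (if x.IsSwap N then swapCC else 1) *
    onAC b (Bool × Y) (queryOp P.alice (x.query (N / 2 + 1)))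

/-- Edge `N / 2 + 1` lies just beyond Alice's last black box, so an exchange never coincides with a
query and the order of the two factors in `letterOp` is immaterial for inverses. -/
theorem Letter.IsSwap.query_eq_none {x : Letter} (h : x.IsSwap N) : x.query (N / 2 + 1) = none := by
  rw [Letter.query, dif_neg]
  rw [h.2]
  simp

theorem letterOp_inv_mul (P : NoiselessProtocol N a b) (x : Letter) :
    (letterOp P x.inv * letterOp P x : CoreOp a b Y) = 1 := by
  by_cases hx : x.1
  · have hx' : x.inv.1 = true := hx
    rw [letterOp, letterOp, if_pos hx, if_pos hx', ← onBC_mul, Letter.query_inv, queryOp_inv_mul,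
      onBC_one]
  · have hx' : ¬ (x.inv.1 = true) := hx
    rw [letterOp, letterOp, if_neg hx, if_neg hx']
    by_cases hs : x.IsSwap N
    · have hs' : x.inv.IsSwap N := hs
      rw [hs.query_eq_none, hs'.query_eq_none, if_pos hs, if_pos hs', queryOp, onAC_one, mul_one,
        swapCC_mul_self]
    · have hs' : ¬ x.inv.IsSwap N := hs
      rw [if_neg hs, if_neg hs', one_mul, one_mul, ← onAC_mul, Letter.query_inv, queryOp_inv_mul,
        onAC_one]

theorem onEnv_mul_letterOp (P : NoiselessProtocol N a b) (O : Matrix Y Y ℂ) (x : Letter) :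
    (onEnv O * letterOp P x : CoreOp a b Y) =
      letterOp P x * onEnv O := by
  unfold letterOp
  split_ifs
  · exact onEnv_mul_onBC _ _
  · rw [← mul_assoc, onEnv_mul_swapCC, mul_assoc, onEnv_mul_onAC, mul_assoc]
  · rw [one_mul, onEnv_mul_onAC]

/-- The operator of a list of operations with Pauli operators after them. -/
def listOp (P : NoiselessProtocol N a b) :
    List (Letter × Pauli) → CoreOp a b Y
  | [] => 1
  | (x, p) :: l => listOp P l * (onC (pauliMatrix p) * letterOp P x)

/-- The operator that remains to be applied. -/
def todoOp (P : NoiselessProtocol N a b) (τ : Todo) : CoreOp a b Y :=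
  listOp P τ.2 * onC (pauliMatrix τ.1)

theorem onEnv_mul_listOp (P : NoiselessProtocol N a b) (O : Matrix Y Y ℂ)
    (l : List (Letter × Pauli)) :
    (onEnv O * listOp P l : CoreOp a b Y) = listOp P l * onEnv O := by
  induction l with
  | nil => simp [listOp]
  | cons x l ih =>
    obtain ⟨x, p⟩ := x
    simp only [listOp]
    rw [← mul_assoc, ih, mul_assoc, ← mul_assoc (onEnv O), onEnv_mul_onC, mul_assoc (onC _),
      onEnv_mul_letterOp]
    simp only [mul_assoc]

theorem onEnv_mul_todoOp (P : NoiselessProtocol N a b) (O : Matrix Y Y ℂ) (τ : Todo) :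
    (onEnv O * todoOp P τ : CoreOp a b Y) = todoOp P τ * onEnv O := by
  rw [todoOp, ← mul_assoc, onEnv_mul_listOp, mul_assoc, onEnv_mul_onC, mul_assoc]

/-- Cancellation uses up the first factor of the word; otherwise `letterOp x.inv * letterOp x = 1`
is inserted. -/
theorem todoOp_applyLetter_mul (P : NoiselessProtocol N a b) (x : Letter) (τ : Todo) :
    (todoOp P (τ.applyLetter x) * letterOp P x : CoreOp a b Y) =
      todoOp P τ := by
  obtain ⟨p, l⟩ := τ
  have push : (todoOp P (Pauli.one, (x.inv, p) :: l) * letterOp P x :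
      CoreOp a b Y) = todoOp P (p, l) := by
    simp only [todoOp, listOp, pauliMatrix_one, onC_one, mul_one]
    rw [mul_assoc, mul_assoc, letterOp_inv_mul, mul_one]
  cases l with
  | nil => exact push
  | cons y l =>
    obtain ⟨y, p'⟩ := y
    simp only [Todo.applyLetter]
    split_ifs with h
    · obtain ⟨rfl, rfl⟩ := h
      simp only [todoOp, listOp, pauliMatrix_one, onC_one, mul_one, mul_assoc]
    · exact push

/-- Up to a scalar, the operator that remains to be applied takes `Ψ` to `X`. -/
def Leads {γ : Type} (P : NoiselessProtocol N a b) (τ : Todo) (Ψ X : Matrix (CoreReg a b Y) γ ℂ) :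
    Prop :=
  ∃ s : ℂ, (todoOp P τ : CoreOp a b Y) * Ψ = s • X

theorem Leads.mulPauli {γ : Type} {P : NoiselessProtocol N a b} {τ : Todo}
    {Ψ X : Matrix (CoreReg a b Y) γ ℂ} (h : Leads P τ Ψ X) (p : Pauli) :
    Leads P (τ.mulPauli p) ((onC (pauliMatrix p) : CoreOp a b Y) * Ψ) X := by
  obtain ⟨s, hs⟩ := h
  obtain ⟨s', hs'⟩ := exists_pauliMatrix_mul p τ.1
  refine ⟨s' * s, ?_⟩
  rw [Todo.mulPauli, todoOp, ← Matrix.mul_assoc, mul_assoc (listOp P _), ← onC_mul, hs', onC_smul,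
    mul_smul_comm, Matrix.smul_mul, mul_smul, ← hs, todoOp]

/-- The operator of a move of a party. -/
def moveOp (P : NoiselessProtocol N a b) (x : Bool) (r : ℤ) :
    Option Bool → CoreOp a b Y
  | none => 1
  | some d => letterOp P (moveLetter x r d)

/-- The message `m` need not be the right one: a turn based on a false belief is recorded in the
word and leaves the target `X` as it was. The outcome of the teleportation enters as the Pauli
operator `m.2`. -/
theorem Leads.turn {γ : Type} {P : NoiselessProtocol N a b} {τ : Todo}
    {Ψ X : Matrix (CoreReg a b Y) γ ℂ} (h : Leads P τ Ψ X) (x : Bool) (r : ℤ) (m : Msg) :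
    Leads P (τ.turn x r m) ((onC (pauliMatrix m.2) : CoreOp a b Y) *
      ((moveOp P x r m.1.2 : CoreOp a b Y) *
        ((onC (pauliMatrix m.1.1) : CoreOp a b Y) * Ψ))) X := by
  refine Leads.mulPauli ?_ _
  have h1 := h.mulPauli m.1.1
  rcases m.1.2 with _ | d
  · simpa [Todo.move, moveOp] using h1
  · obtain ⟨s, hs⟩ := h1
    refine ⟨s, ?_⟩
    rw [← hs, Todo.move, moveOp, ← Matrix.mul_assoc, todoOp_applyLetter_mul]

/-- The word does not touch the adversary's registers, so her operator commutes past it into the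
target. -/
theorem Leads.onEnv {γ : Type} {P : NoiselessProtocol N a b} {τ : Todo}
    {Ψ X : Matrix (CoreReg a b Y) γ ℂ} {O' : Matrix Y Y ℂ} (h : Leads P τ Ψ ((onEnv O' : CoreOp a b Y) * X))
    (O : Matrix Y Y ℂ) : Leads P τ ((QInteractive.onEnv O : CoreOp a b Y) * Ψ)
      ((QInteractive.onEnv (O * O') : CoreOp a b Y) * X) := by
  obtain ⟨s, hs⟩ := h
  refine ⟨s, ?_⟩
  rw [← Matrix.mul_assoc, ← onEnv_mul_todoOp, Matrix.mul_assoc, hs, Matrix.mul_smul, onEnv_mul,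
    Matrix.mul_assoc]

theorem letterOp_eq_one (P : NoiselessProtocol N a b) {x : Letter} (hx : (N / 2 + 2 : ℕ) ≤ x.2.1) :
    (letterOp P x : CoreOp a b Y) = 1 := by
  have h1 : x.query (N / 2) = none := dif_neg (by omega)
  have h2 : x.query (N / 2 + 1) = none := dif_neg (by omega)
  have h3 : ¬ x.IsSwap N := fun h => by have := h.2; omega
  rw [letterOp, h1, h2, if_neg h3]
  simp [queryOp, onBC_one, onAC_one]

/-- What remains is a product of Pauli operators on the communication qubit. It is undone by its
adjoint, so the state differs from the target only on that qubit, which is discarded at the end. -/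
theorem Leads.eq_of_idle {γ : Type} {P : NoiselessProtocol N a b} {τ : Todo}
    {Ψ X : Matrix (CoreReg a b Y) γ ℂ} (h : Leads P τ Ψ X)
    (hτ : ∀ x ∈ τ.2, ((N / 2 + 2 : ℕ) : ℤ) ≤ x.1.2.1) :
    ∃ M : Matrix Bool Bool ℂ, Ψ = (onC M : CoreOp a b Y) * X := by
  have key : ∀ l : List (Letter × Pauli), (∀ x ∈ l, ((N / 2 + 2 : ℕ) : ℤ) ≤ x.1.2.1) →
      ∃ M : Matrix Bool Bool ℂ, M.conjTranspose * M = 1 ∧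
        (listOp P l : CoreOp a b Y) = onC M := by
    intro l
    induction l with
    | nil => exact fun _ => ⟨1, by simp, by simp [listOp, onC_one]⟩
    | cons x l ih =>
      obtain ⟨x, p⟩ := x
      intro hl
      obtain ⟨M, hM, hlM⟩ := ih fun y hy => hl y (List.mem_cons_of_mem _ hy)
      refine ⟨M * pauliMatrix p, ?_, ?_⟩
      · rw [Matrix.conjTranspose_mul, Matrix.mul_assoc, ← Matrix.mul_assoc _ M, hM, Matrix.one_mul,
          conjTranspose_pauliMatrix_mul]
      · rw [listOp, hlM, letterOp_eq_one P (hl (x, p) List.mem_cons_self), mul_one, onC_mul]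
  obtain ⟨M, hM, hl⟩ := key τ.2 hτ
  obtain ⟨s, hs⟩ := h
  have hM' : (M * pauliMatrix τ.1).conjTranspose * (M * pauliMatrix τ.1) = 1 := by
    rw [Matrix.conjTranspose_mul, Matrix.mul_assoc, ← Matrix.mul_assoc _ M, hM, Matrix.one_mul,
      conjTranspose_pauliMatrix_mul]
  refine ⟨s • (M * pauliMatrix τ.1).conjTranspose, ?_⟩
  rw [todoOp, hl, ← onC_mul] at hs
  rw [onC_smul, Matrix.smul_mul, ← Matrix.mul_smul, ← hs, ← Matrix.mul_assoc, ← onC_mul, hM',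
    onC_one, Matrix.one_mul]

/-- The initial word is the protocol, followed by the exchange of the communication qubit and
`C̃`. -/
theorem listOp_initialList (P : NoiselessProtocol N a b) {K : ℕ} (hK : N / 2 + 2 ≤ K) :
    (listOp P (Todo.initialList 0 K) : CoreOp a b Y) =
      swapCC * P.evolution (Bool × Y) := by
  have cons : ∀ k n, (listOp P (Todo.initialList k (n + 1)) :
      CoreOp a b Y) = listOp P (Todo.initialList (k + 1) n) *
        (letterOp P (true, (k : ℤ), true) * letterOp P (false, (k : ℤ), true)) := by
    intro k n
    simp only [Todo.initialList, listOp, pauliMatrix_one, onC_one, one_mul, mul_assoc]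
  have idle : ∀ n k, N / 2 + 2 ≤ k → (listOp P (Todo.initialList k n) :
      CoreOp a b Y) = 1 := by
    intro n
    induction n with
    | zero => intro k _; rfl
    | succ n ih =>
      intro k hk
      rw [cons, ih _ (by omega), letterOp_eq_one P (Nat.cast_le.2 hk),
        letterOp_eq_one P (Nat.cast_le.2 hk), mul_one, mul_one]
  set f : Fin (N / 2) → CoreOp a b Y := fun k =>
      onBC a (Bool × Y) (P.bob k).1 * onAC b (Bool × Y) (P.alice k.castSucc).1 with hf
  -- Induction on the number `d` of rounds of the protocol still ahead. The two spare edges in `d +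
  -- 2 ≤ n` are for Alice's last unitary, on edge `N / 2`, and for the exchange, on edge `N / 2 +
  -- 1`.
  have main : ∀ d k n, k + d = N / 2 → d + 2 ≤ n → (listOp P (Todo.initialList k n) :
      CoreOp a b Y) =
        swapCC * (onAC b (Bool × Y) (P.alice (Fin.last _)).1 *
          ((List.ofFn f).drop k).reverse.prod) := by
    intro d
    induction d with
    | zero =>
      intro k n hk hn
      obtain ⟨n, rfl⟩ : ∃ m, n = m + 2 := ⟨n - 2, by omega⟩
      obtain rfl : k = N / 2 := by omega
      have h1 : (letterOp P (true, ((N / 2 : ℕ) : ℤ), true) :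
          CoreOp a b Y) = 1 := by
        have : Letter.query (N / 2) (true, ((N / 2 : ℕ) : ℤ), true) = none := by
          rw [Letter.query, dif_neg (by simp only [Int.toNat_natCast]; omega)]
        rw [letterOp, if_pos rfl, this, queryOp, onBC_one]
      have h2 : (letterOp P (false, ((N / 2 : ℕ) : ℤ), true) :
          CoreOp a b Y) =
            onAC b (Bool × Y) (P.alice (Fin.last _)).1 := by
        have : Letter.query (N / 2 + 1) (false, ((N / 2 : ℕ) : ℤ), true) =
            some (Fin.last _, false) := by
          rw [Letter.query, dif_pos (by simp only [Int.toNat_natCast]; omega)]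
          simp only [Int.toNat_natCast, Bool.not_true]
          rfl
        have hs : ¬ Letter.IsSwap N (false, ((N / 2 : ℕ) : ℤ), true) := fun h => by
          have := h.2; simp at this
        rw [letterOp, this, if_neg (by simp), if_neg hs, one_mul, queryOp]
      have h3 : (letterOp P (true, ((N / 2 + 1 : ℕ) : ℤ), true) :
          CoreOp a b Y) = 1 := by
        have : Letter.query (N / 2) (true, ((N / 2 + 1 : ℕ) : ℤ), true) = none := by
          rw [Letter.query, dif_neg (by simp only [Int.toNat_natCast]; omega)]
        rw [letterOp, if_pos rfl, this, queryOp, onBC_one]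
      have h4 : (letterOp P (false, ((N / 2 + 1 : ℕ) : ℤ), true) :
          CoreOp a b Y) = swapCC := by
        have hs : Letter.IsSwap N (false, ((N / 2 + 1 : ℕ) : ℤ), true) := ⟨rfl, rfl⟩
        rw [letterOp, if_neg (by simp), if_pos hs, hs.query_eq_none, queryOp, onAC_one, mul_one]
      rw [cons, cons, idle _ _ (by omega), h1, h2, h3, h4, List.drop_of_length_le (by simp)]
      simp
    | succ d ih =>
      intro k n hk hn
      obtain ⟨n, rfl⟩ : ∃ m, n = m + 1 := ⟨n - 1, by omega⟩
      have hkN : k < N / 2 := by omega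
      have h1 : (letterOp P (true, (k : ℤ), true) :
          CoreOp a b Y) = onBC a (Bool × Y) (P.bob ⟨k, hkN⟩).1 := by
        have : Letter.query (N / 2) (true, (k : ℤ), true) = some (⟨k, hkN⟩, false) := by
          rw [Letter.query, dif_pos (by simpa using hkN)]
          simp
        rw [letterOp, if_pos rfl, this, queryOp]
      have h2 : (letterOp P (false, (k : ℤ), true) :
          CoreOp a b Y) =
            onAC b (Bool × Y) (P.alice (Fin.castSucc ⟨k, hkN⟩)).1 := by
        have : Letter.query (N / 2 + 1) (false, (k : ℤ), true) =
            some (Fin.castSucc ⟨k, hkN⟩, false) := by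
          rw [Letter.query, dif_pos (by simp; omega)]
          simp
        have hs : ¬ Letter.IsSwap N (false, (k : ℤ), true) := fun h => by
          have := h.2; simp only at this; omega
        rw [letterOp, this, if_neg (by simp), if_neg hs, one_mul, queryOp]
      have h3 : (List.ofFn f).drop k = f ⟨k, hkN⟩ :: (List.ofFn f).drop (k + 1) := by
        rw [List.drop_eq_getElem_cons (by simpa using hkN), List.getElem_ofFn]
      rw [cons, ih (k + 1) n (by omega) (by omega), h1, h2, h3, List.reverse_cons,
        List.prod_append, List.prod_singleton]
      simp only [mul_assoc, hf]
  rw [main (N / 2) 0 K (by omega) (by omega), List.drop_zero]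
  rfl

end Words

/-! ### The initial state -/

section Initial

variable {a b e W : Type} [DecidableEq a] [DecidableEq b] [DecidableEq e] [DecidableEq W]
  [Fintype a] [Fintype b] [Fintype e] [Fintype W]

/-- The embedding of `A B C E`, with `C̃` and the scratch register of Eve in basis states. -/
def initCore (a b e : Type) {W : Type} [DecidableEq a] [DecidableEq b] [DecidableEq e]
    [DecidableEq W] (w₀ : W) : Matrix (CoreReg a b (e × W)) (a × b × Bool × e) ℂ :=
  Matrix.of fun (i, j, c, (d, (x, w))) (i', j', c', x') =>
    if (i = i' ∧ j = j' ∧ c = c' ∧ x = x') ∧ d = false ∧ w = w₀ then 1 else 0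

theorem mul_initCore_apply {γ : Type} (Ψ : Matrix (a × b × Bool × e) γ ℂ) (w₀ : W) (i : a) (j : b)
    (c d : Bool) (x : e) (w : W) (k : γ) :
    (initCore a b e w₀ * Ψ) (i, j, c, (d, (x, w))) k =
      if d = false ∧ w = w₀ then Ψ (i, j, c, x) k else 0 := by
  simp only [Matrix.mul_apply, initCore, Matrix.of_apply, Fintype.sum_prod_type, ite_and, ite_mul,
    zero_mul, one_mul, Finset.sum_ite_irrel, Finset.sum_const_zero, Finset.sum_ite_eq,
    Finset.mem_univ, if_true]

theorem onAC_mul_initCore (U : Matrix (a × Bool) (a × Bool) ℂ) (w₀ : W) :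
    onAC b (Bool × (e × W)) U * initCore a b e w₀ = initCore a b e w₀ * onAC b e U := by
  ext ⟨i, j, c, d, x, w⟩ ⟨i', j', c', x'⟩
  rw [mul_initCore_apply, onAC_mul_apply]
  simp only [onAC, initCore, Matrix.of_apply, mul_ite, mul_one, mul_zero, ite_and,
    Finset.sum_ite_irrel, Finset.sum_const_zero, Finset.sum_ite_eq', Finset.mem_univ, if_true]
  split_ifs <;> rfl

theorem onBC_mul_initCore (U : Matrix (b × Bool) (b × Bool) ℂ) (w₀ : W) :
    onBC a (Bool × (e × W)) U * initCore a b e w₀ = initCore a b e w₀ * onBC a e U := by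
  ext ⟨i, j, c, d, x, w⟩ ⟨i', j', c', x'⟩
  rw [mul_initCore_apply, onBC_mul_apply]
  simp only [onBC, initCore, Matrix.of_apply, mul_ite, mul_one, mul_zero, ite_and,
    Finset.sum_ite_irrel, Finset.sum_const_zero, Finset.sum_ite_eq', Finset.mem_univ, if_true]
  split_ifs <;> rfl

theorem reverse_prod_mul_of_intertwine {ι m n : Type} [Fintype m] [Fintype n] [DecidableEq m]
    [DecidableEq n] (f : ι → Matrix m m ℂ) (g : ι → Matrix n n ℂ) (J : Matrix m n ℂ)
    (h : ∀ k, f k * J = J * g k) (l : List ι) :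
    (l.map f).reverse.prod * J = J * (l.map g).reverse.prod := by
  induction l with
  | nil => simp
  | cons k l ih =>
    rw [List.map_cons, List.reverse_cons, List.prod_append, List.prod_singleton, List.map_cons,
      List.reverse_cons, List.prod_append, List.prod_singleton, Matrix.mul_assoc, h,
      ← Matrix.mul_assoc, ih, Matrix.mul_assoc]

theorem evolution_mul_initCore {N : ℕ} (P : NoiselessProtocol N a b) (w₀ : W) :
    P.evolution (Bool × (e × W)) * initCore a b e w₀ = initCore a b e w₀ * P.evolution e := by
  have h := reverse_prod_mul_of_intertwine (fun k => onBC a (Bool × (e × W)) (P.bob k).1 *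
        onAC b (Bool × (e × W)) (P.alice k.castSucc).1)
      (fun k => onBC a e (P.bob k).1 * onAC b e (P.alice k.castSucc).1) (initCore a b e w₀)
      (fun k => by rw [Matrix.mul_assoc, onAC_mul_initCore, ← Matrix.mul_assoc, onBC_mul_initCore,
        Matrix.mul_assoc]) (List.finRange (N / 2))
  rw [← List.ofFn_eq_map, ← List.ofFn_eq_map] at h
  rw [NoiselessProtocol.evolution, NoiselessProtocol.evolution, Matrix.mul_assoc, h,
    ← Matrix.mul_assoc, onAC_mul_initCore, Matrix.mul_assoc]

/-- The final state for input on `A B C E`: the result of the protocol on `A B C̃ E`. -/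
def finalCore {N : ℕ} (P : NoiselessProtocol N a b) (e : Type) [Fintype e] [DecidableEq e] {W : Type}
    [DecidableEq W] (w₀ : W) : Matrix (CoreReg a b (e × W)) (a × b × Bool × e) ℂ :=
  Matrix.of fun (i, j, c, (d, (x, w))) k =>
    if c = false ∧ w = w₀ then P.evolution e (i, j, d, x) k else 0

/-- The final exchange moves the result of the protocol from the communication qubit to `C̃`. The
factor `onEnv 1` is the empty record of the adversary's actions, to which `Leads.onEnv` applies. -/
theorem leads_initCore {N : ℕ} (P : NoiselessProtocol N a b) (w₀ : W) {K : ℕ}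
    (hK : N / 2 + 2 ≤ K) :
    Leads P (Pauli.one, Todo.initialList 0 K) (initCore a b e w₀)
      ((onEnv 1 : CoreOp a b (e × W)) * finalCore P e w₀) := by
  refine ⟨1, ?_⟩
  rw [one_smul, onEnv_one, Matrix.one_mul, todoOp, listOp_initialList P hK, pauliMatrix_one, onC_one,
    Matrix.mul_one, Matrix.mul_assoc, evolution_mul_initCore]
  ext ⟨i, j, c, d, x, w⟩ k
  rw [swapCC_mul_apply, mul_initCore_apply]
  rfl

end Initial

/-! ## Branches of classical-quantum maps -/

section Branches

variable {n M P : Type} [Fintype n] [Fintype M] [Fintype P]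

/-- The sums of maps `ρ ↦ V ρ Vᴴ`, where `V` has the property `S`. -/
def branchCone (S : Matrix P n ℂ → Prop) : AddSubmonoid (Matrix n n ℂ →ₗ[ℂ] Matrix P P ℂ) :=
  AddSubmonoid.closure {f | ∃ V, S V ∧ f = conjMap V}

theorem conjMap_mem {S : Matrix P n ℂ → Prop} {V : Matrix P n ℂ} (h : S V) :
    conjMap V ∈ branchCone S :=
  AddSubmonoid.subset_closure ⟨V, h, rfl⟩

theorem conjMap_mul (K : Matrix P P ℂ) (V : Matrix P n ℂ) :
    conjMap K ∘ₗ conjMap V = conjMap (K * V) := by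
  ext1 ρ
  simp [conjMap, Matrix.conjTranspose_mul, Matrix.mul_assoc]

theorem conjMap_zero : conjMap (0 : Matrix P n ℂ) = 0 := by
  ext1 ρ
  simp [conjMap]

/-- All branches of a map into classical-quantum states have the given property, which may depend
on the value of the classical register. -/
def AllBranches (S : M → Matrix P n ℂ → Prop)
    (T : Matrix n n ℂ →ₗ[ℂ] (M → Matrix P P ℂ)) : Prop :=
  ∀ m, LinearMap.proj m ∘ₗ T ∈ branchCone (S m)

/-- The classical value `m` and the operator `V` can become `m'` and `V'`. -/
def KrausFamily.Step (F : KrausFamily M P) (m : M) (V : Matrix P n ℂ) (m' : M)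
    (V' : Matrix P n ℂ) : Prop :=
  ∃ k, F.op m m' k ≠ 0 ∧ V' = F.op m m' k * V

/-- Branch operators get multiplied by Kraus operators. A vanishing Kraus operator gives the zero
map, which lies in every cone; this is why `Step` may demand a nonzero one, and so exclude
impossible classical transitions. -/
theorem AllBranches.act {S S' : M → Matrix P n ℂ → Prop}
    {T : Matrix n n ℂ →ₗ[ℂ] (M → Matrix P P ℂ)} (hT : AllBranches S T) (F : KrausFamily M P)
    (h : ∀ m V m' V', S m V → F.Step m V m' V' → S' m' V') : AllBranches S' (F.act ∘ₗ T) := by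
  intro m'
  have h1 : LinearMap.proj m' ∘ₗ F.act ∘ₗ T =
      ∑ m, ∑ k, conjMap (F.op m m' k) ∘ₗ (LinearMap.proj m ∘ₗ T) := by
    ext1 ρ
    simp [KrausFamily.act, LinearMap.sum_apply]
  rw [h1]
  refine AddSubmonoid.sum_mem _ fun m _ => AddSubmonoid.sum_mem _ fun k _ => ?_
  by_cases h0 : F.op m m' k = 0
  · rw [h0, conjMap_zero, LinearMap.zero_comp]
    exact zero_mem _
  · refine AddSubmonoid.closure_induction (motive := fun f _ => conjMap (F.op m m' k) ∘ₗ f ∈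
      branchCone (S' m')) ?_ ?_ ?_ (hT m)
    · rintro _ ⟨V, hV, rfl⟩
      rw [conjMap_mul]
      exact conjMap_mem (h m V m' _ hV ⟨k, h0, rfl⟩)
    · rw [LinearMap.comp_zero]
      exact zero_mem _
    · intro f g _ _ hf hg
      rw [LinearMap.comp_add]
      exact add_mem hf hg

/-- The classical value `m` and the operator `V` can become `m'` and `V'` through the given
families, first family first. -/
def Steps : List (KrausFamily M P) → M → Matrix P n ℂ → M → Matrix P n ℂ → Prop
  | [], m, V, m', V' => m' = m ∧ V' = V
  | F :: Fs, m, V, m', V' => ∃ m₁ V₁, F.Step m V m₁ V₁ ∧ Steps Fs m₁ V₁ m' V'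

/-- The fold accumulates on the left, so its accumulator `T₀` is generalised separately from the map
`T'` to which it is applied. -/
theorem AllBranches.foldl {α : Type} {T : Matrix n n ℂ →ₗ[ℂ] (M → Matrix P P ℂ)}
    (G : α → KrausFamily M P) (l : List α) {S S' : M → Matrix P n ℂ → Prop} (hT : AllBranches S T)
    (h : ∀ m V m' V', S m V → Steps (l.map G) m V m' V' → S' m' V')
    (T₀ : (M → Matrix P P ℂ) →ₗ[ℂ] (M → Matrix P P ℂ)) (T' : Matrix n n ℂ →ₗ[ℂ] (M → Matrix P P ℂ))
    (hT' : T₀ ∘ₗ T' = T) :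
    AllBranches S' (l.foldl (fun T o => (G o).act ∘ₗ T) T₀ ∘ₗ T') := by
  induction l generalizing T S T₀ with
  | nil =>
    rw [List.foldl_nil, hT']
    intro m
    refine AddSubmonoid.closure_mono ?_ (hT m)
    rintro _ ⟨V, hV, rfl⟩
    exact ⟨V, h m V m V hV ⟨rfl, rfl⟩, rfl⟩
  | cons o l ih =>
    rw [List.foldl_cons]
    -- The intermediate property is to be reachable from `S` by this one step.
    refine ih (S := fun m' V' => ∃ m V, S m V ∧ (G o).Step m V m' V') (hT.act (G o) ?_) ?_ _
      (by rw [LinearMap.comp_assoc, hT'])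
    · intro m V m' V' hV hs
      exact ⟨m, V, hV, hs⟩
    · rintro m₁ V₁ m' V' ⟨m, V, hV, hs⟩ hs'
      exact h m V m' V' hV ⟨m₁, V₁, hs, hs'⟩

theorem AllBranches.turn {α : Type} {T : Matrix n n ℂ →ₗ[ℂ] (M → Matrix P P ℂ)}
    (G : α → KrausFamily M P) (l : List α) {S S' : M → Matrix P n ℂ → Prop} (hT : AllBranches S T)
    (h : ∀ m V m' V', S m V → Steps (l.map G) m V m' V' → S' m' V') :
    AllBranches S' (l.foldl (fun T o => (G o).act ∘ₗ T) LinearMap.id ∘ₗ T) :=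
  AllBranches.foldl G l hT h _ _ (LinearMap.id_comp _)

end Branches

/-! ## Preservation of the trace -/

section Trace

variable {M P : Type} [Fintype M] [Fintype P] [DecidableEq P]

/-- The family preserves the trace. -/
def KrausFamily.Complete (F : KrausFamily M P) : Prop :=
  ∀ m, ∑ m', ∑ k, (F.op m m' k).conjTranspose * F.op m m' k = 1

/-- The total trace of a classical-quantum state. -/
def totalTrace (σ : M → Matrix P P ℂ) : ℂ := ∑ m, (σ m).trace

theorem totalTrace_act {F : KrausFamily M P} (hF : F.Complete) (σ : M → Matrix P P ℂ) :
    totalTrace (F.act σ) = totalTrace σ := by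
  have h1 : ∀ m m' k, (F.op m m' k * σ m * (F.op m m' k).conjTranspose).trace =
      ((F.op m m' k).conjTranspose * F.op m m' k * σ m).trace := fun m m' k => by
    rw [Matrix.trace_mul_comm, ← Matrix.mul_assoc]
  calc totalTrace (F.act σ)
      = ∑ m', ∑ m, ∑ k, ((F.op m m' k).conjTranspose * F.op m m' k * σ m).trace := by
        simp only [totalTrace, KrausFamily.act, LinearMap.pi_apply, LinearMap.sum_apply,
          LinearMap.comp_apply, LinearMap.proj_apply, Matrix.trace_sum]
        simp only [conjMap, LinearMap.coe_mk, AddHom.coe_mk, h1]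
    _ = ∑ m, ∑ m', ∑ k, ((F.op m m' k).conjTranspose * F.op m m' k * σ m).trace :=
        Finset.sum_comm
    _ = totalTrace σ := by
        refine Finset.sum_congr rfl fun m _ => ?_
        simp only [← Matrix.trace_sum, ← Finset.sum_mul, hF m, one_mul]

theorem totalTrace_foldl {α : Type} (G : α → KrausFamily M P) (hG : ∀ o, (G o).Complete)
    (l : List α) (T : (M → Matrix P P ℂ) →ₗ[ℂ] (M → Matrix P P ℂ))
    (hT : ∀ σ, totalTrace (T σ) = totalTrace σ) (σ : M → Matrix P P ℂ) :
    totalTrace (l.foldl (fun T o => (G o).act ∘ₗ T) T σ) = totalTrace σ := by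
  induction l generalizing T with
  | nil => exact hT σ
  | cons o l ih =>
    exact ih _ fun σ => by rw [LinearMap.comp_apply, totalTrace_act (hG o), hT]

theorem kronecker_one_complete {K : Type} (A : Matrix P P ℂ) [Fintype K] [DecidableEq K] :
    (A ⊗ₖ (1 : Matrix K K ℂ)).conjTranspose * (A ⊗ₖ (1 : Matrix K K ℂ)) =
      (A.conjTranspose * A) ⊗ₖ (1 : Matrix K K ℂ) := by
  rw [Matrix.conjTranspose_kronecker, ← Matrix.mul_kronecker_mul, Matrix.conjTranspose_one,
    one_mul]

theorem one_kronecker_complete {K : Type} (A : Matrix P P ℂ) [Fintype K] [DecidableEq K] :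
    ((1 : Matrix K K ℂ) ⊗ₖ A).conjTranspose * ((1 : Matrix K K ℂ) ⊗ₖ A) =
      (1 : Matrix K K ℂ) ⊗ₖ (A.conjTranspose * A) := by
  rw [Matrix.conjTranspose_kronecker, ← Matrix.mul_kronecker_mul, Matrix.conjTranspose_one,
    one_mul]

theorem sum_kronecker_one {ι K : Type} [DecidableEq K] (s : Finset ι) (f : ι → Matrix P P ℂ) :
    ∑ i ∈ s, f i ⊗ₖ (1 : Matrix K K ℂ) = (∑ i ∈ s, f i) ⊗ₖ (1 : Matrix K K ℂ) := by
  ext ⟨i, j⟩ ⟨i', j'⟩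
  simp [Matrix.sum_apply, Matrix.kroneckerMap_apply, Finset.sum_mul]

theorem sum_one_kronecker {ι K : Type} [DecidableEq K] (s : Finset ι) (f : ι → Matrix P P ℂ) :
    ∑ i ∈ s, (1 : Matrix K K ℂ) ⊗ₖ f i = (1 : Matrix K K ℂ) ⊗ₖ (∑ i ∈ s, f i) := by
  ext ⟨i, j⟩ ⟨i', j'⟩
  simp [Matrix.sum_apply, Matrix.kroneckerMap_apply, Finset.mul_sum]

theorem conjTranspose_mul_self_ite (c : Prop) [Decidable c] (A : Matrix P P ℂ) :
    (if c then A else 0).conjTranspose * (if c then A else 0) =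
      if c then A.conjTranspose * A else 0 := by
  split_ifs <;> simp

theorem liftQuery_mul_apply {r V γ : Type} [Fintype r] [DecidableEq r] [Fintype V] [DecidableEq V]
    (U : Matrix (r × Bool) (r × Bool) ℂ) (Ψ : Matrix (r × r × Bool × V) γ ℂ) (i d : r) (c : Bool)
    (v : V) (k : γ) :
    (liftQuery V U * Ψ) (i, d, c, v) k = ∑ i', ∑ c', U (i, c) (i', c') * Ψ (i', d, c', v) k := by
  simp only [Matrix.mul_apply, liftQuery, Matrix.of_apply, Fintype.sum_prod_type, ite_and, ite_mul,
    zero_mul, Finset.sum_ite_irrel, Finset.sum_const_zero, Finset.sum_ite_eq,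
    Finset.mem_univ, if_true]

theorem liftQuery_mul {r V : Type} [Fintype r] [DecidableEq r] [Fintype V] [DecidableEq V]
    (U U' : Matrix (r × Bool) (r × Bool) ℂ) :
    liftQuery V U * liftQuery V U' = liftQuery V (U * U') := by
  ext ⟨i, d, c, v⟩ ⟨i', d', c', v'⟩
  rw [liftQuery_mul_apply]
  simp only [liftQuery, Matrix.of_apply, Matrix.mul_apply, Fintype.sum_prod_type, mul_ite, mul_zero,
    Finset.sum_ite_irrel, Finset.sum_const_zero]

theorem liftQuery_one {r V : Type} [DecidableEq r] [DecidableEq V] :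
    liftQuery V (1 : Matrix (r × Bool) (r × Bool) ℂ) = 1 := by
  ext ⟨i, d, c, v⟩ ⟨i', d', c', v'⟩
  simp only [liftQuery, Matrix.of_apply, Matrix.one_apply, Prod.mk.injEq, ← ite_and]
  congr 1
  exact propext (by tauto)

theorem liftQuery_conjTranspose {r V : Type} [DecidableEq r] [DecidableEq V]
    (U : Matrix (r × Bool) (r × Bool) ℂ) :
    (liftQuery V U).conjTranspose = liftQuery V U.conjTranspose := by
  ext ⟨i, d, c, v⟩ ⟨i', d', c', v'⟩
  simp only [liftQuery, Matrix.of_apply, Matrix.conjTranspose_apply, apply_ite star, star_zero,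
    eq_comm (a := d'), eq_comm (a := v')]

theorem swapMatrix_conjTranspose (r V : Type) [DecidableEq r] [DecidableEq V] :
    (swapMatrix r V).conjTranspose = swapMatrix r V := by
  ext ⟨i, d, w⟩ ⟨i', d', w'⟩
  simp only [swapMatrix, Matrix.of_apply, Matrix.conjTranspose_apply, apply_ite star, star_zero,
    star_one]
  congr 1
  exact propext ⟨fun h => ⟨h.2.1.symm, h.1.symm, h.2.2.symm⟩, fun h => ⟨h.2.1.symm, h.1.symm, h.2.2.symm⟩⟩

theorem swapMatrix_mul_apply {r V γ : Type} [Fintype r] [DecidableEq r] [Fintype V] [DecidableEq V]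
    (Ψ : Matrix (r × r × Bool × V) γ ℂ) (i d : r) (w : Bool × V) (k : γ) :
    (swapMatrix r V * Ψ) (i, d, w) k = Ψ (d, i, w) k := by
  obtain ⟨c, v⟩ := w
  simp only [Matrix.mul_apply, swapMatrix, Matrix.of_apply, Fintype.sum_prod_type, ite_and, ite_mul,
    zero_mul, one_mul, Finset.sum_ite_irrel, Finset.sum_const_zero, Finset.sum_ite_eq,
    Finset.mem_univ, if_true]

theorem swapMatrix_mul_self (r V : Type) [Fintype r] [DecidableEq r] [Fintype V] [DecidableEq V] :
    swapMatrix r V * swapMatrix r V = 1 := by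
  ext ⟨i, d, w⟩ ⟨i', d', w'⟩
  rw [swapMatrix_mul_apply]
  simp only [swapMatrix, Matrix.of_apply, Matrix.one_apply, Prod.mk.injEq]
  congr 1
  exact propext (by tauto)

theorem LocalOp.complete_kraus {J M V r : Type} [Fintype M] [DecidableEq M] [Fintype V]
    [DecidableEq V] [Fintype r] [DecidableEq r] (U : J → Matrix.unitaryGroup (r × Bool) ℂ)
    (o : LocalOp J M V) : (o.kraus U).Complete := by
  intro m
  have diag : ∀ B : Matrix (r × r × Bool × V) (r × r × Bool × V) ℂ, B.conjTranspose * B = 1 →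
      ∑ m', ∑ _k : Fin 1, (if m = m' then B else 0).conjTranspose * (if m = m' then B else 0)
        = 1 := by
    intro B hB
    simp only [conjTranspose_mul_self_ite, Finset.sum_const, Finset.card_univ, Fintype.card_fin,
      one_smul, Finset.sum_ite_eq, Finset.mem_univ, if_true, hB]
  cases o with
  | instr I =>
    simp only [LocalOp.kraus, one_kronecker_complete, sum_one_kronecker]
    exact (congrArg (fun A => (1 : Matrix r r ℂ) ⊗ₖ ((1 : Matrix r r ℂ) ⊗ₖ A)) (I.complete m)).trans
      (by rw [Matrix.one_kronecker_one, Matrix.one_kronecker_one])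
  | query f =>
    refine diag _ ?_
    rcases f m with _ | ⟨j, _ | _⟩
    · simp
    · dsimp only
      rw [liftQuery_conjTranspose, liftQuery_mul]
      exact (congrArg _ ((Matrix.mem_unitaryGroup_iff').1 (U j).2)).trans liftQuery_one
    · dsimp only
      rw [liftQuery_conjTranspose, liftQuery_mul, Matrix.conjTranspose_conjTranspose]
      exact (congrArg _ ((Matrix.mem_unitaryGroup_iff).1 (U j).2)).trans liftQuery_one
  | swap f =>
    refine diag _ ?_
    split_ifs
    · rw [swapMatrix_conjTranspose, swapMatrix_mul_self]
    · simp

/-! ### Trace preservation of the simulator -/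

namespace Simulator

variable {N q : ℕ} {e : Type} [Fintype e] [DecidableEq e]
  {a b : Type} [Fintype a] [DecidableEq a] [Fintype b] [DecidableEq b]

theorem complete_onAlice (S : Simulator N q) (E : Adversary q e)
    {F : KrausFamily (S.X × Fin q) (S.AliceReg a)} (hF : F.Complete) :
    (S.onAlice b E F).Complete := by
  rintro ⟨x, y, z, c⟩
  have h := hF (x, c)
  rw [Fintype.sum_prod_type] at h
  simp only [onAlice, conjTranspose_mul_self_ite, kronecker_one_complete, Fintype.sum_prod_type,
    ite_and, Finset.sum_ite_irrel, Finset.sum_const_zero, Finset.sum_ite_eq, Finset.mem_univ,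
    if_true, sum_kronecker_one]
  exact (congrArg (fun A => A ⊗ₖ (1 : Matrix (S.BobReg b × (e × E.W)) (S.BobReg b × (e × E.W)) ℂ))
    h).trans Matrix.one_kronecker_one

theorem complete_onBob (S : Simulator N q) (E : Adversary q e)
    {F : KrausFamily (S.Y × Fin q) (S.BobReg b)} (hF : F.Complete) :
    (S.onBob a E F).Complete := by
  rintro ⟨x, y, z, c⟩
  have h := hF (y, c)
  rw [Fintype.sum_prod_type] at h
  simp only [onBob, conjTranspose_mul_self_ite, one_kronecker_complete, kronecker_one_complete,
    Fintype.sum_prod_type,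
    ite_and, Finset.sum_ite_irrel, Finset.sum_const_zero, Finset.sum_ite_eq, Finset.mem_univ,
    if_true, sum_one_kronecker, sum_kronecker_one]
  exact (congrArg (fun A => (1 : Matrix (S.AliceReg a) (S.AliceReg a) ℂ) ⊗ₖ
    (A ⊗ₖ (1 : Matrix (e × E.W) (e × E.W) ℂ))) h).trans
    (by rw [Matrix.one_kronecker_one, Matrix.one_kronecker_one])

theorem complete_onEve (S : Simulator N q) (E : Adversary q e)
    {F : KrausFamily (E.Z × Fin q) (e × E.W)} (hF : F.Complete) :
    (S.onEve a b E F).Complete := by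
  rintro ⟨x, y, z, c⟩
  have h := hF (z, c)
  rw [Fintype.sum_prod_type] at h
  simp only [onEve, conjTranspose_mul_self_ite, one_kronecker_complete, Fintype.sum_prod_type,
    ite_and, Finset.sum_ite_irrel, Finset.sum_const_zero, Finset.sum_ite_eq, Finset.mem_univ,
    if_true, sum_one_kronecker]
  exact (congrArg (fun A => (1 : Matrix (S.AliceReg a) (S.AliceReg a) ℂ) ⊗ₖ
    ((1 : Matrix (S.BobReg b) (S.BobReg b) ℂ) ⊗ₖ A)) h).trans
    (by rw [Matrix.one_kronecker_one, Matrix.one_kronecker_one])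

theorem totalTrace_aliceTurn (S : Simulator N q) (P : NoiselessProtocol N a b) (E : Adversary q e)
    (i : ℕ) (σ : S.GlobalState a b E) : totalTrace (S.aliceTurn P E i σ) = totalTrace σ :=
  totalTrace_foldl (fun o => S.onAlice b E (LocalOp.kraus P.alice o))
    (fun o => S.complete_onAlice E (o.complete_kraus _)) _ _ (fun _ => rfl) σ

theorem totalTrace_bobTurn (S : Simulator N q) (P : NoiselessProtocol N a b) (E : Adversary q e)
    (i : ℕ) (σ : S.GlobalState a b E) : totalTrace (S.bobTurn P E i σ) = totalTrace σ :=
  totalTrace_foldl (fun o => S.onBob a E (LocalOp.kraus P.bob o))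
    (fun o => S.complete_onBob E (o.complete_kraus _)) _ _ (fun _ => rfl) σ

/-- This holds against every adversary, and is what later pins down the effect of the adversary on
the output. -/
theorem totalTrace_runRounds (S : Simulator N q) (P : NoiselessProtocol N a b) (E : Adversary q e)
    (n : ℕ) (σ : S.GlobalState a b E) : totalTrace (S.runRounds P E n σ) = totalTrace σ := by
  have hE : ∀ i σ, totalTrace (S.eveTurn a b E i σ) = totalTrace σ := fun i σ =>
    totalTrace_act (S.complete_onEve E (E.step i).complete) σ
  induction n with
  | zero => rfl
  | succ n ih =>
    simp only [runRounds, LinearMap.comp_apply]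
    rw [hE, totalTrace_bobTurn, hE, totalTrace_aliceTurn, ih]

end Simulator

end Trace

/-! ## Teleportation -/

section Teleportation

variable {p : ℕ}

/-- A communication qubit with halves of EPR pairs. -/
abbrev HalfReg (p : ℕ) : Type := Bool × (Fin p → Bool)

/-- Exchange of the communication qubit with the half of pair number `l`. -/
def loadMatrix (l : Fin p) : Matrix (HalfReg p) (HalfReg p) ℂ :=
  Matrix.of fun (c, t) (c', t') => if c' = t l ∧ t' = Function.update t l c then 1 else 0

/-- A Pauli operator on the communication qubit. -/
def pauliLocal (x : Pauli) : Matrix (HalfReg p) (HalfReg p) ℂ :=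
  Matrix.of fun (c, t) (c', t') => if t = t' then pauliMatrix x c c' else 0

/-- Bell measurement, with outcome `o`, of the communication qubit and the half of pair number `l`;
both are reset. -/
def bellMatrix (l : Fin p) (o : Pauli) : Matrix (HalfReg p) (HalfReg p) ℂ :=
  Matrix.of fun (c, t) (c', t') =>
    if c = false ∧ t l = false ∧ t' = Function.update t l (xor c' o.1) then
      ((Real.sqrt 2 : ℝ) : ℂ)⁻¹ * (if o.2 && c' then -1 else 1) else 0

theorem conjTranspose_loadMatrix_mul (l : Fin p) :
    (loadMatrix l).conjTranspose * loadMatrix l = 1 := by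
  have hiff : ∀ (c c' : Bool) (t t' : Fin p → Bool), (c' = t l ∧ t' = Function.update t l c) ↔
      (c = t' l ∧ t = Function.update t' l c') := by
    intro c c' t t'
    constructor
    · rintro ⟨rfl, rfl⟩; simp
    · rintro ⟨rfl, rfl⟩; simp
  ext ⟨c, t⟩ ⟨c', t'⟩
  simp only [Matrix.mul_apply, Matrix.conjTranspose_apply, loadMatrix, Matrix.of_apply,
    Fintype.sum_prod_type, hiff, apply_ite star, star_one, star_zero, ite_and, ite_mul, one_mul,
    zero_mul, Finset.sum_ite_irrel, Finset.sum_const_zero, Finset.sum_ite_eq',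
    Finset.mem_univ, if_true, Matrix.one_apply, Prod.mk.injEq]
  by_cases h : c = c' ∧ t = t'
  · obtain ⟨rfl, rfl⟩ := h; simp
  · rw [← ite_and, if_neg, ← ite_and, if_neg h]
    rintro ⟨h1, h2⟩
    have h3 := congrFun h2 l
    simp only [Function.update_self] at h3
    refine h ⟨h3, funext fun k => ?_⟩
    by_cases hk : k = l
    · rw [hk, h1]
    · simpa [hk] using congrFun h2 k

theorem conjTranspose_pauliLocal_mul (x : Pauli) :
    (pauliLocal x : Matrix (HalfReg p) (HalfReg p) ℂ).conjTranspose * pauliLocal x = 1 := by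
  ext ⟨c, t⟩ ⟨c', t'⟩
  have h := congrFun (congrFun (conjTranspose_pauliMatrix_mul x) c) c'
  rw [Matrix.mul_apply] at h
  simp only [Matrix.conjTranspose_apply] at h
  simp only [Matrix.mul_apply, Matrix.conjTranspose_apply, pauliLocal, Matrix.of_apply,
    Fintype.sum_prod_type, apply_ite star, star_zero, ite_mul, mul_ite, mul_zero,
    zero_mul, Finset.sum_ite_irrel, Finset.sum_const_zero, Finset.sum_ite_eq',
    Finset.mem_univ, if_true, h]
  simp only [Matrix.one_apply, Prod.mk.injEq, ite_and, eq_comm (a := t') (b := t)]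
  split_ifs <;> rfl

/-- The rows of the four outcomes are the Bell vectors of the communication qubit and half `l`; they
form an orthonormal basis, and the reset does not affect the products. -/
theorem sum_conjTranspose_bellMatrix_mul (l : Fin p) :
    ∑ o, (bellMatrix l o).conjTranspose * bellMatrix l o = 1 := by
  -- Solving for the row index `t` lets the sum over rows collapse.
  have hiff : ∀ (v : Bool) (t t' : Fin p → Bool), (t l = false ∧ t' = Function.update t l v) ↔
      (t = Function.update t' l false ∧ t' l = v) := by
    intro v t t'
    constructor
    · rintro ⟨h, rfl⟩; simp [← h]
    · rintro ⟨rfl, rfl⟩; simp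
  have hsq : ((Real.sqrt 2 : ℝ) : ℂ)⁻¹ * ((Real.sqrt 2 : ℝ) : ℂ)⁻¹ = 1 / 2 := by
    rw [← mul_inv, ← Complex.ofReal_mul, Real.mul_self_sqrt (by norm_num)]
    norm_num
  ext ⟨c, t⟩ ⟨c', t'⟩
  simp only [Matrix.sum_apply, Matrix.mul_apply, Matrix.conjTranspose_apply, bellMatrix,
    Matrix.of_apply, Fintype.sum_prod_type, hiff, apply_ite star, star_zero, ite_and, ite_mul,
    mul_ite, mul_zero, zero_mul, Finset.sum_ite_irrel, Finset.sum_const_zero,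
    Finset.sum_ite_eq', Finset.mem_univ, if_true]
  by_cases hu : Function.update t l false = Function.update t' l false
  · have htt : t = t' ↔ t l = t' l := by
      refine ⟨fun h => by rw [h], fun h => funext fun k => ?_⟩
      by_cases hk : k = l
      · rw [hk, h]
      · simpa [hk] using congrFun hu k
    simp only [Matrix.one_apply, Prod.mk.injEq, htt, hu, if_true]
    generalize t l = u
    generalize t' l = u'
    have hs : star (((Real.sqrt 2 : ℝ) : ℂ)⁻¹) = ((Real.sqrt 2 : ℝ) : ℂ)⁻¹ := by
      rw [star_inv₀, Complex.star_def, Complex.conj_ofReal]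
    cases c <;> cases c' <;> cases u <;> cases u' <;> simp [hs, hsq] <;> norm_num
  · have htt : t ≠ t' := fun h => hu (by rw [h])
    have hu' : ¬ Function.update t' l false = Function.update t l false := fun h => hu h.symm
    simp [hu', htt]

/-- The location of a qubit, as a linear embedding of the qubit into two half registers. -/
abbrev Location (p : ℕ) : Type := HalfReg p → HalfReg p → Bool → ℂ

namespace Location

/-- Action on the first half register. -/
def actFst (M : Matrix (HalfReg p) (HalfReg p) ℂ) (κ : Location p) : Location p :=
  fun h₁ h₂ d => ∑ h, M h₁ h * κ h h₂ d

/-- Action on the second half register. -/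
def actSnd (M : Matrix (HalfReg p) (HalfReg p) ℂ) (κ : Location p) : Location p :=
  fun h₁ h₂ d => ∑ h, M h₂ h * κ h₁ h d

/-- Exchange of the half registers. -/
def flip (κ : Location p) : Location p := fun h₁ h₂ d => κ h₂ h₁ d

/-- Action on the qubit. -/
def actQubit (κ : Location p) (M : Matrix Bool Bool ℂ) : Location p :=
  fun h₁ h₂ d => ∑ d', κ h₁ h₂ d' * M d' d

/-- The state of the EPR pairs when the first `n` have been used and reset. -/
def IsFresh (n : ℕ) (t t' : Fin p → Bool) : Prop :=
  ∀ l, if l.1 < n then t l = false ∧ t' l = false else t l = t' l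

instance (n : ℕ) (t t' : Fin p → Bool) : Decidable (IsFresh n t t') :=
  inferInstanceAs (Decidable (∀ _ : Fin p, _))

/-- The amplitude of the second half register and the EPR pairs when the first register holds the
qubit. -/
def amplitude (n : ℕ) (h₂ : HalfReg p) (t : Fin p → Bool) : ℂ :=
  if h₂.1 = false ∧ IsFresh n t h₂.2 then 1 else 0

/-- The qubit is the communication qubit of the first register, and `n` pairs have been used. -/
def held (p n : ℕ) : Location p := fun (c, t) h₂ d => if c = d then amplitude n h₂ t else 0

/-- The qubit has been teleported to the second register by means of pair number `n`. -/
def sent (n : Fin p) : Location p := fun (c, t) (c', t') d =>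
  if (c = false ∧ c' = false ∧ t n = false ∧ t' n = d) ∧
    ∀ l : Fin p, l ≠ n → if l.1 < n.1 then t l = false ∧ t' l = false else t l = t' l
  then 1 else 0

/-- The exchange puts the reset communication qubit `false` into half `n`, so pair `n` joins the
used and reset pairs. -/
theorem actSnd_load (n : Fin p) : actSnd (loadMatrix n) (sent n) = flip (held p (n + 1)) := by
  funext ⟨c, t⟩ ⟨c', t'⟩ d
  simp only [actSnd, flip, loadMatrix, Matrix.of_apply, Fintype.sum_prod_type, ite_and, ite_mul,
    one_mul, zero_mul, Finset.sum_ite_irrel, Finset.sum_const_zero, Finset.sum_ite_eq',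
    Finset.mem_univ, if_true]
  simp only [sent, held, amplitude, ← ite_and]
  congr 1
  apply propext
  simp only [Function.update_self]
  constructor
  · rintro ⟨⟨h1, h2, h3, h4⟩, h5⟩
    refine ⟨h4, h1, fun l => ?_⟩
    by_cases hl : l = n
    · subst hl; simp [h2, h3]
    · have := h5 l hl
      have hlt : l.1 ≠ n.1 := fun h => hl (Fin.ext h)
      rw [Function.update_of_ne hl] at this
      split_ifs at this ⊢ with h6 h7 h7
      · exact this.symm
      · omega
      · omega
      · exact this.symm
  · rintro ⟨h1, h2, h3⟩
    have hn := h3 n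
    rw [if_pos (by omega)] at hn
    refine ⟨⟨h2, hn.1, hn.2, h1⟩, fun l hl => ?_⟩
    have := h3 l
    have hlt : l.1 ≠ n.1 := fun h => hl (Fin.ext h)
    rw [Function.update_of_ne hl]
    split_ifs at this ⊢ with h6 h7 h7
    · exact this.symm
    · omega
    · omega
    · exact this.symm

theorem actFst_load (n : Fin p) : actFst (loadMatrix n) (flip (sent n)) = held p (n + 1) :=
  congrArg flip (actSnd_load n)

/-- Teleportation: outcome `o` leaves the qubit in the other half with the Pauli operator `o`
applied. The factor is `1 / √2` and not `1 / 2` because `held` contains unnormalised pairs `|00⟩ +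
|11⟩`. -/
theorem actFst_bell (n : Fin p) (o : Pauli) : actFst (bellMatrix n o) (held p n) =
    ((Real.sqrt 2 : ℝ) : ℂ)⁻¹ • actQubit (sent n) (pauliMatrix o) := by
  funext ⟨c, t⟩ ⟨c', t'⟩ d
  have key : ∀ v : Bool, (c = false ∧ t n = false ∧ c' = false ∧
      IsFresh n (Function.update t n v) t') ↔
      ((c = false ∧ c' = false ∧ t n = false ∧ t' n = v) ∧
        ∀ l : Fin p, l ≠ n → if l.1 < n.1 then t l = false ∧ t' l = false else t l = t' l) := by
    intro v
    constructor
    · rintro ⟨h1, h2, h3, h4⟩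
      have hn := h4 n
      rw [if_neg (by omega), Function.update_self] at hn
      refine ⟨⟨h1, h3, h2, hn.symm⟩, fun l hl => ?_⟩
      have := h4 l
      rwa [Function.update_of_ne hl] at this
    · rintro ⟨⟨h1, h3, h2, hn⟩, h4⟩
      refine ⟨h1, h2, h3, fun l => ?_⟩
      by_cases hl : l = n
      · subst hl; simp [hn]
      · rw [Function.update_of_ne hl]
        exact h4 l hl
  have h1 : actFst (bellMatrix n o) (held p n) (c, t) (c', t') d =
      if c = false ∧ t n = false ∧ c' = false ∧ IsFresh n (Function.update t n (xor d o.1)) t' then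
        ((Real.sqrt 2 : ℝ) : ℂ)⁻¹ * (if o.2 && d then -1 else 1) else 0 := by
    simp only [actFst, bellMatrix, held, Matrix.of_apply, Fintype.sum_prod_type, mul_ite, mul_zero,
      Finset.sum_ite_irrel, Finset.sum_const_zero, Finset.sum_ite_eq', Finset.mem_univ, if_true]
    simp only [ite_and, ite_mul, zero_mul, Finset.sum_ite_irrel, Finset.sum_const_zero,
      Finset.sum_ite_eq', Finset.mem_univ, if_true]
    simp only [amplitude, ite_and, mul_ite, mul_one, mul_zero]
    split_ifs <;> simp
  rw [h1]
  simp only [key]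
  simp only [Pi.smul_apply, smul_eq_mul, actQubit, sent, pauliMatrix, Matrix.of_apply, mul_ite,
    mul_zero, Finset.sum_ite_eq', Finset.mem_univ, if_true, ite_mul, one_mul, zero_mul, mul_one]
  split_ifs <;> rfl

theorem actSnd_bell (n : Fin p) (o : Pauli) : actSnd (bellMatrix n o) (flip (held p n)) =
    ((Real.sqrt 2 : ℝ) : ℂ)⁻¹ • actQubit (flip (sent n)) (pauliMatrix o) :=
  congrArg flip (actFst_bell n o)

theorem actFst_pauli (n : ℕ) (x : Pauli) :
    actFst (pauliLocal x) (held p n) = actQubit (held p n) (pauliMatrix x) := by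
  funext ⟨c, t⟩ ⟨c', t'⟩ d
  simp only [actFst, actQubit, pauliLocal, held, Matrix.of_apply, Fintype.sum_prod_type, ite_mul,
    mul_ite, mul_zero, zero_mul, Finset.sum_ite_irrel, Finset.sum_ite_eq', Finset.sum_ite_eq,
    Finset.mem_univ, if_true, mul_comm]

theorem actSnd_pauli (n : ℕ) (x : Pauli) :
    actSnd (pauliLocal x) (flip (held p n)) = actQubit (flip (held p n)) (pauliMatrix x) :=
  congrArg flip (actFst_pauli n x)

end Location

end Teleportation

/-! ## Global operators -/

section Placing

theorem kronecker_one_mul_apply {P K γ : Type} [Fintype P] [Fintype K] [DecidableEq K]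
    (A : Matrix P P ℂ) (V : Matrix (P × K) γ ℂ) (i : P) (k : K) (j : γ) :
    ((A ⊗ₖ (1 : Matrix K K ℂ)) * V) (i, k) j = (A * Matrix.of fun i' j => V (i', k) j) i j := by
  simp only [Matrix.mul_apply, Fintype.sum_prod_type, Matrix.kroneckerMap_apply, Matrix.one_apply,
    mul_ite, mul_one, mul_zero, ite_mul, zero_mul, Finset.sum_ite_eq, Finset.mem_univ, if_true,
    Matrix.of_apply]

theorem one_kronecker_mul_apply {P K γ : Type} [Fintype P] [Fintype K] [DecidableEq K]
    (A : Matrix P P ℂ) (V : Matrix (K × P) γ ℂ) (k : K) (i : P) (j : γ) :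
    (((1 : Matrix K K ℂ) ⊗ₖ A) * V) (k, i) j = (A * Matrix.of fun i' j => V (k, i') j) i j := by
  simp only [Matrix.mul_apply, Fintype.sum_prod_type, Matrix.kroneckerMap_apply, Matrix.one_apply,
    ite_mul, one_mul, zero_mul, Finset.sum_ite_irrel, Finset.sum_const_zero, Finset.sum_ite_eq,
    Finset.mem_univ, if_true, Matrix.of_apply]

/-! ### Local operators on the registers of a party -/

section LocalMatrices

variable {p : ℕ} (W : Type) [DecidableEq W]

/-- An operator on `C_A` and Alice's halves of the EPR pairs. -/
def aliceLocal (M : Matrix (HalfReg p) (HalfReg p) ℂ) :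
    Matrix (Bool × (Bool × W × (Fin p → Bool))) (Bool × (Bool × W × (Fin p → Bool))) ℂ :=
  Matrix.of fun (c, d, w, t) (c', d', w', t') => if d = d' ∧ w = w' then M (c, t) (c', t') else 0

/-- An operator on `C_B` and Bob's halves of the EPR pairs. -/
def bobLocal (M : Matrix (HalfReg p) (HalfReg p) ℂ) :
    Matrix (Bool × (W × (Fin p → Bool))) (Bool × (W × (Fin p → Bool))) ℂ :=
  Matrix.of fun (c, w, t) (c', w', t') => if w = w' then M (c, t) (c', t') else 0

/-- The exchange of `C_A` and `C̃`. -/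
def aliceSwap (p : ℕ) :
    Matrix (Bool × (Bool × W × (Fin p → Bool))) (Bool × (Bool × W × (Fin p → Bool))) ℂ :=
  Matrix.of fun (c, d, w, t) (c', d', w', t') => if c = d' ∧ d = c' ∧ w = w' ∧ t = t' then 1 else 0

variable {W} [Fintype W]

theorem aliceLocal_mul_apply {γ : Type} (M : Matrix (HalfReg p) (HalfReg p) ℂ)
    (V : Matrix (Bool × (Bool × W × (Fin p → Bool))) γ ℂ) (c d : Bool) (w : W) (t : Fin p → Bool)
    (k : γ) : (aliceLocal W M * V) (c, d, w, t) k = ∑ h, M (c, t) h * V (h.1, d, w, h.2) k := by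
  simp only [Matrix.mul_apply, aliceLocal, Matrix.of_apply, Fintype.sum_prod_type, ite_and, ite_mul,
    zero_mul, Finset.sum_ite_irrel, Finset.sum_const_zero, Finset.sum_ite_eq, Finset.mem_univ,
    if_true]

theorem bobLocal_mul_apply {γ : Type} (M : Matrix (HalfReg p) (HalfReg p) ℂ)
    (V : Matrix (Bool × (W × (Fin p → Bool))) γ ℂ) (c : Bool) (w : W) (t : Fin p → Bool)
    (k : γ) : (bobLocal W M * V) (c, w, t) k = ∑ h, M (c, t) h * V (h.1, w, h.2) k := by
  simp only [Matrix.mul_apply, bobLocal, Matrix.of_apply, Fintype.sum_prod_type, ite_mul,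
    zero_mul, Finset.sum_ite_irrel, Finset.sum_const_zero, Finset.sum_ite_eq, Finset.mem_univ,
    if_true]

theorem aliceSwap_mul_apply {γ : Type} (V : Matrix (Bool × (Bool × W × (Fin p → Bool))) γ ℂ)
    (c d : Bool) (w : W) (t : Fin p → Bool) (k : γ) :
    (aliceSwap W p * V) (c, d, w, t) k = V (d, c, w, t) k := by
  simp only [Matrix.mul_apply, aliceSwap, Matrix.of_apply, Fintype.sum_prod_type, ite_and, ite_mul,
    one_mul, zero_mul, Finset.sum_ite_irrel, Finset.sum_const_zero, Finset.sum_ite_eq,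
    Finset.mem_univ, if_true]

theorem aliceLocal_one : aliceLocal W (1 : Matrix (HalfReg p) (HalfReg p) ℂ) = 1 := by
  ext ⟨c, d, w, t⟩ ⟨c', d', w', t'⟩
  simp only [aliceLocal, Matrix.of_apply, Matrix.one_apply, Prod.mk.injEq, ← ite_and]
  congr 1
  exact propext (by tauto)

theorem bobLocal_one : bobLocal W (1 : Matrix (HalfReg p) (HalfReg p) ℂ) = 1 := by
  ext ⟨c, w, t⟩ ⟨c', w', t'⟩
  simp only [bobLocal, Matrix.of_apply, Matrix.one_apply, Prod.mk.injEq, ← ite_and]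
  congr 1
  exact propext (by tauto)

theorem conjTranspose_aliceLocal_mul (M : Matrix (HalfReg p) (HalfReg p) ℂ) :
    (aliceLocal W M).conjTranspose * aliceLocal W M = aliceLocal W (M.conjTranspose * M) := by
  have h : (aliceLocal W M).conjTranspose = aliceLocal W M.conjTranspose := by
    ext ⟨c, d, w, t⟩ ⟨c', d', w', t'⟩
    simp only [aliceLocal, Matrix.of_apply, Matrix.conjTranspose_apply, apply_ite star, star_zero,
      eq_comm (a := d'), eq_comm (a := w')]
  rw [h]
  ext ⟨c, d, w, t⟩ ⟨c', d', w', t'⟩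
  rw [aliceLocal_mul_apply]
  simp only [aliceLocal, Matrix.of_apply, mul_ite, mul_zero, Finset.sum_ite_irrel,
    Finset.sum_const_zero, Matrix.mul_apply]

theorem conjTranspose_bobLocal_mul (M : Matrix (HalfReg p) (HalfReg p) ℂ) :
    (bobLocal W M).conjTranspose * bobLocal W M = bobLocal W (M.conjTranspose * M) := by
  have h : (bobLocal W M).conjTranspose = bobLocal W M.conjTranspose := by
    ext ⟨c, w, t⟩ ⟨c', w', t'⟩
    simp only [bobLocal, Matrix.of_apply, Matrix.conjTranspose_apply, apply_ite star, star_zero,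
      eq_comm (a := w')]
  rw [h]
  ext ⟨c, w, t⟩ ⟨c', w', t'⟩
  rw [bobLocal_mul_apply]
  simp only [bobLocal, Matrix.of_apply, mul_ite, mul_zero, Finset.sum_ite_irrel,
    Finset.sum_const_zero, Matrix.mul_apply]

theorem aliceLocal_sum {ι : Type} (s : Finset ι) (f : ι → Matrix (HalfReg p) (HalfReg p) ℂ) :
    aliceLocal W (∑ i ∈ s, f i) = ∑ i ∈ s, aliceLocal W (f i) := by
  ext ⟨c, d, w, t⟩ ⟨c', d', w', t'⟩
  simp only [aliceLocal, Matrix.of_apply, Matrix.sum_apply, Finset.sum_ite_irrel,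
    Finset.sum_const_zero]

theorem bobLocal_sum {ι : Type} (s : Finset ι) (f : ι → Matrix (HalfReg p) (HalfReg p) ℂ) :
    bobLocal W (∑ i ∈ s, f i) = ∑ i ∈ s, bobLocal W (f i) := by
  ext ⟨c, w, t⟩ ⟨c', w', t'⟩
  simp only [bobLocal, Matrix.of_apply, Matrix.sum_apply, Finset.sum_ite_irrel,
    Finset.sum_const_zero]

theorem conjTranspose_aliceSwap_mul : (aliceSwap W p).conjTranspose * aliceSwap W p = 1 := by
  have h : (aliceSwap W p).conjTranspose = aliceSwap W p := by
    ext ⟨c, d, w, t⟩ ⟨c', d', w', t'⟩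
    simp only [aliceSwap, Matrix.of_apply, Matrix.conjTranspose_apply, apply_ite star, star_zero,
      star_one]
    congr 1
    exact propext ⟨fun h => ⟨h.2.1.symm, h.1.symm, h.2.2.1.symm, h.2.2.2.symm⟩,
      fun h => ⟨h.2.1.symm, h.1.symm, h.2.2.1.symm, h.2.2.2.symm⟩⟩
  rw [h]
  ext ⟨c, d, w, t⟩ ⟨c', d', w', t'⟩
  rw [aliceSwap_mul_apply]
  simp only [aliceSwap, Matrix.of_apply, Matrix.one_apply, Prod.mk.injEq]
  congr 1
  exact propext (by tauto)

end LocalMatrices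

/-! ### Local operators on the global state -/

namespace Simulator

variable {N q : ℕ} {e : Type} [Fintype e] [DecidableEq e]
  {a b : Type} [Fintype a] [DecidableEq a] [Fintype b] [DecidableEq b] [Inhabited a] [Inhabited b]
  (S : Simulator N q) (E : Adversary q e) {γ : Type}

/-- The state of all quantum registers when the dummy and scratch registers are in their initial
states, the communication qubit is at the given location, and the remaining registers are in the
state `Ψ`. -/
def place (κ : Location S.pairs) (Ψ : Matrix (CoreReg a b (e × E.W)) γ ℂ) :
    Matrix (S.Quantum a b E) γ ℂ :=
  Matrix.of fun ((i, i', cA, d, wA, tA), (j, j', cB, wB, tB), y) k =>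
    if (i' = default ∧ j' = default) ∧ wA = S.wA₀ ∧ wB = S.wB₀ then
      ∑ c, κ (cA, tA) (cB, tB) c * Ψ (i, j, c, (d, y)) k else 0

/-- This turns Pauli operators picked up by the travelling qubit into operators on the core state,
wherever the qubit is located. -/
theorem place_actQubit (κ : Location S.pairs) (M : Matrix Bool Bool ℂ)
    (Ψ : Matrix (CoreReg a b (e × E.W)) γ ℂ) :
    S.place E (κ.actQubit M) Ψ = S.place E κ ((onC M : CoreOp a b (e × E.W)) * Ψ) := by
  ext ⟨⟨i, i', cA, d, wA, tA⟩, ⟨j, j', cB, wB, tB⟩, y⟩ k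
  simp only [place, Matrix.of_apply, onC_mul_apply, Location.actQubit, Finset.sum_mul,
    Finset.mul_sum, mul_assoc]
  rw [Finset.sum_comm]

theorem place_smul (κ : Location S.pairs) (s : ℂ) (Ψ : Matrix (CoreReg a b (e × E.W)) γ ℂ) :
    S.place E (s • κ) Ψ = S.place E κ (s • Ψ) := by
  ext ⟨⟨i, i', cA, d, wA, tA⟩, ⟨j, j', cB, wB, tB⟩, y⟩ k
  simp only [place, Matrix.of_apply, Pi.smul_apply, Matrix.smul_apply, smul_eq_mul, mul_assoc,
    mul_left_comm s]

/-- Alice's operator as a global one. -/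
abbrev aliceGlobal (K : Matrix (S.AliceReg a) (S.AliceReg a) ℂ) :
    Matrix (S.Quantum a b E) (S.Quantum a b E) ℂ :=
  K ⊗ₖ (1 : Matrix (S.BobReg b × (e × E.W)) (S.BobReg b × (e × E.W)) ℂ)

/-- Bob's operator as a global one. -/
abbrev bobGlobal (K : Matrix (S.BobReg b) (S.BobReg b) ℂ) :
    Matrix (S.Quantum a b E) (S.Quantum a b E) ℂ :=
  (1 : Matrix (S.AliceReg a) (S.AliceReg a) ℂ) ⊗ₖ (K ⊗ₖ (1 : Matrix (e × E.W) (e × E.W) ℂ))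

/-- Eve's operator as a global one. -/
abbrev eveGlobal (K : Matrix (e × E.W) (e × E.W) ℂ) :
    Matrix (S.Quantum a b E) (S.Quantum a b E) ℂ :=
  (1 : Matrix (S.AliceReg a) (S.AliceReg a) ℂ) ⊗ₖ ((1 : Matrix (S.BobReg b) (S.BobReg b) ℂ) ⊗ₖ K)

theorem aliceLocal_mul_place (M : Matrix (HalfReg S.pairs) (HalfReg S.pairs) ℂ)
    (κ : Location S.pairs) (Ψ : Matrix (CoreReg a b (e × E.W)) γ ℂ) :
    S.aliceGlobal E (b := b) ((1 : Matrix a a ℂ) ⊗ₖ ((1 : Matrix a a ℂ) ⊗ₖ aliceLocal S.WA M)) *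
      S.place E κ Ψ = S.place E (κ.actFst M) Ψ := by
  ext ⟨⟨i, i', cA, d, wA, tA⟩, ⟨j, j', cB, wB, tB⟩, y⟩ k
  rw [kronecker_one_mul_apply, one_kronecker_mul_apply, one_kronecker_mul_apply,
    aliceLocal_mul_apply]
  simp only [place, Matrix.of_apply, Location.actFst, mul_ite, mul_zero, Finset.sum_ite_irrel,
    Finset.sum_const_zero, Finset.mul_sum, Finset.sum_mul, mul_assoc]
  rw [Finset.sum_comm]

theorem bobLocal_mul_place (M : Matrix (HalfReg S.pairs) (HalfReg S.pairs) ℂ)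
    (κ : Location S.pairs) (Ψ : Matrix (CoreReg a b (e × E.W)) γ ℂ) :
    S.bobGlobal E (a := a) ((1 : Matrix b b ℂ) ⊗ₖ ((1 : Matrix b b ℂ) ⊗ₖ bobLocal S.WB M)) *
      S.place E κ Ψ = S.place E (κ.actSnd M) Ψ := by
  ext ⟨⟨i, i', cA, d, wA, tA⟩, ⟨j, j', cB, wB, tB⟩, y⟩ k
  rw [one_kronecker_mul_apply, kronecker_one_mul_apply, one_kronecker_mul_apply,
    one_kronecker_mul_apply, bobLocal_mul_apply]
  simp only [place, Matrix.of_apply, Location.actSnd, mul_ite, mul_zero, Finset.sum_ite_irrel,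
    Finset.sum_const_zero, Finset.mul_sum, Finset.sum_mul, mul_assoc]
  rw [Finset.sum_comm]

theorem eve_mul_place (O : Matrix (e × E.W) (e × E.W) ℂ)
    (κ : Location S.pairs) (Ψ : Matrix (CoreReg a b (e × E.W)) γ ℂ) :
    S.eveGlobal E (a := a) (b := b) O * S.place E κ Ψ =
      S.place E κ ((onEnv O : CoreOp a b (e × E.W)) * Ψ) := by
  ext ⟨⟨i, i', cA, d, wA, tA⟩, ⟨j, j', cB, wB, tB⟩, y⟩ k
  rw [one_kronecker_mul_apply, one_kronecker_mul_apply]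
  simp only [place, Matrix.mul_apply (M := O), Matrix.of_apply, onEnv_mul_apply, mul_ite, mul_zero,
    Finset.sum_ite_irrel, Finset.sum_const_zero, Finset.mul_sum, mul_left_comm]
  rw [Finset.sum_comm]

/-- The location must be `held`: only when the qubit is in `C_A` is the physical exchange the
operator `swapCC`. The black boxes below need it for the same reason. -/
theorem aliceSwap_mul_place (n : ℕ) (Ψ : Matrix (CoreReg a b (e × E.W)) γ ℂ) :
    S.aliceGlobal E (b := b) ((1 : Matrix a a ℂ) ⊗ₖ ((1 : Matrix a a ℂ) ⊗ₖ
      aliceSwap S.WA S.pairs)) * S.place E (Location.held _ n) Ψ =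
      S.place E (Location.held _ n) ((swapCC : CoreOp a b (e × E.W)) * Ψ) := by
  ext ⟨⟨i, i', cA, d, wA, tA⟩, ⟨j, j', cB, wB, tB⟩, y⟩ k
  rw [kronecker_one_mul_apply, one_kronecker_mul_apply, one_kronecker_mul_apply,
    aliceSwap_mul_apply]
  simp only [place, Matrix.of_apply, swapCC_mul_apply, Location.held, ite_mul, zero_mul,
    Finset.sum_ite_eq, Finset.mem_univ, if_true]

theorem aliceQuery_mul_place (U : Matrix (a × Bool) (a × Bool) ℂ) (n : ℕ)
    (Ψ : Matrix (CoreReg a b (e × E.W)) γ ℂ) :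
    S.aliceGlobal E (b := b) (liftQuery (Bool × S.WA × (Fin S.pairs → Bool)) U) *
      S.place E (Location.held _ n) Ψ =
      S.place E (Location.held _ n) (onAC b (Bool × (e × E.W)) U * Ψ) := by
  ext ⟨⟨i, i', cA, d, wA, tA⟩, ⟨j, j', cB, wB, tB⟩, y⟩ k
  rw [kronecker_one_mul_apply, liftQuery_mul_apply]
  simp only [place, Matrix.of_apply, onAC_mul_apply, Location.held, ite_mul, zero_mul,
    Finset.sum_ite_eq, Finset.mem_univ, if_true, mul_ite, mul_zero, Finset.sum_ite_irrel,
    Finset.sum_const_zero, Finset.mul_sum, mul_left_comm]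

theorem bobQuery_mul_place (U : Matrix (b × Bool) (b × Bool) ℂ) (n : ℕ)
    (Ψ : Matrix (CoreReg a b (e × E.W)) γ ℂ) :
    S.bobGlobal E (a := a) (liftQuery (S.WB × (Fin S.pairs → Bool)) U) *
      S.place E (Location.held _ n).flip Ψ =
      S.place E (Location.held _ n).flip (onBC a (Bool × (e × E.W)) U * Ψ) := by
  ext ⟨⟨i, i', cA, d, wA, tA⟩, ⟨j, j', cB, wB, tB⟩, y⟩ k
  rw [one_kronecker_mul_apply, kronecker_one_mul_apply, liftQuery_mul_apply]
  simp only [place, Matrix.of_apply, onBC_mul_apply, Location.held, Location.flip, ite_mul,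
    zero_mul, Finset.sum_ite_eq, Finset.mem_univ, if_true, mul_ite, mul_zero, Finset.sum_ite_irrel,
    Finset.sum_const_zero, Finset.mul_sum, mul_left_comm]

theorem eprPairs_eq (p : ℕ) (s t : Fin p → Bool) :
    eprPairs p s t = ((Real.sqrt 2 : ℝ) : ℂ)⁻¹ ^ p * (if Location.IsFresh 0 s t then 1 else 0) := by
  unfold eprPairs
  by_cases h : s = t
  · subst h
    have hf : Location.IsFresh 0 s s := fun l => by simp
    simp [hf]
  · obtain ⟨l, hl⟩ := Function.ne_iff.1 h
    rw [if_neg (fun hf => hl (by simpa using hf l)), mul_zero]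
    exact Finset.prod_eq_zero (Finset.mem_univ l) (if_neg hl)

theorem prepare_eq : S.prepare a b E = S.place E (Location.held _ 0)
    -- All normalisation of the EPR pairs is put into the core state.
    (((Real.sqrt 2 : ℝ) : ℂ)⁻¹ ^ S.pairs • initCore a b e E.w₀) := by
  ext ⟨⟨i, i', cA, d, wA, tA⟩, ⟨j, j', cB, wB, tB⟩, x, w⟩ ⟨i₀, j₀, c₀, x₀⟩
  simp only [prepare, place, Matrix.of_apply, Location.held, ite_mul, zero_mul, Finset.sum_ite_eq,
    Finset.mem_univ, if_true]
  simp only [Location.amplitude, Matrix.smul_apply, Matrix.of_apply, initCore, smul_eq_mul,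
    ite_mul, zero_mul, eprPairs_eq, mul_ite, mul_one, mul_zero, one_mul, ← ite_and]
  congr 1
  exact propext (by tauto)

end Simulator

end Placing

/-! ## Instruments with a classical outcome -/

section Instruments

variable {M Q O : Type} [Fintype M] [DecidableEq M] [Fintype Q] [DecidableEq Q] [Fintype O]

/-- The instrument that applies `B m o` for an outcome `o` and updates the classical value `m` to
`f m o`. -/
def outcomeInstrument (f : M → O → M) (B : M → O → Matrix Q Q ℂ)
    (hB : ∀ m, ∑ o, (B m o).conjTranspose * B m o = 1) : Instrument M Q where
  rank := Fintype.card O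
  op m m' k := if m' = f m ((Fintype.equivFin O).symm k) then B m ((Fintype.equivFin O).symm k)
    else 0
  complete m := by
    simp only [conjTranspose_mul_self_ite]
    rw [Finset.sum_comm]
    simp only [Finset.sum_ite_eq', Finset.mem_univ, if_true]
    rw [← hB m]
    exact Equiv.sum_comp (Fintype.equivFin O).symm fun o => (B m o).conjTranspose * B m o

/-- The instrument with one outcome. -/
def unitaryInstrument (f : M → M) (B : M → Matrix Q Q ℂ)
    (hB : ∀ m, (B m).conjTranspose * B m = 1) : Instrument M Q :=
  outcomeInstrument (O := Unit) (fun m _ => f m) (fun m _ => B m) fun m => by simpa using hB m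

end Instruments

namespace Simulator

/-! ### Single operations as steps of branches -/

section Steps

variable {N q : ℕ} {e : Type} [Fintype e] [DecidableEq e]
  {a b : Type} [Fintype a] [DecidableEq a] [Fintype b] [DecidableEq b]
  (S : Simulator N q) (E : Adversary q e) {γ : Type}

variable {S E}

/-- That the Kraus operator is nonzero forces the classical registers of the others to stay fixed
and Alice's to take the value prescribed by `f`. -/
theorem step_alice_instr {O : Type} [Fintype O] {U : Fin (N / 2 + 1) → Matrix.unitaryGroup (a × Bool) ℂ}
    {f : S.X × Fin q → O → S.X × Fin q} {B hB} {x : S.X} {y : S.Y} {z : E.Z} {c : Fin q} {V V' : Matrix (S.Quantum a b E) γ ℂ} {m' : S.Classical E}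
    (h : (S.onAlice b E ((LocalOp.instr (outcomeInstrument f B hB)).kraus U)).Step
      (n := γ) (x, y, z, c) V m' V') :
    ∃ o, m' = ((f (x, c) o).1, y, z, (f (x, c) o).2) ∧ V' = S.aliceGlobal E (b := b)
      ((1 : Matrix a a ℂ) ⊗ₖ ((1 : Matrix a a ℂ) ⊗ₖ B (x, c) o)) * V := by
  obtain ⟨k, h0, rfl⟩ := h
  obtain ⟨x', y', z', c'⟩ := m'
  simp only [onAlice, LocalOp.kraus, outcomeInstrument] at h0 ⊢
  by_cases h1 : y = y' ∧ z = z'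
  · by_cases h2 : (x', c') = f (x, c) ((Fintype.equivFin O).symm k)
    · refine ⟨(Fintype.equivFin O).symm k, ?_, ?_⟩
      · rw [← h2, h1.1, h1.2]
      · rw [if_pos h1, if_pos h2]
    · rw [if_pos h1, if_neg h2] at h0
      simp at h0
  · exact absurd (if_neg h1) h0

theorem step_bob_instr {O : Type} [Fintype O] {U : Fin (N / 2) → Matrix.unitaryGroup (b × Bool) ℂ}
    {f : S.Y × Fin q → O → S.Y × Fin q} {B hB} {x : S.X} {y : S.Y} {z : E.Z} {c : Fin q} {V V' : Matrix (S.Quantum a b E) γ ℂ} {m' : S.Classical E}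
    (h : (S.onBob a E ((LocalOp.instr (outcomeInstrument f B hB)).kraus U)).Step
      (n := γ) (x, y, z, c) V m' V') :
    ∃ o, m' = (x, (f (y, c) o).1, z, (f (y, c) o).2) ∧ V' = S.bobGlobal E (a := a)
      ((1 : Matrix b b ℂ) ⊗ₖ ((1 : Matrix b b ℂ) ⊗ₖ B (y, c) o)) * V := by
  obtain ⟨k, h0, rfl⟩ := h
  obtain ⟨x', y', z', c'⟩ := m'
  simp only [onBob, LocalOp.kraus, outcomeInstrument] at h0 ⊢
  by_cases h1 : x = x' ∧ z = z'
  · by_cases h2 : (y', c') = f (y, c) ((Fintype.equivFin O).symm k)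
    · refine ⟨(Fintype.equivFin O).symm k, ?_, ?_⟩
      · rw [← h2, h1.1, h1.2]
      · rw [if_pos h1, if_pos h2]
    · rw [if_pos h1, if_neg h2] at h0
      simp at h0
  · exact absurd (if_neg h1) h0

theorem step_alice_query {U : Fin (N / 2 + 1) → Matrix.unitaryGroup (a × Bool) ℂ}
    {f : S.X × Fin q → Option (Fin (N / 2 + 1) × Bool)} {x : S.X} {y : S.Y} {z : E.Z} {c : Fin q}
    {V V' : Matrix (S.Quantum a b E) γ ℂ} {m' : S.Classical E} (h : (S.onAlice b E ((LocalOp.query f).kraus U)).Step (n := γ) (x, y, z, c) V m' V') :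
    m' = (x, y, z, c) ∧ V' = S.aliceGlobal E (b := b) (liftQuery _ (queryOp U (f (x, c)))) * V := by
  obtain ⟨k, h0, rfl⟩ := h
  obtain ⟨x', y', z', c'⟩ := m'
  simp only [onAlice, LocalOp.kraus] at h0 ⊢
  by_cases h1 : y = y' ∧ z = z'
  · by_cases h2 : (x, c) = (x', c')
    · obtain ⟨rfl, rfl⟩ := h1
      cases h2
      refine ⟨rfl, ?_⟩
      rw [if_pos ⟨rfl, rfl⟩, if_pos rfl]
      rcases f (x, c) with _ | ⟨j, _ | _⟩
      · rw [queryOp, liftQuery_one]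
      · rfl
      · rfl
    · rw [if_pos h1, if_neg h2] at h0
      simp at h0
  · exact absurd (if_neg h1) h0

theorem step_bob_query {U : Fin (N / 2) → Matrix.unitaryGroup (b × Bool) ℂ}
    {f : S.Y × Fin q → Option (Fin (N / 2) × Bool)} {x : S.X} {y : S.Y} {z : E.Z} {c : Fin q}
    {V V' : Matrix (S.Quantum a b E) γ ℂ} {m' : S.Classical E} (h : (S.onBob a E ((LocalOp.query f).kraus U)).Step (n := γ) (x, y, z, c) V m' V') :
    m' = (x, y, z, c) ∧ V' = S.bobGlobal E (a := a) (liftQuery _ (queryOp U (f (y, c)))) * V := by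
  obtain ⟨k, h0, rfl⟩ := h
  obtain ⟨x', y', z', c'⟩ := m'
  simp only [onBob, LocalOp.kraus] at h0 ⊢
  by_cases h1 : x = x' ∧ z = z'
  · by_cases h2 : (y, c) = (y', c')
    · obtain ⟨rfl, rfl⟩ := h1
      cases h2
      refine ⟨rfl, ?_⟩
      rw [if_pos ⟨rfl, rfl⟩, if_pos rfl]
      rcases f (y, c) with _ | ⟨j, _ | _⟩
      · rw [queryOp, liftQuery_one]
      · rfl
      · rfl
    · rw [if_pos h1, if_neg h2] at h0
      simp at h0
  · exact absurd (if_neg h1) h0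

theorem step_alice_swap {U : Fin (N / 2 + 1) → Matrix.unitaryGroup (a × Bool) ℂ}
    {f : S.X × Fin q → Bool} {x : S.X} {y : S.Y} {z : E.Z} {c : Fin q}
    {V V' : Matrix (S.Quantum a b E) γ ℂ} {m' : S.Classical E} (h : (S.onAlice b E ((LocalOp.swap f).kraus U)).Step (n := γ) (x, y, z, c) V m' V') :
    m' = (x, y, z, c) ∧ V' = S.aliceGlobal E (b := b) (if f (x, c) then swapMatrix a _ else 1) * V := by
  obtain ⟨k, h0, rfl⟩ := h
  obtain ⟨x', y', z', c'⟩ := m'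
  simp only [onAlice, LocalOp.kraus] at h0 ⊢
  by_cases h1 : y = y' ∧ z = z'
  · by_cases h2 : (x, c) = (x', c')
    · obtain ⟨rfl, rfl⟩ := h1
      cases h2
      exact ⟨rfl, by rw [if_pos ⟨rfl, rfl⟩, if_pos rfl]⟩
    · rw [if_pos h1, if_neg h2] at h0
      simp at h0
  · exact absurd (if_neg h1) h0

theorem step_bob_swap {U : Fin (N / 2) → Matrix.unitaryGroup (b × Bool) ℂ}
    {f : S.Y × Fin q → Bool} {x : S.X} {y : S.Y} {z : E.Z} {c : Fin q}
    {V V' : Matrix (S.Quantum a b E) γ ℂ} {m' : S.Classical E} (h : (S.onBob a E ((LocalOp.swap f).kraus U)).Step (n := γ) (x, y, z, c) V m' V') :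
    m' = (x, y, z, c) ∧ V' = S.bobGlobal E (a := a) (if f (y, c) then swapMatrix b _ else 1) * V := by
  obtain ⟨k, h0, rfl⟩ := h
  obtain ⟨x', y', z', c'⟩ := m'
  simp only [onBob, LocalOp.kraus] at h0 ⊢
  by_cases h1 : x = x' ∧ z = z'
  · by_cases h2 : (y, c) = (y', c')
    · obtain ⟨rfl, rfl⟩ := h1
      cases h2
      exact ⟨rfl, by rw [if_pos ⟨rfl, rfl⟩, if_pos rfl]⟩
    · rw [if_pos h1, if_neg h2] at h0
      simp at h0
  · exact absurd (if_neg h1) h0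

theorem step_eve {F : KrausFamily (E.Z × Fin q) (e × E.W)} {x : S.X} {y : S.Y} {z : E.Z}
    {c : Fin q} {V V' : Matrix (S.Quantum a b E) γ ℂ} {m' : S.Classical E} (h : (S.onEve a b E F).Step (n := γ) (x, y, z, c) V m' V') :
    ∃ z' c' k, m' = (x, y, z', c') ∧ V' = S.eveGlobal E (a := a) (b := b) (F.op (z, c) (z', c') k) * V := by
  obtain ⟨k, h0, rfl⟩ := h
  obtain ⟨x', y', z', c'⟩ := m'
  simp only [onEve] at h0 ⊢
  by_cases h1 : x = x' ∧ y = y'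
  · exact ⟨z', c', k, by rw [h1.1, h1.2], by rw [if_pos h1]⟩
  · exact absurd (if_neg h1) h0

end Steps

end Simulator

/-! ## Trajectories of the adversary -/

section Trajectories

variable {q : ℕ} {e : Type} [Fintype e] [DecidableEq e]

/-- In the first `n` transmissions, `k` symbols are changed, the classical register of the adversary
ends with the value `z`, and the operator `O` is applied to her quantum register. -/
inductive Trajectory (E : Adversary q e) : ℕ → ℕ → E.Z → Matrix (e × E.W) (e × E.W) ℂ → Prop
  | zero : Trajectory E 0 0 E.z₀ 1
  | succ {n k z O} (h : Trajectory E n k z O) (s t : Fin q) (z' : E.Z) (i : Fin (E.step n).rank) :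
      Trajectory E (n + 1) ((if s = t then 0 else 1) + k) z' ((E.step n).op (z, s) (z', t) i * O)

theorem trajectoryOp_congr (E : Adversary q e) {z z' : ℕ → E.Z} {s s' t t' : ℕ → Fin q}
    {k k' : ∀ i, Fin (E.step i).rank} {n : ℕ} (hz : ∀ i ≤ n, z i = z' i)
    (hs : ∀ i < n, s i = s' i) (ht : ∀ i < n, t i = t' i) (hk : ∀ i < n, k i = k' i) :
    E.trajectoryOp z s t k n = E.trajectoryOp z' s' t' k' n := by
  induction n with
  | zero => rfl
  | succ n ih =>
    simp only [Adversary.trajectoryOp]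
    rw [ih (fun i hi => hz i (by omega)) (fun i hi => hs i (by omega)) (fun i hi => ht i (by omega))
      (fun i hi => hk i (by omega)), hz n (by omega), hz (n + 1) le_rfl, hs n (by omega),
      ht n (by omega), hk n (by omega)]

/-- Without Kraus operators, completeness would read `0 = 1`. -/
theorem rank_pos [Nonempty e] (E : Adversary q e) (hq : 0 < q) (i : ℕ) : 0 < (E.step i).rank := by
  by_contra h
  have h0 : (E.step i).rank = 0 := by omega
  have hc := (E.step i).complete (E.z₀, ⟨0, hq⟩)
  have : IsEmpty (Fin (E.step i).rank) := by rw [h0]; infer_instance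
  simp only [Finset.univ_eq_empty, Finset.sum_empty, Finset.sum_const_zero] at hc
  obtain ⟨x⟩ := ‹Nonempty e›
  have := congrFun (congrFun hc (x, E.w₀)) (x, E.w₀)
  simp at this

/-- `CorruptsAtMost` speaks of infinite sequences, so the finite record is extended by arbitrary
values; `rank_pos` provides the indices of Kraus operators. -/
theorem Trajectory.exists_functions [Nonempty e] {E : Adversary q e} (hq : 0 < q) {n k : ℕ}
    {z : E.Z} {O : Matrix (e × E.W) (e × E.W) ℂ} (h : Trajectory E n k z O) :
    ∃ (zs : ℕ → E.Z) (s t : ℕ → Fin q) (is : ∀ i, Fin (E.step i).rank), zs 0 = E.z₀ ∧ zs n = z ∧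
      E.trajectoryOp zs s t is n = O ∧ ((Finset.range n).filter fun i => s i ≠ t i).card = k := by
  induction h with
  | zero =>
    exact ⟨fun _ => E.z₀, fun _ => ⟨0, hq⟩, fun _ => ⟨0, hq⟩, fun i => ⟨0, rank_pos E hq i⟩, rfl, rfl,
      rfl, rfl⟩
  | @succ n k z O h s t z' i ih =>
    obtain ⟨zs, ss, ts, is, h0, hz, hO, hk⟩ := ih
    refine ⟨Function.update zs (n + 1) z', Function.update ss n s, Function.update ts n t,
      Function.update is n i, ?_, by simp, ?_, ?_⟩
    · rwa [Function.update_of_ne (by omega)]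
    · simp only [Adversary.trajectoryOp, Function.update_self]
      rw [Function.update_of_ne (by omega), hz, ← hO]
      congr 1
      exact trajectoryOp_congr E (fun j hj => Function.update_of_ne (by omega) _ _)
        (fun j hj => Function.update_of_ne (by omega) _ _)
        (fun j hj => Function.update_of_ne (by omega) _ _)
        (fun j hj => Function.update_of_ne (by omega) _ _)
    · rw [Finset.card_filter, Finset.sum_range_succ, ← hk, Finset.card_filter, add_comm]
      congr 1
      · simp
      · refine Finset.sum_congr rfl fun j hj => ?_
        rw [Finset.mem_range] at hj
        rw [Function.update_of_ne (by omega), Function.update_of_ne (by omega)]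

theorem Trajectory.le_of_corruptsAtMost [Nonempty e] {E : Adversary q e} (hq : 0 < q) {n k : ℕ}
    {z : E.Z} {O : Matrix (e × E.W) (e × E.W) ℂ} (h : Trajectory E n k z O) (hO : O ≠ 0) {δ : ℝ}
    (hE : E.CorruptsAtMost δ n) : (k : ℝ) ≤ δ * n := by
  obtain ⟨zs, s, t, is, h0, hz, hO', hk⟩ := h.exists_functions hq
  rw [← hk]
  exact hE zs s t is h0 (by rwa [hO'])

end Trajectories

/-! ## The turns of the parties -/

theorem Leads.smul {a b Y γ : Type} [DecidableEq a] [DecidableEq b] [DecidableEq Y] [Fintype a]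
    [Fintype b] [Fintype Y] {N : ℕ} {P : NoiselessProtocol N a b} {τ : Todo}
    {Ψ X : Matrix (CoreReg a b Y) γ ℂ} (h : Leads P τ Ψ X) (s : ℂ) : Leads P τ (s • Ψ) X := by
  obtain ⟨t, ht⟩ := h
  exact ⟨s * t, by rw [Matrix.mul_smul, ht, mul_smul]⟩

section Actions

variable {N p : ℕ} {M W : Type} [Fintype M] [DecidableEq M] [Fintype W] [DecidableEq W]

/-- The unitary operators on a communication qubit and halves of EPR pairs. -/
abbrev LocalUnitary (p : ℕ) : Type :=
  {L : Matrix (HalfReg p) (HalfReg p) ℂ // L.conjTranspose * L = 1}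

/-- The black box used by a party that moves as given. -/
def moveQuery (n : ℕ) (b : Bool) (r : ℤ) (d : Option Bool) : Option (Fin n × Bool) :=
  d.bind fun d => (moveLetter b r d).query n

/-- Whether Alice exchanges the communication qubit and `C̃` when she moves as given. -/
def moveIsSwap (N : ℕ) (r : ℤ) (d : Option Bool) : Prop :=
  ∃ d' ∈ d, (moveLetter false r d').IsSwap N

/-- A turn of Alice: receive a symbol and the communication qubit, apply a Pauli operator, move and
teleport the communication qubit with pair number `l`. -/
def aliceActions (L : LocalUnitary p) (receive : M → M) (dec : M → Pauli × Option Bool)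
    (pos : M → ℤ) (send : M → Pauli → M) (l : Fin p) :
    List (LocalOp (Fin (N / 2 + 1)) M (Bool × W × (Fin p → Bool))) := by
  classical exact
  [.instr (unitaryInstrument receive (fun _ => aliceLocal W L.1) fun _ => by
      rw [conjTranspose_aliceLocal_mul, L.2, aliceLocal_one]),
    .instr (unitaryInstrument id (fun m => aliceLocal W (pauliLocal (dec m).1)) fun _ => by
      rw [conjTranspose_aliceLocal_mul, conjTranspose_pauliLocal_mul, aliceLocal_one]),
    .query fun m => moveQuery (N / 2 + 1) false (pos m) (dec m).2,
    .instr (unitaryInstrument id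
      (fun m => if moveIsSwap N (pos m) (dec m).2 then aliceSwap W p else 1) fun _ => by
        split_ifs
        · exact conjTranspose_aliceSwap_mul
        · simp),
    .instr (outcomeInstrument send (fun _ o => aliceLocal W (bellMatrix l o)) fun _ => by
      simp only [conjTranspose_aliceLocal_mul, ← aliceLocal_sum]
      rw [sum_conjTranspose_bellMatrix_mul, aliceLocal_one])]

/-- A turn of Bob. -/
def bobActions (L : LocalUnitary p) (receive : M → M) (dec : M → Pauli × Option Bool)
    (pos : M → ℤ) (send : M → Pauli → M) (l : Fin p) (last : Bool) :
    List (LocalOp (Fin (N / 2)) M (W × (Fin p → Bool))) :=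
  [.instr (unitaryInstrument receive (fun _ => bobLocal W L.1) fun _ => by
      rw [conjTranspose_bobLocal_mul, L.2, bobLocal_one]),
    .instr (unitaryInstrument id (fun m => bobLocal W (pauliLocal (dec m).1)) fun _ => by
      rw [conjTranspose_bobLocal_mul, conjTranspose_pauliLocal_mul, bobLocal_one]),
    .query fun m => moveQuery (N / 2) true (pos m) (dec m).2,
    .instr (outcomeInstrument send (fun _ o => bobLocal W (bellMatrix l o)) fun _ => by
      simp only [conjTranspose_bobLocal_mul, ← bobLocal_sum]
      rw [sum_conjTranspose_bellMatrix_mul, bobLocal_one]),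
    .swap fun _ => last]

end Actions

namespace Simulator

variable {N q : ℕ} {e : Type} [Fintype e] [DecidableEq e]
  {a b : Type} [Fintype a] [DecidableEq a] [Fintype b] [DecidableEq b] [Inhabited a] [Inhabited b]
  {S : Simulator N q} {E : Adversary q e} {γ : Type}

theorem moveOp_false (P : NoiselessProtocol N a b) (r : ℤ) (d : Option Bool)
    [Decidable (moveIsSwap N r d)] {Y : Type} [Fintype Y] [DecidableEq Y] :
    (moveOp P false r d : CoreOp a b Y) = (if moveIsSwap N r d then swapCC else 1) *
      onAC b (Bool × Y) (queryOp P.alice (moveQuery (N / 2 + 1) false r d)) := by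
  rcases d with _ | d
  · rw [if_neg (by simp [moveIsSwap])]
    simp [moveOp, moveQuery, queryOp, onAC_one]
  · have h : moveIsSwap N r (some d) ↔ (moveLetter false r d).IsSwap N := by simp [moveIsSwap]
    rw [moveOp, letterOp, if_neg (by simp)]
    simp only [h, moveQuery, Option.bind_some]

theorem moveOp_true (P : NoiselessProtocol N a b) (r : ℤ) (d : Option Bool)
    {Y : Type} [Fintype Y] [DecidableEq Y] :
    (moveOp P true r d : CoreOp a b Y) =
      onBC a (Bool × Y) (queryOp P.bob (moveQuery (N / 2) true r d)) := by
  rcases d with _ | d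
  · simp [moveOp, moveQuery, queryOp, onBC_one]
  · rw [moveOp, letterOp, if_pos (by simp)]
    rfl

/-- The exchange of Bob's input register and dummy register, or nothing. -/
def bobSwap (S : Simulator N q) (b : Type) [DecidableEq b] (s : Bool) :
    Matrix (S.BobReg b) (S.BobReg b) ℂ :=
  if s then swapMatrix b _ else 1

theorem bobGlobal_bobSwap_false_mul (V : Matrix (S.Quantum a b E) γ ℂ) :
    S.bobGlobal E (a := a) (S.bobSwap b false) * V = V := by
  have h : S.bobSwap b false = 1 := rfl
  rw [h, Simulator.bobGlobal, Matrix.one_kronecker_one, Matrix.one_kronecker_one, Matrix.one_mul]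

theorem eveGlobal_mul_bobGlobal (O : Matrix (e × E.W) (e × E.W) ℂ)
    (A : Matrix (S.BobReg b) (S.BobReg b) ℂ) :
    S.eveGlobal E (a := a) O * S.bobGlobal E A = S.bobGlobal E A * S.eveGlobal E O := by
  rw [Simulator.eveGlobal, Simulator.bobGlobal, ← Matrix.mul_kronecker_mul,
    ← Matrix.mul_kronecker_mul, ← Matrix.mul_kronecker_mul, ← Matrix.mul_kronecker_mul,
    Matrix.one_mul, Matrix.mul_one, Matrix.one_mul, Matrix.mul_one, Matrix.one_mul]

/-- The turn loads the qubit, acts on it and teleports it, so the core state undergoes exactly the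
operators in `Leads.turn`, up to the factor `1 / √2` of the Bell measurement. The functions `dec`
and `pos` are arbitrary. -/
theorem steps_aliceActions {P : NoiselessProtocol N a b} {L : LocalUnitary S.pairs}
    {receive : S.X × Fin q → S.X × Fin q} {dec : S.X × Fin q → Pauli × Option Bool}
    {pos : S.X × Fin q → ℤ} {send : S.X × Fin q → Pauli → S.X × Fin q} {l : Fin S.pairs}
    {κ : Location S.pairs} (hκ : κ.actFst L.1 = .held _ l.1) {τ : Todo}
    {Ψ X : Matrix (CoreReg a b (e × E.W)) γ ℂ} (hΨ : Leads P τ Ψ X) {x y z c m' V'}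
    (h : Steps ((aliceActions L receive dec pos send l).map fun o =>
      S.onAlice b E (o.kraus P.alice)) (x, y, z, c) (S.place E κ Ψ) m' V') :
    ∃ o, m' = ((send (receive (x, c)) o).1, y, z, (send (receive (x, c)) o).2) ∧
      ∃ Ψ', V' = S.place E (.sent l) Ψ' ∧
        Leads P (τ.turn false (pos (receive (x, c))) (dec (receive (x, c)), o)) Ψ' X := by
  classical
  obtain ⟨m₁, V₁, h1, m₂, V₂, h2, m₃, V₃, h3, m₄, V₄, h4, m₅, V₅, h5, rfl, rfl⟩ := h
  obtain ⟨-, rfl, rfl⟩ := step_alice_instr h1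
  rw [aliceLocal_mul_place, hκ] at h2
  obtain ⟨-, rfl, rfl⟩ := step_alice_instr h2
  rw [aliceLocal_mul_place, Location.actFst_pauli, place_actQubit] at h3
  obtain ⟨rfl, rfl⟩ := step_alice_query h3
  rw [aliceQuery_mul_place] at h4
  obtain ⟨-, rfl, rfl⟩ := step_alice_instr h4
  obtain ⟨o, rfl, rfl⟩ := step_alice_instr h5
  refine ⟨o, rfl, ((Real.sqrt 2 : ℝ) : ℂ)⁻¹ • _, ?_, (hΨ.turn false _ (_, o)).smul _⟩
  simp only [id, Prod.mk.eta]
  rw [moveOp_false]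
  generalize receive (x, c) = m
  have h6 : ∀ Ψ : Matrix (CoreReg a b (e × E.W)) γ ℂ,
      S.aliceGlobal E (b := b) ((1 : Matrix a a ℂ) ⊗ₖ ((1 : Matrix a a ℂ) ⊗ₖ
        (if moveIsSwap N (pos m) (dec m).2 then aliceSwap S.WA S.pairs else 1))) *
        S.place E (.held _ l.1) Ψ = S.place E (.held _ l.1)
          ((if moveIsSwap N (pos m) (dec m).2 then swapCC else 1 : CoreOp a b (e × E.W)) * Ψ) := by
    intro Ψ
    split_ifs
    · exact aliceSwap_mul_place S E _ _
    · rw [Matrix.one_kronecker_one, Matrix.one_kronecker_one, Simulator.aliceGlobal,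
        Matrix.one_kronecker_one, Matrix.one_mul, Matrix.one_mul]
  rw [h6, aliceLocal_mul_place, Location.actFst_bell, place_smul, place_actQubit, Matrix.mul_smul,
    Matrix.mul_assoc (ite _ _ _)]

theorem steps_bobActions {P : NoiselessProtocol N a b} {L : LocalUnitary S.pairs}
    {receive : S.Y × Fin q → S.Y × Fin q} {dec : S.Y × Fin q → Pauli × Option Bool}
    {pos : S.Y × Fin q → ℤ} {send : S.Y × Fin q → Pauli → S.Y × Fin q} {l : Fin S.pairs}
    {last : Bool} {κ : Location S.pairs} (hκ : κ.actSnd L.1 = (Location.held _ l.1).flip) {τ : Todo}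
    {Ψ X : Matrix (CoreReg a b (e × E.W)) γ ℂ} (hΨ : Leads P τ Ψ X) {x y z c m' V'}
    (h : Steps ((bobActions L receive dec pos send l last).map fun o =>
      S.onBob a E (o.kraus P.bob)) (x, y, z, c) (S.place E κ Ψ) m' V') :
    ∃ o, m' = (x, (send (receive (y, c)) o).1, z, (send (receive (y, c)) o).2) ∧
      ∃ Ψ', V' = S.bobGlobal E (a := a) (S.bobSwap b last) *
          S.place E (Location.sent l).flip Ψ' ∧
        Leads P (τ.turn true (pos (receive (y, c))) (dec (receive (y, c)), o)) Ψ' X := by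
  obtain ⟨m₁, V₁, h1, m₂, V₂, h2, m₃, V₃, h3, m₄, V₄, h4, m₅, V₅, h5, rfl, rfl⟩ := h
  obtain ⟨-, rfl, rfl⟩ := step_bob_instr h1
  rw [bobLocal_mul_place, hκ] at h2
  obtain ⟨-, rfl, rfl⟩ := step_bob_instr h2
  rw [bobLocal_mul_place, Location.actSnd_pauli, place_actQubit] at h3
  obtain ⟨rfl, rfl⟩ := step_bob_query h3
  rw [bobQuery_mul_place] at h4
  obtain ⟨o, rfl, rfl⟩ := step_bob_instr h4
  obtain ⟨rfl, rfl⟩ := step_bob_swap h5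
  refine ⟨o, rfl, ((Real.sqrt 2 : ℝ) : ℂ)⁻¹ • _, ?_, (hΨ.turn true _ (_, o)).smul _⟩
  simp only [id, Prod.mk.eta]
  rw [moveOp_true, bobLocal_mul_place, Location.actSnd_bell, place_smul, place_actQubit,
    Matrix.mul_smul]
  rfl

end Simulator

/-! ## Conversations -/

section Conversation

variable {q : ℕ}

/-- This covers Alice's first turn too, when nothing has been received: the empty word is always
decoded correctly. -/
theorem badCount_eq (enc : List Msg → Fin q) {l : List Msg} {r : List (Fin q)}
    (h : l.length = r.length) : badCount enc l r =
      (if decode enc r = l then 0 else 1) + badCount enc l.tail r.tail := by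
  rcases l with _ | ⟨a, l⟩ <;> rcases r with _ | ⟨c, r⟩
  · have : decode enc ([] : List (Fin q)) = [] := List.eq_nil_of_length_eq_zero (length_decode enc _)
    simp [badCount, this]
  · simp at h
  · simp at h
  · rfl

/-- The situation before Alice sends message number `i`: the messages `μ` of Alice and `ν` of Bob
have been sent (newest first), and `rA` and `rB` have been received by Alice and Bob. -/
structure AliceReady (enc : List Msg → Fin q) (K i : ℕ) (μ ν : List Msg) (rA rB : List (Fin q)) :
    Prop where
  length_sentA : μ.length = i
  length_sentB : ν.length = i
  length_recvA : rA.length = i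
  length_recvB : rB.length = i
  walkA : Todo.IsWalk false K (position μ) (Todo.afterRounds K μ ν).2
  walkB : Todo.IsWalk true K (position ν) (Todo.afterRounds K μ ν).2
  -- Alice has not yet decoded the newest symbol, so its possible failure is not counted: hence the
  -- tails.
  length_le : (Todo.afterRounds K μ ν).2.length ≤
    (2 * K - i) + 2 * (badCount enc ν.tail rA.tail + badCount enc μ rB)

/-- The situation before Bob sends message number `i`. -/
structure BobReady (enc : List Msg → Fin q) (K i : ℕ) (μ ν : List Msg) (rA rB : List (Fin q)) :
    Prop where
  length_sentA : μ.length = i + 1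
  length_sentB : ν.length = i
  length_recvA : rA.length = i
  length_recvB : rB.length = i + 1
  walkA : Todo.IsWalk false K (position μ) (Todo.midRound K μ ν).2
  walkB : Todo.IsWalk true K (position ν) (Todo.midRound K μ ν).2
  length_le : (Todo.midRound K μ ν).2.length ≤
      (2 * K - (i + 1)) + 2 * (badCount enc ν rA + badCount enc μ.tail rB.tail) ∨
    ((Todo.midRound K μ ν).2.length ≤
      (2 * K - i) + 2 * (badCount enc ν rA + badCount enc μ.tail rB.tail) ∧
      Todo.HeadIs true (Todo.midRound K μ ν).2)

variable {enc : List Msg → Fin q} {K i : ℕ} {μ ν : List Msg} {rA rB : List (Fin q)}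

theorem aliceReady_zero (enc : List Msg → Fin q) (K : ℕ) : AliceReady enc K 0 [] [] [] [] where
  length_sentA := rfl
  length_sentB := rfl
  length_recvA := rfl
  length_recvB := rfl
  walkA := by simpa [position, Todo.afterRounds] using Todo.isWalk_initialList false 0 K
  walkB := by simpa [position, Todo.afterRounds] using Todo.isWalk_initialList true 0 K
  length_le := by
    have := Todo.length_initialList 0 K
    simp [Todo.afterRounds, this]

/-- Either Alice decodes correctly and follows the policy for the true word, or the count of bad
times grows by one. The symbol `c` for Bob is arbitrary, since it is decoded and counted only in his
turn. -/
theorem AliceReady.bobReady (h : AliceReady enc K i μ ν rA rB) (o : Pauli) (c : Fin q) :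
    BobReady enc K i ((Todo.policy false (position μ) (Todo.afterRounds K μ (decode enc rA)), o) :: μ)
      ν rA (c :: rB) where
  length_sentA := by simp [h.length_sentA]
  length_sentB := h.length_sentB
  length_recvA := h.length_recvA
  length_recvB := by simp [h.length_recvB]
  walkA := Todo.isWalk_turn_self _ h.walkA
  walkB := Todo.isWalk_turn_other (by simp) _ h.walkB
  length_le := by
    refine Todo.progress_alice h.walkA h.length_le ?_
    rw [badCount_eq enc (h.length_sentB.trans h.length_recvA.symm)]
    simp only [List.tail_cons]
    by_cases hd : decode enc rA = ν
    · left
      rw [if_pos hd, hd]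
      exact ⟨by omega, rfl⟩
    · right
      rw [if_neg hd]
      omega

theorem BobReady.aliceReady (h : BobReady enc K i μ ν rA rB) (o : Pauli) (c : Fin q) :
    AliceReady enc K (i + 1) μ
      ((Todo.policy true (position ν) (Todo.midRound K (decode enc rB) ν), o) :: ν)
      (c :: rA) rB := by
  obtain ⟨a, μ, rfl⟩ : ∃ a l, μ = a :: l := by
    rcases μ with _ | ⟨a, l⟩
    · simpa using h.length_sentA
    · exact ⟨a, l, rfl⟩
  refine ⟨h.length_sentA, by simp [h.length_sentB], by simp [h.length_recvA], h.length_recvB,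
    Todo.isWalk_turn_other (by simp) _ h.walkA, Todo.isWalk_turn_self _ h.walkB, ?_⟩
  refine Todo.progress_bob h.walkB h.length_le ?_
  rw [badCount_eq enc (h.length_sentA.trans h.length_recvB.symm)]
  simp only [List.tail_cons]
  by_cases hd : decode enc rB = a :: μ
  · left
    rw [if_pos hd, hd]
    exact ⟨by omega, rfl⟩
  · right
    rw [if_neg hd]
    omega

/-- At `i = 2 * K` the term `2 * K - i` has vanished. The constant is `8 = 2 * 4`: two letters for a
bad turn, four bad turns for a corrupted symbol. -/
theorem AliceReady.le_edge (henc : IsTreeCode (2 * K) enc) (h : AliceReady enc K (2 * K) μ ν rA rB)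
    {x : Letter × Pauli} (hx : x ∈ (Todo.afterRounds K μ ν).2) :
    (K : ℤ) - (8 * (ham (codeword enc ν) rA + ham (codeword enc μ) rB) : ℕ) ≤ x.1.2.1 := by
  have h1 := badCount_le henc (h.length_sentB.trans h.length_recvA.symm) h.length_sentB.le
  have h2 := badCount_le henc (h.length_sentA.trans h.length_recvB.symm) h.length_sentA.le
  rw [badCount_eq enc (h.length_sentB.trans h.length_recvA.symm)] at h1
  have h3 := h.length_le
  have h4 : (K : ℤ) - (Todo.afterRounds K μ ν).2.length ≤ x.1.2.1 := by
    rcases hb : x.1.1 with _ | _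
    · exact (Todo.le_edge_of_isWalk h.walkA).2 x hx hb
    · exact (Todo.le_edge_of_isWalk h.walkB).2 x hx hb
  omega

end Conversation

/-! ## The simulator -/

/-- Lists of bounded length. -/
abbrev BoundedList (n : ℕ) (Γ : Type) : Type := {l : List Γ // l.length ≤ n}

instance (n : ℕ) (Γ : Type) [Finite Γ] : Fintype (BoundedList n Γ) :=
  (List.finite_length_le Γ n).fintype

instance (n : ℕ) (Γ : Type) [DecidableEq Γ] : DecidableEq (BoundedList n Γ) :=
  Subtype.instDecidableEq

/-- Extension of a list, if there is space. -/
def BoundedList.push {n : ℕ} {Γ : Type} (l : BoundedList n Γ) (x : Γ) : BoundedList n Γ :=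
  if h : l.1.length < n then ⟨x :: l.1, h⟩ else l

theorem BoundedList.push_val {n : ℕ} {Γ : Type} {l : BoundedList n Γ} (x : Γ) (h : l.1.length < n) :
    (l.push x).1 = x :: l.1 := by
  rw [BoundedList.push, dif_pos h]

/-- The messages sent and the symbols received by a party. -/
abbrev Memory (n q : ℕ) : Type := BoundedList n Msg × BoundedList n (Fin q)

instance (n q : ℕ) : DecidableEq (Memory n q) := instDecidableEqProd

section Simulation

variable {n q : ℕ}

/-- Store the symbol received. -/
def Memory.receive (m : Memory n q × Fin q) : Memory n q × Fin q :=
  ((m.1.1, m.1.2.push m.2), m.2)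

/-- Add a message, and encode it into the channel register. -/
def Memory.send (enc : List Msg → Fin q) (dec : Memory n q × Fin q → Pauli × Option Bool)
    (m : Memory n q × Fin q) (o : Pauli) : Memory n q × Fin q :=
  ((m.1.1.push (dec m, o), m.1.2), enc (m.1.1.push (dec m, o)).1)

/-- The action that Alice takes. -/
def aliceDecision (enc : List Msg → Fin q) (K : ℕ) (m : Memory n q × Fin q) :
    Pauli × Option Bool :=
  Todo.policy false (position m.1.1.1) (Todo.afterRounds K m.1.1.1 (decode enc m.1.2.1))

/-- The action that Bob takes. -/
def bobDecision (enc : List Msg → Fin q) (K : ℕ) (m : Memory n q × Fin q) :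
    Pauli × Option Bool :=
  Todo.policy true (position m.1.1.1) (Todo.midRound K (decode enc m.1.2.1) m.1.1.1)

/-- Exchange of the communication qubit with the half of pair number `k - 1`. -/
def loadUnitary (p k : ℕ) : LocalUnitary p :=
  if h : 0 < k ∧ k - 1 < p then ⟨loadMatrix ⟨k - 1, h.2⟩, conjTranspose_loadMatrix_mul _⟩
  else ⟨1, by simp⟩

/-- The location of the communication qubit when `k` pairs have been used and it is Alice's turn. -/
def incoming (p k : ℕ) : Location p :=
  -- Pair `k - 1` served the latest teleportation; for `k = 0` the qubit is still in `C_A`, and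
  -- `loadUnitary` is the identity.
  if h : 0 < k ∧ k - 1 < p then (Location.sent ⟨k - 1, h.2⟩).flip else Location.held p 0

theorem actFst_loadUnitary {p k : ℕ} (hk : k ≤ p) :
    (incoming p k).actFst (loadUnitary p k).1 = Location.held p k := by
  by_cases h : 0 < k ∧ k - 1 < p
  · rw [incoming, loadUnitary, dif_pos h, dif_pos h, Location.actFst_load]
    congr 1
    exact Nat.succ_pred_eq_of_pos h.1
  · obtain rfl : k = 0 := by omega
    rw [incoming, loadUnitary, dif_neg h, dif_neg h]
    funext h₁ h₂ d
    simp [Location.actFst, Matrix.one_apply]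

theorem actSnd_loadUnitary {p k : ℕ} (hk : k < p) :
    (Location.sent ⟨k, hk⟩).actSnd (loadUnitary p (k + 1)).1 = (Location.held p (k + 1)).flip := by
  rw [loadUnitary, dif_pos ⟨by omega, by simpa using hk⟩]
  exact Location.actSnd_load _

theorem incoming_succ {p k : ℕ} (hk : k < p) :
    incoming p (k + 1) = (Location.sent ⟨k, hk⟩).flip := by
  rw [incoming, dif_pos ⟨by omega, by simpa using hk⟩]
  rfl

/-- The reception of a symbol by Alice in turn `i`. -/
def aliceReceive (i : ℕ) (m : Memory n q × Fin q) : Memory n q × Fin q :=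
  -- In turn 0 the channel register holds its initial value, which is not a received symbol.
  if i = 0 then m else Memory.receive m

/-- The simulator with `n` rounds that uses the tree code `enc` and follows the protocol for `K`
steps. -/
abbrev treeSimulator (N n K : ℕ) {q : ℕ} (hq : 2 ≤ q) (enc : List Msg → Fin q) :
    Simulator N q where
  two_le := hq
  rounds := n
  -- One pair for each transmission: Alice uses number `2 * i` and Bob number `2 * i + 1`.
  pairs := 2 * n
  X := Memory n q
  Y := Memory n q
  x₀ := (⟨[], Nat.zero_le _⟩, ⟨[], Nat.zero_le _⟩)
  y₀ := (⟨[], Nat.zero_le _⟩, ⟨[], Nat.zero_le _⟩)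
  WA := Unit
  WB := Unit
  wA₀ := ()
  wB₀ := ()
  alice i := if h : i < n then
      aliceActions (loadUnitary (2 * n) (2 * i)) (aliceReceive i) (aliceDecision enc K)
        (fun m => position m.1.1.1) (Memory.send enc (aliceDecision enc K)) ⟨2 * i, by omega⟩
    -- After the last round Alice merely moves her register to the output; the last symbol is not
    -- used.
    else [.swap fun _ => true]
  bob i := if h : i < n then
      bobActions (loadUnitary (2 * n) (2 * i + 1)) Memory.receive (bobDecision enc K)
        (fun m => position m.1.1.1) (Memory.send enc (bobDecision enc K)) ⟨2 * i + 1, by omega⟩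
        -- Bob has no turn after the last round, so he moves his register to the output in his last
        -- turn.
        (decide (i + 1 = n))
    else []

end Simulation

/-! ## The branches of the simulation -/

section Simulation

open Simulator

variable {N n K q : ℕ} {hq : 2 ≤ q} {enc : List Msg → Fin q} {a b e : Type} [Fintype a]
  [DecidableEq a] [Inhabited a] [Fintype b] [DecidableEq b] [Inhabited b] [Fintype e]
  [DecidableEq e] {P : NoiselessProtocol N a b} {E : Adversary q e}

theorem fst_fst_aliceReceive (i : ℕ) (m : Memory n q × Fin q) :
    (aliceReceive i m).1.1 = m.1.1 := by
  unfold aliceReceive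
  split_ifs <;> rfl

/-- The branches when Alice is about to begin turn `i`. -/
def AtAlice (hq : 2 ≤ q) (enc : List Msg → Fin q) (K : ℕ) (P : NoiselessProtocol N a b)
    (E : Adversary q e) (i : ℕ)
    (m : (treeSimulator N n K hq enc).Classical E)
    (V : Matrix ((treeSimulator N n K hq enc).Quantum a b E) (a × b × Bool × e) ℂ) : Prop :=
  ∃ k O, Trajectory E (2 * i) k m.2.2.1 O ∧
    AliceReady enc K i m.1.1.1 m.2.1.1.1 (aliceReceive i (m.1, m.2.2.2)).1.2.1 m.2.1.2.1 ∧
    k = ham (codeword enc m.2.1.1.1) (aliceReceive i (m.1, m.2.2.2)).1.2.1 +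
      ham (codeword enc m.1.1.1) m.2.1.2.1 ∧
    ∃ Ψ, Leads P (Todo.afterRounds K m.1.1.1 m.2.1.1.1) Ψ
        ((onEnv O : CoreOp a b (e × E.W)) * finalCore P e E.w₀) ∧
      V = (treeSimulator N n K hq enc).bobGlobal E (a := a)
          ((treeSimulator N n K hq enc).bobSwap b (decide (i = n))) *
        (treeSimulator N n K hq enc).place E (incoming _ (2 * i)) Ψ

/-- The branches when Alice has finished turn `i`. -/
def AfterAlice (hq : 2 ≤ q) (enc : List Msg → Fin q) (K : ℕ) (P : NoiselessProtocol N a b)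
    (E : Adversary q e) (i : ℕ) (hi : 2 * i < 2 * n)
    (m : (treeSimulator N n K hq enc).Classical E)
    (V : Matrix ((treeSimulator N n K hq enc).Quantum a b E) (a × b × Bool × e) ℂ) : Prop :=
  ∃ k O, Trajectory E (2 * i) k m.2.2.1 O ∧
    m.2.2.2 = enc m.1.1.1 ∧ m.2.1.2.1.length = i ∧
    (∀ c, BobReady enc K i m.1.1.1 m.2.1.1.1 m.1.2.1 (c :: m.2.1.2.1)) ∧
    k = ham (codeword enc m.2.1.1.1) m.1.2.1 + ham (codeword enc m.1.1.1.tail) m.2.1.2.1 ∧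
    ∃ Ψ, Leads P (Todo.midRound K m.1.1.1 m.2.1.1.1) Ψ
        ((onEnv O : CoreOp a b (e × E.W)) * finalCore P e E.w₀) ∧
      V = (treeSimulator N n K hq enc).place E (.sent ⟨2 * i, hi⟩) Ψ

/-- The branches when Bob is about to begin turn `i`. -/
def AtBob (hq : 2 ≤ q) (enc : List Msg → Fin q) (K : ℕ) (P : NoiselessProtocol N a b)
    (E : Adversary q e) (i : ℕ) (hi : 2 * i < 2 * n)
    (m : (treeSimulator N n K hq enc).Classical E)
    (V : Matrix ((treeSimulator N n K hq enc).Quantum a b E) (a × b × Bool × e) ℂ) : Prop :=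
  ∃ k O, Trajectory E (2 * i + 1) k m.2.2.1 O ∧
    m.2.1.2.1.length = i ∧
    BobReady enc K i m.1.1.1 m.2.1.1.1 m.1.2.1 (m.2.2.2 :: m.2.1.2.1) ∧
    k = ham (codeword enc m.2.1.1.1) m.1.2.1 +
      ham (codeword enc m.1.1.1) (m.2.2.2 :: m.2.1.2.1) ∧
    ∃ Ψ, Leads P (Todo.midRound K m.1.1.1 m.2.1.1.1) Ψ
        ((onEnv O : CoreOp a b (e × E.W)) * finalCore P e E.w₀) ∧
      V = (treeSimulator N n K hq enc).place E (.sent ⟨2 * i, hi⟩) Ψ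

/-- The branches when Bob has finished turn `i`. -/
def AfterBob (hq : 2 ≤ q) (enc : List Msg → Fin q) (K : ℕ) (P : NoiselessProtocol N a b)
    (E : Adversary q e) (i : ℕ)
    (m : (treeSimulator N n K hq enc).Classical E)
    (V : Matrix ((treeSimulator N n K hq enc).Quantum a b E) (a × b × Bool × e) ℂ) : Prop :=
  ∃ k O, Trajectory E (2 * i + 1) k m.2.2.1 O ∧
    m.2.2.2 = enc m.2.1.1.1 ∧ m.1.2.1.length = i ∧
    (∀ c, AliceReady enc K (i + 1) m.1.1.1 m.2.1.1.1 (c :: m.1.2.1) m.2.1.2.1) ∧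
    k = ham (codeword enc m.2.1.1.1.tail) m.1.2.1 + ham (codeword enc m.1.1.1) m.2.1.2.1 ∧
    ∃ Ψ, Leads P (Todo.afterRounds K m.1.1.1 m.2.1.1.1) Ψ
        ((onEnv O : CoreOp a b (e × E.W)) * finalCore P e E.w₀) ∧
      V = (treeSimulator N n K hq enc).bobGlobal E (a := a)
          ((treeSimulator N n K hq enc).bobSwap b (decide (i + 1 = n))) *
        (treeSimulator N n K hq enc).place E (incoming _ (2 * (i + 1))) Ψ

theorem AtAlice.afterAlice {i : ℕ} (hi : i < n) {m V m' V'}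
    (h : AtAlice (n := n) hq enc K P E i m V)
    (hs : Steps (((treeSimulator N n K hq enc).alice i).map fun o =>
      (treeSimulator N n K hq enc).onAlice b E (o.kraus P.alice)) m V m' V') :
    AfterAlice hq enc K P E i (by omega) m' V' := by
  obtain ⟨x, y, z, c⟩ := m
  obtain ⟨k, O, hT, hR, hk, Ψ, hL, rfl⟩ := h
  dsimp only at hT hR hk hL
  have ha : (treeSimulator N n K hq enc).alice i = _ := dif_pos hi
  rw [ha, decide_eq_false (by omega : i ≠ n), bobGlobal_bobSwap_false_mul] at hs
  have h0 : 2 * i ≤ 2 * n := by omega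
  obtain ⟨o, rfl, Ψ', rfl, hL'⟩ := steps_aliceActions (S := treeSimulator N n K hq enc)
    (L := loadUnitary (2 * n) (2 * i)) (actFst_loadUnitary h0) hL hs
  have h2 : (aliceReceive i (x, c)).1.1 = x.1 := fst_fst_aliceReceive i _
  have h3 : (aliceReceive i (x, c)).1.1.1.length < n := by
    rw [h2, hR.length_sentA]; exact hi
  have h4 := BoundedList.push_val (aliceDecision enc K (aliceReceive i (x, c)), o) h3
  have h5 : aliceDecision enc K (aliceReceive i (x, c)) =
      Todo.policy false (position x.1.1) (Todo.afterRounds K x.1.1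
        (decode enc (aliceReceive i (x, c)).1.2.1)) := by
    rw [aliceDecision, h2]
  have h6 : (Memory.send enc (aliceDecision enc K) (aliceReceive i (x, c)) o).1.1.1 =
      (Todo.policy false (position x.1.1) (Todo.afterRounds K x.1.1
        (decode enc (aliceReceive i (x, c)).1.2.1)), o) :: x.1.1 := by
    rw [Memory.send]
    dsimp only
    rw [h4, h5, h2]
  refine ⟨k, O, hT, rfl, hR.length_recvB, fun c' => ?_, ?_, Ψ', ?_, rfl⟩
  · dsimp only
    rw [h6]
    exact hR.bobReady o c'
  · dsimp only
    rw [h6, hk]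
    rfl
  · dsimp only
    rw [h6]
    rw [h5, h2] at hL'
    exact hL'

/-- The symbol sent is the newest letter of Alice's codeword, so a change made by the adversary
raises the number of corruptions and the Hamming distance alike. Her operator goes into the target.
-/
theorem AfterAlice.atBob {i : ℕ} {hi : 2 * i < 2 * n} {m V m' V'}
    (h : AfterAlice (n := n) hq enc K P E i hi m V)
    (hs : ((treeSimulator N n K hq enc).onEve a b E (E.step (2 * i)).toKrausFamily).Step
      m V m' V') :
    AtBob hq enc K P E i hi m' V' := by
  obtain ⟨x, y, z, c⟩ := m
  obtain ⟨k, O, hT, hc, hl, hR, hk, Ψ, hL, rfl⟩ := h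
  dsimp only at hT hc hl hR hk hL
  obtain ⟨z', c', j, rfl, rfl⟩ := step_eve hs
  obtain ⟨p, l, hx⟩ : ∃ p l, x.1.1 = p :: l := by
    rcases hx : x.1.1 with _ | ⟨p, l⟩
    · have := (hR c).length_sentA
      rw [hx] at this
      simp at this
    · exact ⟨p, l, rfl⟩
  refine ⟨_, _, hT.succ c c' z' j, hl, hR c', ?_, _, hL.onEnv _, eve_mul_place _ _ _ _ _⟩
  dsimp only
  rw [hk, hc, hx, codeword, ham, List.tail_cons]
  omega

theorem AtBob.afterBob {i : ℕ} {hi : 2 * i < 2 * n} {m V m' V'}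
    (h : AtBob (n := n) hq enc K P E i hi m V)
    (hs : Steps (((treeSimulator N n K hq enc).bob i).map fun o =>
      (treeSimulator N n K hq enc).onBob a E (o.kraus P.bob)) m V m' V') :
    AfterBob hq enc K P E i m' V' := by
  obtain ⟨x, y, z, c⟩ := m
  obtain ⟨k, O, hT, hl, hR, hk, Ψ, hL, rfl⟩ := h
  dsimp only at hT hl hR hk hL
  have ha : (treeSimulator N n K hq enc).bob i = _ := dif_pos (by omega : i < n)
  rw [ha] at hs
  obtain ⟨o, rfl, Ψ', rfl, hL'⟩ := steps_bobActions (actSnd_loadUnitary hi) hL hs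
  have h2 : (Memory.receive (y, c)).1.2.1 = c :: y.2.1 :=
    BoundedList.push_val c (by rw [hl]; omega)
  have h3 : (Memory.receive (y, c)).1.1.1.length < n := by
    change y.1.1.length < n
    rw [hR.length_sentB]; omega
  have h4 := BoundedList.push_val (bobDecision enc K (Memory.receive (y, c)), o) h3
  have h5 : bobDecision enc K (Memory.receive (y, c)) =
      Todo.policy true (position y.1.1) (Todo.midRound K (decode enc (c :: y.2.1)) y.1.1) := by
    rw [bobDecision, h2]
    rfl
  have h6 : (Memory.send enc (bobDecision enc K) (Memory.receive (y, c)) o).1.1.1 =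
      (Todo.policy true (position y.1.1) (Todo.midRound K (decode enc (c :: y.2.1)) y.1.1), o) ::
        y.1.1 := by
    rw [Memory.send]
    dsimp only
    rw [h4, h5]
    rfl
  have h7 : (Memory.send enc (bobDecision enc K) (Memory.receive (y, c)) o).1.2.1 = c :: y.2.1 := h2
  obtain ⟨p, l, hx⟩ : ∃ p l, x.1.1 = p :: l := by
    rcases hx : x.1.1 with _ | ⟨p, l⟩
    · have := hR.length_sentA
      rw [hx] at this
      simp at this
    · exact ⟨p, l, rfl⟩
  refine ⟨k, O, hT, rfl, hR.length_recvA, fun c' => ?_, ?_, Ψ', ?_, ?_⟩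
  · dsimp only
    rw [h6, h7]
    exact hR.aliceReady o c'
  · dsimp only
    rw [h6, h7, hk]
    rfl
  · dsimp only
    rw [h6]
    rw [h5] at hL'
    rw [hx] at hL' ⊢
    exact hL'
  · have h8 : 2 * i + 1 < 2 * n := by omega
    rw [show 2 * (i + 1) = 2 * i + 1 + 1 by ring, incoming_succ h8]

theorem AfterBob.atAlice {i : ℕ} (hi : i < n) {m V m' V'}
    (h : AfterBob (n := n) hq enc K P E i m V)
    (hs : ((treeSimulator N n K hq enc).onEve a b E (E.step (2 * i + 1)).toKrausFamily).Step
      m V m' V') :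
    AtAlice hq enc K P E (i + 1) m' V' := by
  obtain ⟨x, y, z, c⟩ := m
  obtain ⟨k, O, hT, hc, hl, hR, hk, Ψ, hL, rfl⟩ := h
  dsimp only at hT hc hl hR hk hL
  obtain ⟨z', c', j, rfl, rfl⟩ := step_eve hs
  obtain ⟨p, l, hy⟩ : ∃ p l, y.1.1 = p :: l := by
    rcases hy : y.1.1 with _ | ⟨p, l⟩
    · have := (hR c).length_sentB
      rw [hy] at this
      simp at this
    · exact ⟨p, l, rfl⟩
  have h1 : (aliceReceive (i + 1) (x, c')).1.2.1 = c' :: x.2.1 :=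
    BoundedList.push_val c' (by rw [hl]; exact hi)
  refine ⟨_, _, hT.succ c c' z' j, ?_, ?_, _, hL.onEnv _, ?_⟩
  · dsimp only
    rw [h1]
    exact hR c'
  · dsimp only
    rw [h1, hk, hc, hy, codeword, ham, List.tail_cons]
    omega
  -- In the last round Bob's exchange of registers precedes this transmission, and the adversary's
  -- operator has to be moved past it.
  · rw [← Matrix.mul_assoc, eveGlobal_mul_bobGlobal, Matrix.mul_assoc, eve_mul_place]

theorem allBranches_prepare (hn : n ≠ 0) (hK : N / 2 + 2 ≤ K) :
    AllBranches (AtAlice (n := n) hq enc K P E 0)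
      (LinearMap.single ℂ (fun _ : (treeSimulator N n K hq enc).Classical E =>
        Matrix ((treeSimulator N n K hq enc).Quantum a b E)
          ((treeSimulator N n K hq enc).Quantum a b E) ℂ)
        ((treeSimulator N n K hq enc).initialClassical E) ∘ₗ
        conjMap ((treeSimulator N n K hq enc).prepare a b E)) := by
  intro m
  by_cases hm : m = (treeSimulator N n K hq enc).initialClassical E
  · subst hm
    rw [← LinearMap.comp_assoc, LinearMap.proj_comp_single_same, LinearMap.id_comp]
    refine conjMap_mem ⟨0, 1, .zero, aliceReady_zero enc K, rfl,
      ((Real.sqrt 2 : ℝ) : ℂ)⁻¹ ^ (2 * n) • initCore a b e E.w₀,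
      (leads_initCore P E.w₀ hK).smul _, ?_⟩
    -- As `n ≠ 0`, Bob's final exchange is not yet due.
    rw [decide_eq_false hn.symm, bobGlobal_bobSwap_false_mul, prepare_eq]
    rfl
  · have h0 : LinearMap.proj m ∘ₗ LinearMap.single ℂ
        (fun _ : (treeSimulator N n K hq enc).Classical E =>
          Matrix ((treeSimulator N n K hq enc).Quantum a b E)
            ((treeSimulator N n K hq enc).Quantum a b E) ℂ)
        ((treeSimulator N n K hq enc).initialClassical E) = 0 :=
      LinearMap.proj_comp_single_ne _ _ _ _ hm
    rw [← LinearMap.comp_assoc, h0, LinearMap.zero_comp]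
    exact zero_mem _

theorem allBranches_runRounds (hn : n ≠ 0) (hK : N / 2 + 2 ≤ K) {i : ℕ} (hi : i ≤ n) :
    AllBranches (AtAlice (n := n) hq enc K P E i)
      ((treeSimulator N n K hq enc).runRounds P E i ∘ₗ
        LinearMap.single ℂ (fun _ : (treeSimulator N n K hq enc).Classical E =>
          Matrix ((treeSimulator N n K hq enc).Quantum a b E)
            ((treeSimulator N n K hq enc).Quantum a b E) ℂ)
          ((treeSimulator N n K hq enc).initialClassical E) ∘ₗ
          conjMap ((treeSimulator N n K hq enc).prepare a b E)) := by
  induction i with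
  | zero => exact allBranches_prepare hn hK
  | succ i ih =>
    have h1 := AllBranches.turn
      (fun o => (treeSimulator N n K hq enc).onAlice b E (LocalOp.kraus P.alice o))
      ((treeSimulator N n K hq enc).alice i) (ih (by omega))
      (fun m V m' V' h hs => h.afterAlice (by omega) hs)
    have h2 := h1.act ((treeSimulator N n K hq enc).onEve a b E (E.step (2 * i)).toKrausFamily)
      (fun m V m' V' h hs => h.atBob hs)
    have h3 := AllBranches.turn
      (fun o => (treeSimulator N n K hq enc).onBob a E (LocalOp.kraus P.bob o))
      ((treeSimulator N n K hq enc).bob i) h2 (fun m V m' V' h hs => h.afterBob hs)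
    exact h3.act ((treeSimulator N n K hq enc).onEve a b E (E.step (2 * i + 1)).toKrausFamily)
      (fun m V m' V' h hs => h.atAlice (by omega) hs)

end Simulation

/-! ## The output of the simulation -/

section Output

theorem exists_mul_listOp {N : ℕ} {a b Y : Type} [DecidableEq a] [DecidableEq b] [DecidableEq Y]
    [Fintype a] [Fintype b] [Fintype Y] (P : NoiselessProtocol N a b) (l : List (Letter × Pauli)) :
    ∃ M : CoreOp a b Y, M * listOp P l = 1 := by
  induction l with
  | nil => exact ⟨1, one_mul _⟩
  | cons x l ih =>
    obtain ⟨x, p⟩ := x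
    obtain ⟨M, hM⟩ := ih
    refine ⟨letterOp P x.inv * (onC (pauliMatrix p).conjTranspose * M), ?_⟩
    rw [listOp, mul_assoc, mul_assoc, ← mul_assoc M, hM, one_mul, ← mul_assoc (onC _), ← onC_mul,
      conjTranspose_pauliMatrix_mul, onC_one, one_mul, letterOp_inv_mul]

/-- This is for branches in which the adversary's operator is zero. The bound on corruptions says
nothing about them, but their state vanishes because the remaining word is invertible. -/
theorem Leads.eq_zero {N : ℕ} {a b Y γ : Type} [DecidableEq a] [DecidableEq b] [DecidableEq Y]
    [Fintype a] [Fintype b] [Fintype Y] {P : NoiselessProtocol N a b} {τ : Todo}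
    {Ψ : Matrix (CoreReg a b Y) γ ℂ} (h : Leads P τ Ψ 0) : Ψ = 0 := by
  obtain ⟨s, hs⟩ := h
  obtain ⟨M, hM⟩ := exists_mul_listOp (Y := Y) P τ.2
  have h1 : (onC (pauliMatrix τ.1).conjTranspose * M) * (todoOp P τ : CoreOp a b Y) = 1 := by
    rw [todoOp, mul_assoc, ← mul_assoc M, hM, one_mul, ← onC_mul, conjTranspose_pauliMatrix_mul,
      onC_one]
  rw [smul_zero] at hs
  rw [← Matrix.one_mul Ψ, ← h1, Matrix.mul_assoc, hs, Matrix.mul_zero]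

/-! ### Outputs that factor through a unitary -/

section Purification

variable {n o t m x : Type} [Fintype n] [Fintype o] [Fintype t] [Fintype m] [Fintype x]

/-- An operator whose output factors through `U`, up to an operator from the register `x` to the
registers that are traced out. -/
def FactorsThrough (f : o → t → m) (g : o → x → n) (U : Matrix n n ℂ) (V : Matrix m n ℂ) : Prop :=
  ∃ A : t → x → ℂ, ∀ i s k, V (f i s) k = ∑ y, A s y * U (g i y) k

/-- `Q` is the Gram matrix of the columns of `A`, which remains when the discarded registers are
summed over; it does not depend on `ρ`. -/
theorem FactorsThrough.partialTrace {f : o → t → m} {g : o → x → n} {U : Matrix n n ℂ}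
    {V : Matrix m n ℂ} (h : FactorsThrough f g U V) : ∃ Q : x → x → ℂ, ∀ ρ i j,
      partialTrace f (conjMap V ρ) i j = ∑ y, ∑ y', Q y y' * conjMap U ρ (g i y) (g j y') := by
  obtain ⟨A, hA⟩ := h
  refine ⟨fun y y' => ∑ s, A s y * star (A s y'), fun ρ i j => ?_⟩
  have h1 : ∀ (r : Type) (W : Matrix r n ℂ) (u v : r),
      conjMap W ρ u v = W u ⬝ᵥ (ρ.mulVec (star (W v))) := by
    intro r W u v
    simp only [conjMap, LinearMap.coe_mk, AddHom.coe_mk, Matrix.mul_assoc]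
    rfl
  have h2 : ∀ i s, V (f i s) = ∑ y, A s y • U (g i y) := by
    intro i s
    funext k
    rw [hA, Finset.sum_apply]
    rfl
  have h3 : QInteractive.partialTrace f (conjMap V ρ) i j =
      ∑ s, conjMap V ρ (f i s) (f j s) := rfl
  rw [h3]
  simp only [h1, h2, star_sum, star_smul, Matrix.mulVec_sum, Matrix.mulVec_smul, sum_dotProduct,
    dotProduct_sum, smul_dotProduct, dotProduct_smul, smul_eq_mul, Finset.sum_mul, Finset.mul_sum,
    mul_assoc]
  refine Finset.sum_comm.trans ((Finset.sum_congr rfl fun y' _ => Finset.sum_comm).trans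
    (Finset.sum_comm.trans ?_))
  simp only [mul_left_comm]

theorem exists_output_of_allBranches {M : Type} [Fintype M] {f : o → t → m} {g : o → x → n}
    {U : Matrix n n ℂ} {S : M → Matrix m n ℂ → Prop}
    {T : Matrix n n ℂ →ₗ[ℂ] (M → Matrix m m ℂ)} (hT : AllBranches S T)
    (hS : ∀ z V, S z V → FactorsThrough f g U V) : ∃ Q : x → x → ℂ, ∀ ρ i j,
      partialTrace f (∑ z, T ρ z) i j = ∑ y, ∑ y', Q y y' * conjMap U ρ (g i y) (g j y') := by
  have h1 : ∀ z, ∃ Q : x → x → ℂ, ∀ ρ i j,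
      partialTrace f (T ρ z) i j = ∑ y, ∑ y', Q y y' * conjMap U ρ (g i y) (g j y') := by
    intro z
    refine AddSubmonoid.closure_induction (motive := fun F _ => ∃ Q : x → x → ℂ, ∀ ρ i j,
      partialTrace f (F ρ) i j = ∑ y, ∑ y', Q y y' * conjMap U ρ (g i y) (g j y')) ?_ ?_ ?_ (hT z)
    · rintro _ ⟨V, hV, rfl⟩
      exact (hS z V hV).partialTrace
    · exact ⟨0, fun ρ i j => by simp⟩
    · rintro F G _ _ ⟨Q, hQ⟩ ⟨Q', hQ'⟩
      refine ⟨Q + Q', fun ρ i j => ?_⟩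
      rw [LinearMap.add_apply, map_add, Matrix.add_apply, hQ, hQ']
      simp only [Pi.add_apply, add_mul, Finset.sum_add_distrib]
  choose Q hQ using h1
  refine ⟨fun y y' => ∑ z, Q z y y', fun ρ i j => ?_⟩
  rw [map_sum, Matrix.sum_apply]
  simp only [hQ, Finset.sum_mul]
  rw [Finset.sum_comm]
  exact Finset.sum_congr rfl fun y _ => Finset.sum_comm

/-- An output of that form that preserves the trace does not depend on the operator on `x`. -/
theorem eq_of_trace_eq [DecidableEq n] [DecidableEq x] [DecidableEq o] [Nonempty o]
    {g : o → x → n} (hg : ∀ i y i' y', g i y = g i' y' → i = i' ∧ y = y') {U : Matrix n n ℂ}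
    (hU : U * U.conjTranspose = 1) {Q : x → x → ℂ}
    (hQ : ∀ ρ, ∑ i, ∑ y, ∑ y', Q y y' * conjMap U ρ (g i y) (g i y') = ρ.trace) (y y' : x) :
    Q y y' = if y = y' then 1 else 0 := by
  obtain ⟨i₀⟩ := ‹Nonempty o›
  -- This input is turned by `U` into a matrix unit, whose trace condition reads off the single
  -- entry `Q y y'`.
  have h := hQ (U.conjTranspose * Matrix.single (g i₀ y) (g i₀ y') 1 * U)
  have h1 : conjMap U (U.conjTranspose * Matrix.single (g i₀ y) (g i₀ y') 1 * U) =
      Matrix.single (g i₀ y) (g i₀ y') 1 := by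
    simp only [conjMap, LinearMap.coe_mk, AddHom.coe_mk]
    rw [← Matrix.mul_assoc, ← Matrix.mul_assoc, hU, Matrix.one_mul, Matrix.mul_assoc, hU,
      Matrix.mul_one]
  have h2 : (U.conjTranspose * Matrix.single (g i₀ y) (g i₀ y') 1 * U).trace =
      if y = y' then 1 else 0 := by
    rw [Matrix.trace_mul_comm, ← Matrix.mul_assoc, hU, Matrix.one_mul]
    by_cases hy : y = y'
    · subst hy
      simp
    · rw [if_neg hy, Matrix.trace_single_eq_of_ne]
      exact fun h => hy (hg _ _ _ _ h).2
  rw [h1, h2] at h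
  rw [← h, Finset.sum_eq_single i₀, Finset.sum_eq_single y, Finset.sum_eq_single y']
  · simp
  · intro z _ hz
    rw [Matrix.single_apply_of_col_ne, mul_zero]
    exact fun h => hz (hg _ _ _ _ h).2.symm
  · simp
  · intro z _ hz
    refine Finset.sum_eq_zero fun z' _ => ?_
    rw [Matrix.single_apply_of_row_ne, mul_zero]
    exact fun h => hz (hg _ _ _ _ h).2.symm
  · simp
  · intro i _ hi
    refine Finset.sum_eq_zero fun z _ => Finset.sum_eq_zero fun z' _ => ?_
    rw [Matrix.single_apply_of_row_ne, mul_zero]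
    exact fun h => hi (hg _ _ _ _ h).1.symm
  · simp

end Purification

theorem Simulator.conjTranspose_prepare_mul {N q : ℕ} (S : Simulator N q) {a b e : Type}
    [Fintype a] [DecidableEq a] [Inhabited a] [Fintype b] [DecidableEq b] [Inhabited b] [Fintype e]
    [DecidableEq e] (E : Adversary q e) :
    (S.prepare a b E).conjTranspose * S.prepare a b E = 1 := by
  have h0 : ∀ s t : Fin S.pairs → Bool, eprPairs S.pairs s t =
      if s = t then ((Real.sqrt 2 : ℝ) : ℂ)⁻¹ ^ S.pairs else 0 := by
    intro s t
    rw [eprPairs_eq]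
    have : Location.IsFresh 0 s t ↔ s = t := by
      simp [Location.IsFresh, funext_iff]
    simp [this]
  have h1 : ∑ _s : Fin S.pairs → Bool, star (((Real.sqrt 2 : ℝ) : ℂ)⁻¹ ^ S.pairs) *
      ((Real.sqrt 2 : ℝ) : ℂ)⁻¹ ^ S.pairs = 1 := by
    have hs : star (((Real.sqrt 2 : ℝ) : ℂ)⁻¹) * ((Real.sqrt 2 : ℝ) : ℂ)⁻¹ = 2⁻¹ := by
      rw [star_inv₀, Complex.star_def, Complex.conj_ofReal, ← mul_inv, ← Complex.ofReal_mul,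
        Real.mul_self_sqrt (by norm_num)]
      norm_num
    rw [star_pow, ← mul_pow, hs, Finset.sum_const, Finset.card_univ, Fintype.card_fun,
      Fintype.card_bool, Fintype.card_fin, nsmul_eq_mul]
    push_cast
    rw [← mul_pow]
    norm_num
  ext ⟨i, j, c, x⟩ ⟨i', j', c', x'⟩
  simp only [Matrix.mul_apply, Matrix.conjTranspose_apply, Simulator.prepare, Matrix.of_apply,
    Fintype.sum_prod_type, apply_ite star, star_zero, ite_and, ite_mul, mul_ite, mul_zero, zero_mul,
    Finset.sum_ite_irrel, Finset.sum_const_zero, Finset.sum_ite_eq, Finset.sum_ite_eq',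
    Finset.mem_univ, if_true, h0, h1]
  simp only [Matrix.one_apply, Prod.mk.injEq, ite_and, eq_comm (a := i'), eq_comm (a := j'),
    eq_comm (a := c'), eq_comm (a := x')]

end Output

/-! ## Correctness of the simulation -/

section Norm

theorem traceNorm_zero {n : Type} [Fintype n] [DecidableEq n] : traceNorm (0 : Matrix n n ℂ) = 0 := by
  have h : (Matrix.isHermitian_conjTranspose_mul_self (0 : Matrix n n ℂ)).eigenvalues = 0 := by
    rw [Matrix.IsHermitian.eigenvalues_eq_zero_iff]
    simp
  rw [traceNorm]
  refine Finset.sum_eq_zero fun i _ => ?_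
  rw [h, Pi.zero_apply, Real.sqrt_zero]

theorem diamondNorm_zero {n m : Type} [Fintype n] [Fintype m] [DecidableEq n] [DecidableEq m] :
    diamondNorm (0 : Matrix n n ℂ →ₗ[ℂ] Matrix m m ℂ) = 0 := by
  have h : ∀ σ, withReference n (0 : Matrix n n ℂ →ₗ[ℂ] Matrix m m ℂ) σ = 0 := fun σ => by
    ext i j
    simp [withReference]
  simp [diamondNorm, h, traceNorm_zero]

end Norm

section Unitary

variable {N : ℕ} {a b : Type} [Fintype a] [DecidableEq a] [Fintype b] [DecidableEq b]
  (e : Type) [Fintype e] [DecidableEq e]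

theorem onAC_mem_unitaryGroup (U : Matrix.unitaryGroup (a × Bool) ℂ) :
    onAC b e U.1 ∈ Matrix.unitaryGroup (a × b × Bool × e) ℂ := by
  have h : star (onAC b e U.1) = onAC b e U.1.conjTranspose := by
    ext ⟨i, j, c, x⟩ ⟨i', j', c', x'⟩
    simp only [onAC, Matrix.star_apply, Matrix.of_apply, Matrix.conjTranspose_apply,
      apply_ite star, star_zero, eq_comm (a := j'), eq_comm (a := x')]
  rw [Matrix.mem_unitaryGroup_iff, h, ← onAC_mul]
  exact (congrArg _ (Matrix.mem_unitaryGroup_iff.1 U.2)).trans (onAC_one e)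

theorem onBC_mem_unitaryGroup (U : Matrix.unitaryGroup (b × Bool) ℂ) :
    onBC a e U.1 ∈ Matrix.unitaryGroup (a × b × Bool × e) ℂ := by
  have h : star (onBC a e U.1) = onBC a e U.1.conjTranspose := by
    ext ⟨i, j, c, x⟩ ⟨i', j', c', x'⟩
    simp only [onBC, Matrix.star_apply, Matrix.of_apply, Matrix.conjTranspose_apply,
      apply_ite star, star_zero, eq_comm (a := i'), eq_comm (a := x')]
  rw [Matrix.mem_unitaryGroup_iff, h, ← onBC_mul]
  exact (congrArg _ (Matrix.mem_unitaryGroup_iff.1 U.2)).trans (onBC_one e)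

theorem NoiselessProtocol.evolution_mem_unitaryGroup (P : NoiselessProtocol N a b) :
    P.evolution e ∈ Matrix.unitaryGroup (a × b × Bool × e) ℂ := by
  refine mul_mem (onAC_mem_unitaryGroup e _) (Submonoid.list_prod_mem _ fun A hA => ?_)
  rw [List.mem_reverse, List.mem_ofFn] at hA
  obtain ⟨k, rfl⟩ := hA
  exact mul_mem (onBC_mem_unitaryGroup e _) (onAC_mem_unitaryGroup e _)

end Unitary

/-! ### Reading off the output registers -/

namespace Simulator

variable {N q : ℕ} {e : Type} [Fintype e] [DecidableEq e]
  {a b : Type} [Fintype a] [DecidableEq a] [Fintype b] [DecidableEq b] [Inhabited a] [Inhabited b]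

/-- The registers that are discarded at the end. -/
abbrev Discarded (S : Simulator N q) (a b : Type) (E : Adversary q e) : Type :=
  (a × Bool × S.WA × (Fin S.pairs → Bool)) × (b × Bool × S.WB × (Fin S.pairs → Bool)) × (e × E.W)

/-- The arrangement of the output registers and the discarded registers. -/
def outputIndex (S : Simulator N q) (E : Adversary q e) :
    a × b × Bool → S.Discarded a b E → S.Quantum a b E :=
  fun (i', j', c') ((i, cA, wA, tA), (j, cB, wB, tB), y) =>
    ((i, i', cA, c', wA, tA), (j, j', cB, wB, tB), y)

theorem trace_partialTrace_outputIndex (S : Simulator N q) (E : Adversary q e)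
    (σ : Matrix (S.Quantum a b E) (S.Quantum a b E) ℂ) :
    (partialTrace (S.outputIndex E) σ).trace = σ.trace := by
  have h : Function.Bijective fun x : (a × b × Bool) × S.Discarded a b E =>
      S.outputIndex E x.1 x.2 := by
    constructor
    · rintro ⟨⟨i', j', c'⟩, ⟨i, cA, wA, tA⟩, ⟨j, cB, wB, tB⟩, y⟩
        ⟨⟨i'', j'', c''⟩, ⟨i₁, cA₁, wA₁, tA₁⟩, ⟨j₁, cB₁, wB₁, tB₁⟩, y₁⟩ h
      simp only [outputIndex, Prod.mk.injEq] at h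
      simp only [Prod.mk.injEq]
      tauto
    · rintro ⟨⟨i, i', cA, c', wA, tA⟩, ⟨j, j', cB, wB, tB⟩, y⟩
      exact ⟨((i', j', c'), ((i, cA, wA, tA), (j, cB, wB, tB), y)), rfl⟩
  exact (Fintype.sum_prod_type' fun i s => σ (S.outputIndex E i s) (S.outputIndex E i s)).symm.trans
    (Function.Bijective.sum_comp h fun r => σ r r)

/-- In `finalCore` the communication qubit is `false` and the adversary's scratch register is `w₀`,
so `M` and `O` only enter through the columns `M c false` and `O y (x, w₀)`. Their rows, like the
location `κ`, belong to discarded registers, while the two exchanges bring `A` and `B` to the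
output. -/
theorem factorsThrough_place (S : Simulator N q) (E : Adversary q e) (P : NoiselessProtocol N a b)
    (κ : Location S.pairs) (M : Matrix Bool Bool ℂ) (O : Matrix (e × E.W) (e × E.W) ℂ) :
    FactorsThrough (S.outputIndex E) (fun (i, j, c) (x : e) => (i, j, c, x)) (P.evolution e)
      (S.aliceGlobal E (b := b) (swapMatrix a _) * (S.bobGlobal E (a := a) (S.bobSwap b true) *
        S.place E κ ((onC M : CoreOp a b (e × E.W)) *
          ((onEnv O : CoreOp a b (e × E.W)) * finalCore P e E.w₀)))) := by
  refine ⟨fun ((i, cA, wA, tA), (j, cB, wB, tB), y) x =>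
    if (i = default ∧ j = default) ∧ wA = S.wA₀ ∧ wB = S.wB₀ then
      ∑ c, κ (cA, tA) (cB, tB) c * (M c false * O y (x, E.w₀)) else 0, ?_⟩
  rintro ⟨i', j', c'⟩ ⟨⟨i, cA, wA, tA⟩, ⟨j, cB, wB, tB⟩, y⟩ k
  have hs : S.bobSwap b true = swapMatrix b _ := rfl
  rw [outputIndex, kronecker_one_mul_apply, swapMatrix_mul_apply, Matrix.of_apply,
    one_kronecker_mul_apply, kronecker_one_mul_apply, hs, swapMatrix_mul_apply]
  simp only [Matrix.of_apply, place, onC_mul_apply, onEnv_mul_apply, finalCore,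
    Fintype.sum_prod_type]
  by_cases hd : (i = default ∧ j = default) ∧ wA = S.wA₀ ∧ wB = S.wB₀
  · simp only [if_pos hd]
    simp only [Fintype.sum_bool, ite_and, Finset.mul_sum, add_mul, ← Finset.sum_add_distrib]
    simp [mul_assoc, Finset.sum_add_distrib]
  · simp [if_neg hd]

end Simulator

section Main

variable {N n K q : ℕ} {hq : 2 ≤ q} {enc : List Msg → Fin q} {a b e : Type} [Fintype a]
  [DecidableEq a] [Inhabited a] [Fintype b] [DecidableEq b] [Inhabited b] [Fintype e]
  [DecidableEq e]

theorem AtAlice.factorsThrough [Nonempty e] {P : NoiselessProtocol N a b} {E : Adversary q e}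
    (hN : 2 ≤ N) (henc : IsTreeCode (8 * N) enc) (hE : E.CorruptsAtMost (1 / 80) (2 * (8 * N)))
    {m V m' V'} (h : AtAlice (n := 8 * N) hq enc (4 * N) P E (8 * N) m V)
    (hs : Steps (((treeSimulator N (8 * N) (4 * N) hq enc).alice (8 * N)).map fun o =>
      (treeSimulator N (8 * N) (4 * N) hq enc).onAlice b E (o.kraus P.alice)) m V m' V') :
    FactorsThrough ((treeSimulator N (8 * N) (4 * N) hq enc).outputIndex E)
      (fun (i, j, c) (x : e) => (i, j, c, x)) (P.evolution e) V' := by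
  obtain ⟨x, y, z, c⟩ := m
  obtain ⟨k, O, hT, hR, hk, Ψ, hL, rfl⟩ := h
  dsimp only at hT hR hk hL
  have ha : (treeSimulator N (8 * N) (4 * N) hq enc).alice (8 * N) = _ := dif_neg (lt_irrefl _)
  rw [ha] at hs
  obtain ⟨m₁, V₁, h1, rfl, rfl⟩ := hs
  obtain ⟨-, rfl⟩ := Simulator.step_alice_swap h1
  have hΨ : ∃ M : Matrix Bool Bool ℂ, Ψ = (onC M : CoreOp a b (e × E.W)) *
      ((onEnv O : CoreOp a b (e × E.W)) * finalCore P e E.w₀) := by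
    -- Only a trajectory with nonzero operator is subject to the bound on corruptions.
    by_cases hO : O = 0
    · subst hO
      have h0 : (onEnv (0 : Matrix (e × E.W) (e × E.W) ℂ) : CoreOp a b (e × E.W)) = 0 := by
        ext ⟨i, j, c, d, w⟩ ⟨i', j', c', d', w'⟩
        simp [onEnv]
      rw [h0, Matrix.zero_mul] at hL ⊢
      exact ⟨1, by rw [hL.eq_zero, Matrix.mul_zero]⟩
    · have hb := hT.le_of_corruptsAtMost (by omega) hO hE
      -- From `k ≤ 16N / 80 = N / 5`, cleared of denominators.
      have hb' : 40 * k ≤ 8 * N := by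
        have : (40 * k : ℝ) ≤ 8 * N := by push_cast at hb; linarith
        exact_mod_cast this
      refine hL.eq_of_idle fun l hl => ?_
      have hR' : AliceReady enc (4 * N) (2 * (4 * N)) x.1.1 y.1.1
          (aliceReceive (8 * N) (x, c)).1.2.1 y.2.1 := by
        rwa [show 2 * (4 * N) = 8 * N by ring]
      have := hR'.le_edge (by rwa [show 2 * (4 * N) = 8 * N by ring]) hl
      rw [← hk] at this
      push_cast at this ⊢
      -- `4N - 8k ≥ 12N / 5 ≥ N / 2 + 2`, where the last inequality uses `N ≥ 2`.
      omega
  obtain ⟨M, rfl⟩ := hΨ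
  rw [decide_eq_true rfl]
  exact Simulator.factorsThrough_place (treeSimulator N (8 * N) (4 * N) hq enc) E P _ M O

/-- All branches factor through the unitary of the protocol, so the output depends on the adversary
only through a matrix `Q` on `E`. Preservation of the trace for all inputs forces `Q = 1`, which is
the partial trace over `E`. -/
theorem channel_treeSimulator (hN : 2 ≤ N) (henc : IsTreeCode (8 * N) enc)
    (P : NoiselessProtocol N a b) (E : Adversary q e)
    (hE : E.CorruptsAtMost (1 / 80) (2 * (8 * N))) :
    (treeSimulator N (8 * N) (4 * N) hq enc).channel P E = P.channel e := by
  ext1 ρ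
  -- If the basis of `E` is empty, the only input is 0.
  rcases isEmpty_or_nonempty e with he | he
  · rw [Subsingleton.elim ρ 0, map_zero, map_zero]
  set S := treeSimulator N (8 * N) (4 * N) hq enc with hS
  have hbr := AllBranches.turn
    (fun o => S.onAlice b E (LocalOp.kraus P.alice o)) (S.alice (8 * N))
    (allBranches_runRounds (n := 8 * N) (K := 4 * N) (hq := hq) (enc := enc) (P := P) (E := E)
      (by omega) (by omega) le_rfl)
    (S' := fun _ V => FactorsThrough (S.outputIndex E)
      (fun (i, j, c) (x : e) => (i, j, c, x)) (P.evolution e) V)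
    (fun m V m' V' h hs => h.factorsThrough hN henc hE hs)
  obtain ⟨Q, hQ⟩ := exists_output_of_allBranches hbr fun _ _ h => h
  have hQ' : ∀ ρ i j, S.channel P E ρ i j = ∑ x, ∑ x', Q x x' *
      conjMap (P.evolution e) ρ (i.1, i.2.1, i.2.2, x) (j.1, j.2.1, j.2.2, x') := by
    intro ρ i j
    rw [← hQ ρ i j, Simulator.channel]
    simp only [LinearMap.comp_apply, LinearMap.sum_apply, LinearMap.proj_apply]
    rfl
  have htr : ∀ ρ, (S.channel P E ρ).trace = ρ.trace := by
    intro ρ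
    refine (S.trace_partialTrace_outputIndex E _).trans ?_
    rw [LinearMap.comp_apply, LinearMap.sum_apply, Matrix.trace_sum]
    refine (S.totalTrace_aliceTurn P E _ _).trans ((S.totalTrace_runRounds P E _ _).trans ?_)
    rw [LinearMap.comp_apply, totalTrace]
    refine (Finset.sum_eq_single (S.initialClassical E) (fun m _ hm => ?_)
      (fun h => absurd (Finset.mem_univ _) h)).trans ?_
    · rw [LinearMap.single_apply, Pi.single_eq_of_ne hm, Matrix.trace_zero]
    · rw [LinearMap.single_apply, Pi.single_eq_same]
      simp only [conjMap, LinearMap.coe_mk, AddHom.coe_mk]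
      rw [Matrix.trace_mul_comm, ← Matrix.mul_assoc, S.conjTranspose_prepare_mul, Matrix.one_mul]
  have hδ : ∀ x x', Q x x' = if x = x' then 1 else 0 :=
    eq_of_trace_eq (g := fun (i : a × b × Bool) (x : e) => (i.1, i.2.1, i.2.2, x))
      (by rintro ⟨i, j, c⟩ x ⟨i', j', c'⟩ x' h; simpa [and_assoc] using h)
      (Matrix.mem_unitaryGroup_iff.1 (P.evolution_mem_unitaryGroup e))
      (fun ρ => by
        rw [← htr ρ]
        exact Finset.sum_congr rfl fun i _ => (hQ' ρ i i).symm)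
  ext i j
  rw [hQ']
  simp only [hδ, ite_mul, one_mul, zero_mul, Finset.sum_ite_eq, Finset.mem_univ, if_true]
  rfl

theorem succeedsWithError_treeSimulator (hN : 2 ≤ N) (henc : IsTreeCode (8 * N) enc) :
    (treeSimulator N (8 * N) (4 * N) hq enc).SucceedsWithError (1 / 80) 0 := by
  intro a b e _ _ _ _ _ _ _ _ P E hE
  rw [channel_treeSimulator hN henc P E hE, sub_self, diamondNorm_zero]
  exact zero_le

end Main

end QInteractive

end

theorem mainTheorem3 :
    ∃ R_C : ℝ, 0 < R_C ∧ ∃ q : ℕ, 2 ≤ q ∧ ∃ R_E : ℝ, 0 < R_E ∧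
      ∀ N : ℕ, 0 < N → Even N →
        ∃ S : QInteractive.Simulator N q,
          R_C ≤ S.communicationRate ∧
          S.entanglementRate = R_E ∧
          S.SucceedsWithError (1 / 80) 0 := by
  obtain ⟨q, hq, henc⟩ := QInteractive.exists_isTreeCode QInteractive.Msg
  have hlog : 0 < Real.logb 2 q := Real.logb_pos (by norm_num) (by exact_mod_cast hq)
  -- There are `8N` rounds, so `16N` transmissions and as many EPR pairs.
  refine ⟨1 / (16 * Real.logb 2 q), by positivity, q, hq, 1 / Real.logb 2 q, by positivity,
    fun N hN hN' => ?_⟩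
  have hN2 : 2 ≤ N := by
    obtain ⟨r, rfl⟩ := hN'
    omega
  have hN0 : (N : ℝ) ≠ 0 := by positivity
  obtain ⟨enc, henc⟩ := henc (8 * N)
  refine ⟨QInteractive.treeSimulator N (8 * N) (4 * N) hq enc, le_of_eq ?_, ?_,
    QInteractive.succeedsWithError_treeSimulator hN2 henc⟩
  · simp only [QInteractive.Simulator.communicationRate, QInteractive.Simulator.length]
    push_cast
    field_simp
    norm_num
  · simp only [QInteractive.Simulator.entanglementRate, QInteractive.Simulator.length]
    push_cast
    field_simp
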